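/- For a unit vector $P_\infty\in\mathbb{R}^3$, $|P_\infty|=1$, let $H_\infty$ be the operator on $L^2(\mathbb{R}^3;\mathbb{C}^2)$ given by the matrix differential operator $$H_\infty=\begin{pmatrix} P_\infty\cdot\nabla_x & -\Delta\\ -(-\Delta+1) & P_\infty\cdot\nabla_x\end{pmatrix}$$ (in the sense of distributions) on its maximal domain $\{u\in L^2: H_\infty u\in L^2\}$. Write $\|u\|_\infty$ for the essential supremum of the Euclidean length $|u(x)|$, and $\|f\|_{\mathcal H^2}=\|(1-\Delta)f\|_{L^2}$. Let $n\ge \frac34$, let $V:\mathbb{R}^3\to\mathbb{R}$ be a smooth, spherically symmetric function which, together with all its derivatives, decays exponentially fast at infinity, and put $W=(-\Delta)^nV$ and $W^Y(x)=W(Y-x)$ for $Y\in\mathbb{R}^3$. Then $H_\infty$ is injective and generates a strongly continuous semigroup $e^{tH_\infty}$, $t\ge 0$, on $L^2(\mathbb{R}^3;\mathbb{C}^2)$; $W^Y$ is differentiable, $W^Y$ and $\partial_{x_j}W^Y$ ($j=1,2,3$) belong to $L^2$, and $(0,W^Y)^T$ and $(0,\partial_{x_j}W^Y)^T$ lie in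 the domain of $H_\infty^{-1}$. Moreover there are an absolute constant $C$ and a constant $C'$ depending only on $n$ and $V$ such that, for all $t\ge0$, all unit vectors $P_\infty$, all $Y\in\mathbb{R}^3$, $j\in\{1,2,3\}$, and all $\eta_0$ with $(1+|x|)^4\eta_0\in L^2(\mathbb{R}^3;\mathbb{C}^2)$, $$\|e^{tH_\infty}\eta_0\|_\infty\le C(1+t)^{-1}\|(1+|x|)^4\eta_0\|_{\mathcal H^2},$$ $$\|e^{tH_\infty}H_\infty^{-1}(0,W^{Y})^T\|_\infty\le C'(1+t)^{-1},$$ $$\|e^{tH_\infty}H_\infty^{-1}\partial_{x_j}(0,W^{Y})^T\|_\infty\le C'(1+t)^{-1},$$ where the right side of the first bound is $+\infty$ if $(1+|x|)^4\eta_0\notin\mathcal H^2$. -/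

import Mathlib

open MeasureTheory Filter Topology
open scoped NNReal ENNReal FourierTransform SchwartzMap LineDeriv Laplacian ContDiff

namespace Bogoliubov

noncomputable section

/-- Physical space `ℝ³`. -/
abbrev Space : Type := EuclideanSpace ℝ (Fin 3)

/-- `L²(ℝ³; ℂ)`. -/
abbrev L2 : Type := Lp (α := Space) ℂ 2 volume

/-- `L²(ℝ³; ℂ²)`, written as pairs of scalar functions. -/
abbrev State : Type := L2 × L2

/-- Pairs of tempered distributions on `ℝ³`. -/
abbrev Distr : Type := 𝓢'(Space, ℂ) × 𝓢'(Space, ℂ)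

/-- A pair of `L²` functions as a pair of tempered distributions. -/
def toDistr : State →ₗ[ℂ] Distr where
  toFun u := (Lp.toTemperedDistributionCLM ℂ volume 2 u.1,
    Lp.toTemperedDistributionCLM ℂ volume 2 u.2)
  map_add' u v := by simp only [Prod.fst_add, Prod.snd_add, map_add, Prod.mk_add_mk]
  map_smul' c u := by
    simp only [Prod.smul_fst, Prod.smul_snd, map_smul, Prod.smul_mk, RingHom.id_apply]

theorem toDistr_injective : Function.Injective toDistr := by
  have h := LinearMap.ker_eq_bot.1
    (Lp.ker_toTemperedDistributionCLM_eq_bot (E := Space) (F := ℂ) (μ := volume) (p := 2))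
  intro u v huv
  exact Prod.ext (h (congrArg Prod.fst huv)) (h (congrArg Prod.snd huv))

/-- The matrix differential operator
`H_P = [[P · ∇, -Δ], [-(-Δ + 1), P · ∇]]`, acting on pairs of tempered distributions. -/
def diffOp (P : Space) : Distr →ₗ[ℂ] Distr where
  toFun u := (∂_{P} u.1 + (-Δ u.2), -(-Δ u.1 + u.1) + ∂_{P} u.2)
  map_add' u v := by
    simp only [← TemperedDistribution.laplacianCLM_apply, Prod.fst_add, Prod.snd_add, map_add,
      LineDeriv.lineDerivOp_add, Prod.mk_add_mk]
    ext1 <;> simp only <;> abel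
  map_smul' c u := by
    simp only [← TemperedDistribution.laplacianCLM_apply, Prod.smul_fst, Prod.smul_snd, map_smul,
      LineDeriv.lineDerivOp_smul, Prod.smul_mk, RingHom.id_apply, smul_add, smul_neg]

/-- All pairs `(u, g)` of `L²` states with `H_P u = g` in the sense of distributions. -/
def hGraph (P : Space) : Submodule ℂ (State × State) where
  carrier := {x | diffOp P (toDistr x.1) = toDistr x.2}
  add_mem' := by
    intro x y hx hy
    simp only [Set.mem_ofPred_eq, Prod.fst_add, Prod.snd_add, map_add] at hx hy ⊢
    rw [hx, hy]
  zero_mem' := by simp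
  smul_mem' := by
    intro c x hx
    simp only [Set.mem_ofPred_eq, Prod.smul_fst, Prod.smul_snd, map_smul] at hx ⊢
    rw [hx]

/-- The unbounded operator `H_P` on `L²(ℝ³; ℂ²)`, with its maximal domain: all `u` for which the
distribution `H_P u` belongs to `L²`. -/
def H (P : Space) : State →ₗ.[ℂ] State := (hGraph P).toLinearPMap

theorem mem_H_graph (P : Space) (u g : State) :
    (u, g) ∈ (H P).graph ↔ diffOp P (toDistr u) = toDistr g := by
  rw [H, Submodule.toLinearPMap_graph_eq]
  · rfl
  · rintro ⟨u, g⟩ hx hu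
    have hx' : diffOp P (toDistr u) = toDistr g := hx
    simp only at hu
    subst hu
    apply toDistr_injective
    simpa using hx'.symm

/-- `T` is the strongly continuous semigroup `T t = e^{tA}` generated by the (possibly unbounded)
operator `A`: the generator `u ↦ lim_{t ↓ 0} (T t u - u) / t`, on the set of all `u` for which the
limit exists, is exactly `A`. A semigroup is determined by its generator. -/
structure IsSemigroupGeneratedBy (A : State →ₗ.[ℂ] State) (T : ℝ≥0 → State →L[ℂ] State) :
    Prop where
  zero : T 0 = ContinuousLinearMap.id ℂ State
  add : ∀ s t, T (s + t) = (T s).comp (T t)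
  continuous : ∀ u, Continuous fun t => T t u
  generator : ∀ u g, (u, g) ∈ A.graph ↔
    Tendsto (fun t : ℝ≥0 => (t : ℝ)⁻¹ • (T t u - u)) (𝓝[>] 0) (𝓝 g)

/-- `‖u‖_∞`, the essential supremum of the Euclidean length of `u(x) ∈ ℂ²`. -/
def supNorm (u : State) : ℝ≥0∞ :=
  eLpNorm (fun x => Real.sqrt (‖u.1 x‖ ^ 2 + ‖u.2 x‖ ^ 2)) ∞ volume

/-- `‖f‖_{H^s} = ‖(1 - Δ)^{s/2} f‖_{L²}` (equal to `∞` if `f` does not lie in `H^s`). In the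
normalization of `𝓕`, the frequency variable `ξ` corresponds to the momentum `2πξ`. -/
def sobolevNorm (s : ℝ) (f : L2) : ℝ≥0∞ :=
  eLpNorm (fun ξ => (((1 + (2 * Real.pi * ‖ξ‖) ^ 2) ^ (s / 2) : ℝ) : ℂ) * (𝓕 f : L2) ξ) 2 volume

/-- The `H^s` norm of a pair. -/
def sobolevNormPair (s : ℝ) (u : State) : ℝ≥0∞ :=
  (sobolevNorm s u.1 ^ 2 + sobolevNorm s u.2 ^ 2) ^ (1 / 2 : ℝ)

/-- `w(x) = (1 + |x|)⁴ η(x)` almost everywhere. -/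
def IsWeighted (η w : State) : Prop :=
  (∀ᵐ x ∂(volume : Measure Space), w.1 x = (((1 + ‖x‖) ^ 4 : ℝ) : ℂ) * η.1 x) ∧
  (∀ᵐ x ∂(volume : Measure Space), w.2 x = (((1 + ‖x‖) ^ 4 : ℝ) : ℂ) * η.2 x)

/-- Smooth, spherically symmetric, real functions on `ℝ³` that decay exponentially fast at
infinity together with all their derivatives. -/
structure IsAdmissible (V : Space → ℝ) : Prop where
  smooth : ContDiff ℝ ∞ V
  radial : ∀ x y, ‖x‖ = ‖y‖ → V x = V y
  decay : ∃ δ > 0, ∀ m : ℕ, ∃ C : ℝ, ∀ x, ‖iteratedFDeriv ℝ m V x‖ ≤ C * Real.exp (-δ * ‖x‖)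

/-- `W = (-Δ)^n V`, the Fourier multiplier with `|k|^{2n}`, `k = 2πξ`. -/
def potential (n : ℝ) (V : Space → ℝ) : Space → ℂ :=
  𝓕⁻ fun ξ : Space =>
    (((2 * Real.pi * ‖ξ‖) ^ (2 * n) : ℝ) : ℂ) * 𝓕 (fun x : Space => (V x : ℂ)) ξ

/-- `W^Y(x) = W(Y - x)`. -/
def shifted (n : ℝ) (V : Space → ℝ) (Y : Space) : Space → ℂ :=
  fun x => potential n V (Y - x)

/-- `∂_j W^Y`, the partial derivative of `W^Y` in the `j`-th coordinate direction. -/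
def shiftedDeriv (n : ℝ) (V : Space → ℝ) (Y : Space) (j : Fin 3) : Space → ℂ :=
  fun x => fderiv ℝ (shifted n V Y) x (EuclideanSpace.single j 1)

/-- The state `(0, f)ᵀ`. -/
def lower {f : Space → ℂ} (hf : MemLp f 2 volume) : State := (0, hf.toLp f)

end

end Bogoliubov

/-!
On the Fourier side, with momentum `k = 2πξ`, `κ = |k|` and `a = P · k`, the operator `H_P` is
multiplication by the matrix `[[ia, κ²], [-(κ² + 1), ia]]`. Its exponential is explicit: the
translation factor `e^{ita}` times a rotation-like matrix with entries `cos ωt`,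
`(κ / √(1 + κ²)) sin ωt`, `-(√(1 + κ²) / κ) sin ωt`, where `ω = κ √(1 + κ²)` is the Bogoliubov
dispersion relation. The factor `√(1 + κ²) / κ` is singular at zero frequency, but `sin ωt` vanishes
there to the same order, so that all entries are bounded for each `t`.
Hence the multipliers define a strongly continuous semigroup (`semigroup`), whose generator is
`H_P` on its maximal domain (`isSemigroupGeneratedBy_semigroup`). The symbol has determinant
`D = ω² - a² ≥ κ⁴`, nonzero almost everywhere, so that `H_P` is injective (`ker_H`).

The decay comes from one-dimensional integration by parts. The Fourier integral of a radial
function is a one-dimensional integral against `κ² J(κρ)`, where `J(x)` is the integral of `e^{ixu}`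
over `u ∈ [-1, 1]`; both `J` and `x J'(x)` are bounded, hence the kernel of
`e^{iτω} κ^α (1 + κ²)^β` is `O(1/|τ|)` uniformly in space as soon as the amplitude is integrable
against `dκ / κ` (`norm_radial_kernel_le`): the phase satisfies `ω' = (1 + 2κ²) / √(1 + κ²) ≥ 1`
and has no stationary point. The factor `e^{ita}` is a translation in space and does not affect
sup norms.

For the first estimate, write the data as `(1 - Δ)⁻¹ f`. The relevant multipliers are
`(1 + κ²)⁻¹`, `κ (1 + κ²)^{-3/2}` and `κ⁻¹ (1 + κ²)^{-1/2}`, and the flow is bounded by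
`(1 + t)⁻¹ (‖f‖₁ + ‖f‖₂)` (`exists_norm_osc_multiplier_le`). It remains to bound `f = (1 - Δ) η` in
`L¹` and `L²` by the `H²` norm of `w = (1 + |x|)⁴ η`. The weight is not smooth at the origin, but its
second derivatives are `O(|x|⁻¹)` there, which is square integrable in three dimensions and is paired
with the sup norm of `w` (`exists_mass_damp_le`). A regularization of the weight, the density of
Schwartz functions and the lower semicontinuity of the sup norm give the general case
(`exists_weighted_decay`).

For the second and third estimate, the data `H_P⁻¹ (0, W)ᵀ` are `D⁻¹ (-κ², ia) Ŵ` on the frequency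
side, where `Ŵ` is `κ^{2n}` times a Schwartz function. The singular, nonradial factor `D⁻¹` is
written as `∫₀^∞ e^{-s(κ² - a²)} e^{-sκ⁴} ds`. For each `s` the factor `e^{-s(κ² - a²)}` is a
Gaussian average of modulations, harmless for sup norms, and the remaining kernel is radial; the
integral in `s` of the kernel bounds costs three powers of `κ`, which the vanishing of order `2n`
at zero frequency pays for (`exists_norm_resonant_le`). The same vanishing makes the data square
integrable, by `D ≥ κ^{5/2} (κ² - a²)^{3/8}` (`memLp_resonant`). Differentiating `W` only changes the
Schwartz function, and shifting it by `Y` is another modulation (`exists_potential_decay`).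
-/

namespace Bogoliubov

noncomputable section

/-! ### Fourier integrals of radial functions -/

/-- Measure-preserving cylindrical coordinates `ξ = Φ (u, y)` about a prescribed unit axis. -/
theorem exists_axis_coordinates (e : Space) (he : ‖e‖ = 1) :
    ∃ Φ : ℝ × EuclideanSpace ℝ (Fin 2) ≃ₜ Space, MeasurePreserving Φ ∧
      (∀ p, inner ℝ e (Φ p) = p.1) ∧ ∀ p, ‖Φ p‖ = Real.sqrt (p.1 ^ 2 + ‖p.2‖ ^ 2) := by
  let Q := WithLp 2 (ℝ × EuclideanSpace ℝ (Fin 2))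
  have hfr : Module.finrank ℝ Q = Module.finrank ℝ Space := by
    rw [(WithLp.linearEquiv 2 ℝ (ℝ × EuclideanSpace ℝ (Fin 2))).finrank_eq]
    simp
  let Ψ : Q ≃ₗᵢ[ℝ] Space :=
    ((stdOrthonormalBasis ℝ Q).reindex (finCongr hfr)).repr.trans
      (stdOrthonormalBasis ℝ Space).repr.symm
  let v : Q := WithLp.toLp 2 ((1 : ℝ), (0 : EuclideanSpace ℝ (Fin 2)))
  have hv : ‖Ψ v‖ = ‖e‖ := by
    rw [Ψ.norm_map, he, WithLp.prod_norm_eq_of_L2]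
    simp [v]
  let R := Ψ.trans ((Submodule.span ℝ {Ψ v - e})ᗮ.reflection)
  have hR : R v = e := by
    simp only [R, LinearIsometryEquiv.trans_apply]
    exact Submodule.reflection_sub hv
  let c : (ℝ × EuclideanSpace ℝ (Fin 2)) ≃ₜ Q :=
    (WithLp.homeomorphProd 2 ℝ (EuclideanSpace ℝ (Fin 2))).symm
  refine ⟨c.trans R.toHomeomorph, ?_, fun p => ?_, fun p => ?_⟩
  · exact R.measurePreserving.comp
      (WithLp.volume_preserving_toLp (U := ℝ) (V := EuclideanSpace ℝ (Fin 2)))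
  · have h : (c.trans R.toHomeomorph) p = R (WithLp.toLp 2 p) := rfl
    rw [h]
    conv_lhs => rw [← hR]
    rw [R.inner_map_map, WithLp.prod_inner_apply]
    simp [v]
  · have h : (c.trans R.toHomeomorph) p = R (WithLp.toLp 2 p) := rfl
    rw [h, R.norm_map, WithLp.prod_norm_eq_of_L2]
    simp

theorem integral_radial_plane (f : ℝ → ℂ) :
    ∫ y : EuclideanSpace ℝ (Fin 2), f ‖y‖ = (2 * Real.pi : ℝ) • ∫ s in Set.Ioi (0 : ℝ), s • f s := by
  rw [integral_fun_norm_addHaar]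
  have h : (volume : Measure (EuclideanSpace ℝ (Fin 2))).real (Metric.ball 0 1) = Real.pi := by
    simp [Measure.real, EuclideanSpace.volume_ball_fin_two, Real.pi_pos.le]
  rw [h]
  simp [← mul_assoc]

/-- The substitution `r = √(u² + s²)`. -/
theorem integral_comp_sqrt_add_sq (u : ℝ) (F : ℝ → ℂ) :
    ∫ s in Set.Ioi (0 : ℝ), s • F (Real.sqrt (u ^ 2 + s ^ 2)) =
      ∫ r in Set.Ioi |u|, r • F r := by
  have himg : (fun s : ℝ => Real.sqrt (u ^ 2 + s ^ 2)) '' Set.Ioi 0 = Set.Ioi |u| := by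
    ext r
    simp only [Set.mem_image, Set.mem_Ioi]
    constructor
    · rintro ⟨s, hs, rfl⟩
      rw [← Real.sqrt_sq_eq_abs]
      exact Real.sqrt_lt_sqrt (sq_nonneg _) (by nlinarith)
    · intro hr
      have h0 : 0 ≤ |u| := abs_nonneg u
      have h1 : 0 < r ^ 2 - u ^ 2 := by
        rw [← sq_abs u]; nlinarith
      refine ⟨Real.sqrt (r ^ 2 - u ^ 2), Real.sqrt_pos.2 h1, ?_⟩
      rw [Real.sq_sqrt h1.le]
      rw [show u ^ 2 + (r ^ 2 - u ^ 2) = r ^ 2 by ring, Real.sqrt_sq (by linarith)]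
  have hpos : ∀ s ∈ Set.Ioi (0 : ℝ), 0 < u ^ 2 + s ^ 2 := fun s hs => by
    have : (0 : ℝ) < s := hs
    positivity
  rw [← himg, integral_image_eq_integral_abs_deriv_smul measurableSet_Ioi
    (f' := fun s => s / Real.sqrt (u ^ 2 + s ^ 2))]
  · refine setIntegral_congr_fun measurableSet_Ioi fun s hs => ?_
    have h1 := Real.sqrt_pos.2 (hpos s hs)
    have h2 : (0 : ℝ) < s := hs
    rw [abs_of_pos (by positivity), smul_smul, div_mul_cancel₀ _ h1.ne']
  · intro s hs
    have h := ((hasDerivAt_pow 2 s).const_add (u ^ 2)).sqrt (hpos s hs).ne'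
    refine (h.congr_deriv ?_).hasDerivWithinAt
    have h1 := Real.sqrt_pos.2 (hpos s hs)
    field_simp
    simp
  · intro s hs s' hs' h
    have h1 : (0 : ℝ) < s := hs
    have h2 : (0 : ℝ) < s' := hs'
    have h3 : u ^ 2 + s ^ 2 = u ^ 2 + s' ^ 2 := by
      have := congrArg (· ^ 2) h
      simpa only [Real.sq_sqrt (hpos s hs).le, Real.sq_sqrt (hpos s' hs').le] using this
    nlinarith

/-- Integration over spheres in slices orthogonal to the axis `e`: every slice of a sphere of
radius `r` carries the same area element `2π r du`. -/
theorem integral_radial_mul_axial (e : Space) (he : ‖e‖ = 1) (F h : ℝ → ℂ)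
    (hint : Integrable (fun ξ : Space => F ‖ξ‖ * h (inner ℝ e ξ)))
    (hint' : Integrable (fun p : ℝ × ℝ => {p : ℝ × ℝ | |p.1| < p.2}.indicator
      (fun p => h p.1 * (p.2 * F p.2)) p)) :
    ∫ ξ : Space, F ‖ξ‖ * h (inner ℝ e ξ) =
      (2 * Real.pi : ℝ) • ∫ r in Set.Ioi (0 : ℝ), (r * F r) * ∫ u in (-r)..r, h u := by
  obtain ⟨Φ, hΦ, hin, hnorm⟩ := exists_axis_coordinates e he
  have hS : MeasurableSet {p : ℝ × ℝ | |p.1| < p.2} :=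
    measurableSet_lt (by fun_prop) (by fun_prop)
  rw [← hΦ.integral_comp Φ.measurableEmbedding]
  have hI := (hΦ.integrable_comp_emb Φ.measurableEmbedding).2 hint
  simp only [hin, hnorm] at hI ⊢
  rw [Measure.volume_eq_prod] at hI ⊢
  have hI' : Integrable (fun z : ℝ × EuclideanSpace ℝ (Fin 2) =>
      F (Real.sqrt (z.1 ^ 2 + ‖z.2‖ ^ 2)) * h z.1) (volume.prod volume) := by
    convert hI using 2
    simp [hin, hnorm]
  rw [integral_prod _ hI']
  calc
    _ = ∫ u : ℝ, (2 * Real.pi : ℝ) • ∫ r : ℝ, {p : ℝ × ℝ | |p.1| < p.2}.indicator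
          (fun p => h p.1 * (p.2 * F p.2)) (u, r) := by
        refine integral_congr_ae (Eventually.of_forall fun u => ?_)
        simp only
        rw [integral_mul_const, integral_radial_plane (fun s => F (Real.sqrt (u ^ 2 + s ^ 2))),
          integral_comp_sqrt_add_sq, smul_mul_assoc]
        congr 1
        rw [mul_comm, ← integral_const_mul, ← integral_indicator measurableSet_Ioi]
        refine integral_congr_ae (Eventually.of_forall fun r => ?_)
        by_cases hr : |u| < r
        · simp [Set.indicator, hr]
        · simp [Set.indicator, hr]
    _ = _ := by
        rw [integral_smul]
        congr 1
        rw [Measure.volume_eq_prod] at hint'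
        rw [integral_integral_swap (f := fun u r => {p : ℝ × ℝ | |p.1| < p.2}.indicator
          (fun p => h p.1 * (p.2 * F p.2)) (u, r)) hint', ← integral_indicator measurableSet_Ioi]
        refine integral_congr_ae (Eventually.of_forall fun r => ?_)
        by_cases hr : 0 < r
        · simp only [Set.indicator, Set.mem_Ioi, hr, if_true]
          rw [intervalIntegral.integral_of_le (by linarith), ← integral_const_mul,
            integral_Ioc_eq_integral_Ioo, ← integral_indicator measurableSet_Ioo]
          refine integral_congr_ae (Eventually.of_forall fun u => ?_)
          by_cases hu : |u| < r
          · simp [Set.indicator, hu, abs_lt.1 hu, mul_comm]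
          · have : ¬ (-r < u ∧ u < r) := fun h' => hu (abs_lt.2 h')
            simp only [Set.indicator, Set.mem_ofPred_eq, Set.mem_Ioo, hu, this, if_false]
        · have : ∀ u : ℝ, ¬ |u| < r := fun u hu => hr (lt_of_le_of_lt (abs_nonneg u) hu)
          simp [Set.indicator, hr, this]

/-- The integrals `∫_{-1}^1 u^m e^{ixu} du`; up to a constant, `J 0` and `J 1` are the spherical
average of a plane wave and its derivative. -/
def J (m : ℕ) (x : ℝ) : ℂ := ∫ u in (-1 : ℝ)..1, (u : ℂ) ^ m * Complex.exp (Complex.I * (x * u))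

theorem norm_J_le (m : ℕ) (x : ℝ) : ‖J m x‖ ≤ 2 := by
  have := intervalIntegral.norm_integral_le_of_norm_le_const (a := -1) (b := 1) (C := 1)
    (f := fun u : ℝ => (u : ℂ) ^ m * Complex.exp (Complex.I * (x * u))) (fun u hu => by
      rw [Set.uIoc_of_le (by norm_num)] at hu
      have h1 : Complex.I * (x * u) = ((x * u : ℝ) : ℂ) * Complex.I := by push_cast; ring
      rw [norm_mul, h1, Complex.norm_exp_ofReal_mul_I, mul_one, norm_pow, Complex.norm_real]
      exact pow_le_one₀ (norm_nonneg _) (abs_le.2 ⟨hu.1.le, hu.2⟩))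
  calc ‖J m x‖ ≤ 1 * |(1 : ℝ) - (-1)| := this
    _ = 2 := by norm_num

theorem hasDerivAt_J (m : ℕ) (x : ℝ) : HasDerivAt (J m) (Complex.I * J (m + 1) x) x := by
  have h := (intervalIntegral.hasDerivAt_integral_of_dominated_loc_of_deriv_le
    (μ := volume) (a := -1) (b := 1) (x₀ := x) (s := Set.univ) (bound := fun _ => 1)
    (F := fun (x u : ℝ) => (u : ℂ) ^ m * Complex.exp (Complex.I * (x * u)))
    (F' := fun (x u : ℝ) => Complex.I * ((u : ℂ) ^ (m + 1) * Complex.exp (Complex.I * (x * u))))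
    Filter.univ_mem ?_ ?_ ?_ ?_ ?_ ?_).2
  · refine h.congr_deriv ?_
    rw [J, intervalIntegral.integral_const_mul]
  · exact Eventually.of_forall fun y => (by fun_prop : Continuous _).aestronglyMeasurable
  · exact (by fun_prop : Continuous _).intervalIntegrable _ _
  · exact (by fun_prop : Continuous _).aestronglyMeasurable
  · refine Eventually.of_forall fun u hu y _ => ?_
    rw [Set.uIoc_of_le (by norm_num)] at hu
    have h1 : Complex.I * (y * u) = ((y * u : ℝ) : ℂ) * Complex.I := by push_cast; ring
    rw [norm_mul, norm_mul, h1, Complex.norm_exp_ofReal_mul_I, mul_one, norm_pow,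
      Complex.norm_real, Complex.norm_I, one_mul]
    exact pow_le_one₀ (norm_nonneg _) (abs_le.2 ⟨hu.1.le, hu.2⟩)
  · exact intervalIntegrable_const
  · refine Eventually.of_forall fun u _ y _ => ?_
    have h1 : HasDerivAt (fun y : ℝ => Complex.I * ((y : ℂ) * u)) (Complex.I * (1 * u)) y :=
      ((hasDerivAt_id y).ofReal_comp.mul_const _).const_mul _
    refine (h1.cexp.const_mul ((u : ℂ) ^ m)).congr_deriv ?_
    ring

/-- Integrating by parts in `u`, the homogeneous derivative `x J'(x)` is again bounded. -/
theorem norm_mul_J_succ_le (m : ℕ) (x : ℝ) : ‖(x : ℂ) * J (m + 1) x‖ ≤ 2 + 2 * (m + 1) := by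
  have hd : ∀ u : ℝ, HasDerivAt (fun u : ℝ => (u : ℂ) ^ (m + 1) * Complex.exp (Complex.I * (x * u)))
      ((m + 1) * ((u : ℂ) ^ m * Complex.exp (Complex.I * (x * u))) +
        Complex.I * (x * ((u : ℂ) ^ (m + 1) * Complex.exp (Complex.I * (x * u))))) u := by
    intro u
    have h1 : HasDerivAt (fun u : ℝ => Complex.I * ((x : ℂ) * u)) (Complex.I * (x * 1)) u :=
      ((hasDerivAt_id u).ofReal_comp.const_mul _).const_mul _
    have h2 : HasDerivAt (fun u : ℝ => (u : ℂ) ^ (m + 1)) ((m + 1 : ℕ) * (u : ℂ) ^ m) u := by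
      exact ((hasDerivAt_pow (m + 1) (u : ℂ)).comp_ofReal).congr_deriv (by simp)
    refine (h2.mul h1.cexp).congr_deriv ?_
    push_cast
    ring
  have hi := intervalIntegral.integral_eq_sub_of_hasDerivAt (a := -1) (b := 1)
    (fun u _ => hd u) ((by fun_prop : Continuous _).intervalIntegrable _ _)
  rw [intervalIntegral.integral_add ((by fun_prop : Continuous _).intervalIntegrable _ _)
    ((by fun_prop : Continuous _).intervalIntegrable _ _), intervalIntegral.integral_const_mul,
    intervalIntegral.integral_const_mul, intervalIntegral.integral_const_mul] at hi
  have hi' : (m + 1) * J m x + Complex.I * (x * J (m + 1) x) = _ := hi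
  have hk : (x : ℂ) * J (m + 1) x = -Complex.I * (Complex.I * (x * J (m + 1) x)) := by
    rw [← mul_assoc]; simp
  rw [hk, norm_mul, norm_neg, Complex.norm_I, one_mul, eq_sub_of_add_eq' hi']
  have he : ∀ v : ℝ, ‖Complex.exp (Complex.I * (x * v))‖ = 1 := fun v => by
    have h1 : Complex.I * (x * v) = ((x * v : ℝ) : ℂ) * Complex.I := by push_cast; ring
    rw [h1, Complex.norm_exp_ofReal_mul_I]
  refine (norm_sub_le _ _).trans (add_le_add ((norm_sub_le _ _).trans ?_) ?_)
  · rw [norm_mul, norm_mul, he, he]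
    simp
    norm_num
  · rw [norm_mul]
    have h1 : ‖((m : ℂ) + 1)‖ = m + 1 := by
      have : ((m : ℂ) + 1) = ((m + 1 : ℕ) : ℂ) := by push_cast; rfl
      rw [this, Complex.norm_natCast]; push_cast; rfl
    rw [h1, mul_comm]
    exact mul_le_mul_of_nonneg_right (norm_J_le m x) (by positivity)

/-- Functions of the height variable are integrable over the cone `|u| < r` as soon as their
weight `r` times the function is integrable on the half-line. -/
theorem integrable_cone {g : ℝ → ℝ} (hg : Measurable g)
    (hi : IntegrableOn (fun r => r * g r) (Set.Ioi 0)) :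
    Integrable (fun p : ℝ × ℝ => {p : ℝ × ℝ | |p.1| < p.2}.indicator (fun p => g p.2) p) := by
  have hS : MeasurableSet {p : ℝ × ℝ | |p.1| < p.2} :=
    measurableSet_lt (by fun_prop) (by fun_prop)
  have hslice : ∀ r : ℝ, (fun u : ℝ => {p : ℝ × ℝ | |p.1| < p.2}.indicator (fun p => g p.2) (u, r))
      = (Set.Ioo (-r) r).indicator (fun _ => g r) := fun r => by
    ext u
    simp [Set.indicator, abs_lt]
  rw [Measure.volume_eq_prod, integrable_prod_iff' (by
    exact ((hg.comp measurable_snd).indicator hS).aestronglyMeasurable)]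
  refine ⟨Eventually.of_forall fun r => ?_, ?_⟩
  · rw [hslice, integrable_indicator_iff measurableSet_Ioo]
    exact integrableOn_const (by simp)
  · have h1 : (fun r : ℝ => ∫ u : ℝ, ‖{p : ℝ × ℝ | |p.1| < p.2}.indicator (fun p => g p.2) (u, r)‖)
        = (Set.Ioi (0 : ℝ)).indicator (fun r => 2 * ‖r * g r‖) := by
      ext r
      have h2 : ∀ u : ℝ, {p : ℝ × ℝ | |p.1| < p.2}.indicator (fun p => g p.2) (u, r) =
          (Set.Ioo (-r) r).indicator (fun _ => g r) u := fun u => congrFun (hslice r) u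
      simp_rw [h2, norm_indicator_eq_indicator_norm]
      rw [integral_indicator measurableSet_Ioo, setIntegral_const, smul_eq_mul]
      by_cases hr : 0 < r
      · simp [hr, Measure.real, abs_of_pos hr]
        rw [ENNReal.toReal_ofReal (by linarith)]
        ring
      · simp [hr, Measure.real]
    rw [h1, integrable_indicator_iff measurableSet_Ioi]
    exact hi.norm.const_mul 2

theorem integrable_radial_iff {f : ℝ → ℝ} :
    Integrable (fun ξ : Space => f (2 * Real.pi * ‖ξ‖)) ↔
      IntegrableOn (fun κ => κ ^ 2 * f κ) (Set.Ioi 0) := by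
  have h := integrable_fun_norm_addHaar (volume : Measure Space)
    (f := fun r => f (2 * Real.pi * r))
  rw [h]
  have h2 := integrableOn_Ioi_comp_mul_left_iff (fun κ => κ ^ 2 * f κ) 0
    (show (0 : ℝ) < 2 * Real.pi by positivity)
  rw [mul_zero] at h2
  rw [← h2]
  have h3 : (fun y : ℝ => y ^ (Module.finrank ℝ Space - 1) • f (2 * Real.pi * y)) =
      fun y => ((2 * Real.pi) ^ 2)⁻¹ * ((2 * Real.pi * y) ^ 2 * f (2 * Real.pi * y)) := by
    ext y
    have : (2 * Real.pi) ^ 2 ≠ 0 := by positivity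
    simp only [finrank_euclideanSpace, Fintype.card_fin, smul_eq_mul]
    field_simp
  rw [h3]
  exact integrable_const_mul_iff (IsUnit.mk0 _ (by positivity)) _

theorem norm_exp_I (x : ℝ) : ‖Complex.exp (Complex.I * x)‖ = 1 := by
  rw [mul_comm, Complex.norm_exp_ofReal_mul_I]

theorem abs_inner_le_of_unit {e : Space} (he : ‖e‖ = 1) (ξ : Space) : |inner ℝ e ξ| ≤ ‖ξ‖ := by
  simpa [he] using abs_real_inner_le_norm e ξ

theorem radial_kernel_integrable {F : ℝ → ℂ} (hF : Measurable F) (m : ℕ)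
    (hi : IntegrableOn (fun κ => κ ^ (2 + m) * ‖F κ‖) (Set.Ioi 0)) :
    Integrable (fun ξ : Space => F (2 * Real.pi * ‖ξ‖) * (2 * Real.pi * ‖ξ‖ : ℝ) ^ m) := by
  have h1 : Integrable (fun ξ : Space => ‖F (2 * Real.pi * ‖ξ‖)‖ * (2 * Real.pi * ‖ξ‖) ^ m) := by
    rw [integrable_radial_iff (f := fun κ => ‖F κ‖ * κ ^ m)]
    refine hi.congr_fun (fun κ _ => ?_) measurableSet_Ioi
    simp only
    ring
  refine h1.mono' (by fun_prop) (Eventually.of_forall fun ξ => ?_)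
  rw [norm_mul, norm_pow, Complex.norm_real, Real.norm_of_nonneg (by positivity)]

/-- The Fourier integral of a radial function, or of its product with the axial frequency. -/
theorem radial_kernel_formula {e : Space} (he : ‖e‖ = 1) (ρ : ℝ) (m : ℕ) {F : ℝ → ℂ}
    (hF : Measurable F) (hi : IntegrableOn (fun κ => κ ^ (2 + m) * ‖F κ‖) (Set.Ioi 0)) :
    ∫ ξ : Space, F (2 * Real.pi * ‖ξ‖) * ((2 * Real.pi * inner ℝ e ξ : ℝ) : ℂ) ^ m *
        Complex.exp (Complex.I * (2 * Real.pi * (ρ * inner ℝ e ξ) : ℝ)) =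
      ((4 * Real.pi ^ 2)⁻¹ : ℝ) • ∫ κ in Set.Ioi (0 : ℝ), F κ * (κ : ℂ) ^ (2 + m) * J m (κ * ρ) := by
  set c : ℝ := 2 * Real.pi with hc
  have hcpos : 0 < c := by positivity
  let h : ℝ → ℂ := fun u => ((c * u : ℝ) : ℂ) ^ m * Complex.exp (Complex.I * (c * (ρ * u) : ℝ))
  have hh : Continuous h := by fun_prop
  have hnorm : ∀ u, ‖h u‖ = (c * |u|) ^ m := fun u => by
    simp only [h]
    rw [norm_mul, norm_exp_I, mul_one, norm_pow, Complex.norm_real, Real.norm_eq_abs, abs_mul,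
      abs_of_pos hcpos]
  have hFc : Measurable (fun r : ℝ => F (c * r)) := by fun_prop
  have key := integral_radial_mul_axial e he (fun r => F (c * r)) h ?_ ?_
  · calc
      _ = ∫ ξ : Space, F (c * ‖ξ‖) * h (inner ℝ e ξ) := by
          refine integral_congr_ae (Eventually.of_forall fun ξ => ?_)
          simp only [h, mul_assoc]
      _ = _ := key
      _ = c • ∫ r in Set.Ioi (0 : ℝ), (c ^ 2)⁻¹ • (F (c * r) * ((c * r : ℝ) : ℂ) ^ (2 + m) *
            J m (c * r * ρ)) := by
          congr 1
          refine setIntegral_congr_fun measurableSet_Ioi fun r hr => ?_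
          have hr' : (0 : ℝ) < r := hr
          have h1 : ∫ u in (-r)..r, h u = (r : ℂ) * (((c * r : ℝ) : ℂ) ^ m * J m (c * r * ρ)) := by
            have h2 := intervalIntegral.smul_integral_comp_mul_left (a := -1) (b := 1) h r
            rw [mul_neg, mul_one] at h2
            rw [← h2, J, ← intervalIntegral.integral_const_mul, Complex.real_smul]
            congr 1
            refine intervalIntegral.integral_congr fun u _ => ?_
            simp only [h]
            push_cast
            rw [show Complex.I * ((c : ℂ) * (ρ * (r * u))) = Complex.I * (c * r * ρ * u) by ring]
            ring
          simp only [h1, Complex.real_smul]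
          have hc0 : (c : ℂ) ≠ 0 := by exact_mod_cast hcpos.ne'
          push_cast
          field_simp
          ring
      _ = _ := by
          rw [integral_smul, smul_smul]
          have h3 := integral_comp_mul_left_Ioi
            (fun κ : ℝ => F κ * (κ : ℂ) ^ (2 + m) * J m (κ * ρ)) 0 hcpos
          rw [mul_zero] at h3
          rw [h3, smul_smul]
          congr 1
          rw [hc]
          field_simp
          norm_num
  · refine (radial_kernel_integrable hF m hi).mono (by fun_prop) (Eventually.of_forall fun ξ => ?_)
    rw [norm_mul, norm_mul, show ‖_‖ * ‖_‖ = _ from (norm_mul _ _).symm.trans (hnorm _), norm_mul,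
      norm_pow, Complex.norm_real, Real.norm_of_nonneg (by positivity : 0 ≤ 2 * Real.pi * ‖ξ‖)]
    have := abs_inner_le_of_unit he ξ
    gcongr
  · have hg : Measurable (fun r : ℝ => (c * r) ^ m * (r * ‖F (c * r)‖)) := by fun_prop
    have h1 := integrable_cone hg ?_
    · refine h1.mono ?_ (Eventually.of_forall fun p => ?_)
      · refine AEStronglyMeasurable.indicator ?_ (measurableSet_lt (by fun_prop) (by fun_prop))
        exact ((hh.measurable.comp measurable_fst).mul ((Complex.measurable_ofReal.comp
          measurable_snd).mul (hFc.comp measurable_snd))).aestronglyMeasurable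
      · by_cases hp : |p.1| < p.2
        · have hp2 : 0 < p.2 := lt_of_le_of_lt (abs_nonneg _) hp
          simp only [Set.indicator, Set.mem_ofPred_eq, hp, if_true]
          rw [norm_mul, hnorm, norm_mul, Complex.norm_real, norm_mul, norm_mul, norm_norm,
            Real.norm_of_nonneg (by positivity : 0 ≤ (c * p.2) ^ m)]
          gcongr
        · simp [Set.indicator, hp]
    · have h2 := (integrableOn_Ioi_comp_mul_left_iff (fun κ => κ ^ (2 + m) * ‖F κ‖) 0 hcpos).2
        (by simpa using hi)
      refine IntegrableOn.congr_fun (h2.const_mul (c ^ 2)⁻¹) (fun r _ => ?_) measurableSet_Ioi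
      field_simp
      ring

/-! ### Oscillatory integrals with the Bogoliubov phase -/

/-- The Bogoliubov dispersion relation `ω(κ) = κ √(1 + κ²)`. -/
def om (κ : ℝ) : ℝ := κ * Real.sqrt (1 + κ ^ 2)

/-- The group velocity `ω'(κ)`. -/
def om' (κ : ℝ) : ℝ := (1 + 2 * κ ^ 2) / Real.sqrt (1 + κ ^ 2)

theorem sqrt_one_add_sq_pos (κ : ℝ) : 0 < Real.sqrt (1 + κ ^ 2) := Real.sqrt_pos.2 (by positivity)

theorem sq_sqrt_one_add_sq (κ : ℝ) : Real.sqrt (1 + κ ^ 2) ^ 2 = 1 + κ ^ 2 :=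
  Real.sq_sqrt (by positivity)

theorem hasDerivAt_om (κ : ℝ) : HasDerivAt om (om' κ) κ := by
  have h := (hasDerivAt_id κ).mul (((hasDerivAt_pow 2 κ).const_add 1).sqrt
    (by positivity : (1 : ℝ) + κ ^ 2 ≠ 0))
  refine h.congr_deriv ?_
  have h1 := sqrt_one_add_sq_pos κ
  have h2 := sq_sqrt_one_add_sq κ
  simp only [id, om']
  field_simp
  rw [h2]
  ring

theorem om'_pos (κ : ℝ) : 0 < om' κ := div_pos (by positivity) (sqrt_one_add_sq_pos κ)

@[fun_prop]
theorem continuous_om : Continuous om := by unfold om; fun_prop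

@[fun_prop]
theorem continuous_om' : Continuous om' := by
  unfold om'
  exact Continuous.div (by fun_prop) (by fun_prop) fun κ => (sqrt_one_add_sq_pos κ).ne'

/-- Symbol bounds: `f` and its homogeneous derivative `κ f'(κ)` are dominated by `A · M`. -/
def IsSym (A : ℝ) (M f : ℝ → ℝ) : Prop :=
  ∀ κ : ℝ, 0 < κ → DifferentiableAt ℝ f κ ∧ |f κ| ≤ A * M κ ∧ |κ * deriv f κ| ≤ A * M κ

theorem IsSym.of_hasDerivAt {A : ℝ} {M f f' : ℝ → ℝ} (hd : ∀ κ, 0 < κ → HasDerivAt f (f' κ) κ)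
    (h0 : ∀ κ, 0 < κ → |f κ| ≤ A * M κ) (h1 : ∀ κ, 0 < κ → |κ * f' κ| ≤ A * M κ) : IsSym A M f :=
  fun κ hκ => ⟨(hd κ hκ).differentiableAt, h0 κ hκ, by rw [(hd κ hκ).deriv]; exact h1 κ hκ⟩

theorem IsSym.mul {A B : ℝ} {M N f g : ℝ → ℝ} (hf : IsSym A M f) (hg : IsSym B N g) :
    IsSym (2 * (A * B)) (fun κ => M κ * N κ) (fun κ => f κ * g κ) := by
  intro κ hκ
  obtain ⟨df, f0, f1⟩ := hf κ hκ
  obtain ⟨dg, g0, g1⟩ := hg κ hκ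
  have hAM : 0 ≤ A * M κ := (abs_nonneg _).trans f0
  have hBN : 0 ≤ B * N κ := (abs_nonneg _).trans g0
  have hABMN := mul_nonneg hAM hBN
  refine ⟨df.mul dg, ?_, ?_⟩
  · rw [abs_mul]
    have := mul_le_mul f0 g0 (abs_nonneg _) hAM
    nlinarith
  · have h : deriv (fun κ => f κ * g κ) κ = deriv f κ * g κ + f κ * deriv g κ := deriv_mul df dg
    rw [h, show κ * (deriv f κ * g κ + f κ * deriv g κ) =
      (κ * deriv f κ) * g κ + f κ * (κ * deriv g κ) by ring]
    refine (abs_add_le _ _).trans ?_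
    rw [abs_mul, abs_mul (f κ)]
    have h1 := mul_le_mul f1 g0 (abs_nonneg _) hAM
    have h2 := mul_le_mul f0 g1 (abs_nonneg _) hAM
    nlinarith

/-- One integration by parts in the frequency. It gains `1/τ` uniformly in `ρ`, because the
homogeneous derivative of `J m (κ ρ)` is bounded uniformly in `ρ`. -/
theorem norm_oscillatory_le {τ : ℝ} (hτ : τ ≠ 0) (ρ : ℝ) {m : ℕ} (hm : m ≤ 1) {A B : ℝ}
    {M γ : ℝ → ℝ} (hγ : IsSym A M γ) (hM : IntegrableOn (fun κ => M κ / κ) (Set.Ioi 0))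
    (hB : ∀ κ, 0 < κ → |γ κ| ≤ B * (κ / (1 + κ ^ 2)))
    (hβ : IntegrableOn (fun κ => om' κ * γ κ) (Set.Ioi 0)) :
    ‖∫ κ in Set.Ioi (0 : ℝ), Complex.exp (Complex.I * (τ * om κ : ℝ)) *
        (om' κ * γ κ : ℝ) * J m (κ * ρ)‖ ≤
      8 * A / |τ| * ∫ κ in Set.Ioi (0 : ℝ), M κ / κ := by
  let u : ℝ → ℂ := fun κ => (γ κ : ℂ) * J m (κ * ρ)
  let v : ℝ → ℂ := fun κ => Complex.exp (Complex.I * (τ * om κ : ℝ)) / (Complex.I * τ)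
  let v' : ℝ → ℂ := fun κ => om' κ * Complex.exp (Complex.I * (τ * om κ : ℝ))
  have hτc : (τ : ℂ) ≠ 0 := by exact_mod_cast hτ
  have hdu : ∀ κ ∈ Set.Ioi (0 : ℝ), HasDerivAt u
      ((deriv γ κ : ℝ) * J m (κ * ρ) + γ κ * (ρ * (Complex.I * J (m + 1) (κ * ρ)))) κ := by
    intro κ hκ
    have h1 := (hγ κ hκ).1.hasDerivAt.ofReal_comp
    have h2 := HasDerivAt.scomp κ (hasDerivAt_J m (κ * ρ)) ((hasDerivAt_id κ).mul_const ρ)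
    refine (h1.mul h2).congr_deriv ?_
    simp [Function.comp]
  have hdv : ∀ κ ∈ Set.Ioi (0 : ℝ), HasDerivAt v (v' κ) κ := by
    intro κ _
    have h1 := ((hasDerivAt_om κ).const_mul τ).ofReal_comp.const_mul Complex.I
    refine (h1.cexp.div_const (Complex.I * τ)).congr_deriv ?_
    simp only [v']
    push_cast
    field_simp [Complex.I_ne_zero]
  have hnv : ∀ κ, ‖v κ‖ = |τ|⁻¹ := fun κ => by
    simp only [v]
    rw [norm_div, norm_exp_I, norm_mul, Complex.norm_I, Complex.norm_real, one_mul, one_div,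
      Real.norm_eq_abs]
  have hnu : ∀ κ, ‖u κ‖ ≤ |γ κ| * 2 := fun κ => by
    simp only [u]
    rw [norm_mul, Complex.norm_real, Real.norm_eq_abs]
    exact mul_le_mul_of_nonneg_left (norm_J_le _ _) (abs_nonneg _)
  have hnu' : ∀ κ ∈ Set.Ioi (0 : ℝ), ‖deriv u κ‖ ≤ 8 * A * (M κ / κ) := by
    intro κ hκ
    have hκ' : (0 : ℝ) < κ := hκ
    obtain ⟨-, h0, h1⟩ := hγ κ hκ
    have hAM : 0 ≤ A * M κ := (abs_nonneg _).trans h0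
    rw [(hdu κ hκ).deriv]
    have e1 : ‖((deriv γ κ : ℝ) : ℂ) * J m (κ * ρ)‖ ≤ 2 * (A * M κ / κ) := by
      rw [norm_mul, Complex.norm_real, Real.norm_eq_abs]
      have h2 : |deriv γ κ| ≤ A * M κ / κ := by
        rw [le_div_iff₀ hκ', mul_comm]
        rwa [abs_mul, abs_of_pos hκ'] at h1
      nlinarith [norm_J_le m (κ * ρ), norm_nonneg (J m (κ * ρ)), abs_nonneg (deriv γ κ)]
    have e2 : ‖(γ κ : ℂ) * (ρ * (Complex.I * J (m + 1) (κ * ρ)))‖ ≤ 6 * (A * M κ / κ) := by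
      have h3 : (γ κ : ℂ) * (ρ * (Complex.I * J (m + 1) (κ * ρ))) =
          (γ κ / κ : ℝ) * (Complex.I * (((κ * ρ : ℝ) : ℂ) * J (m + 1) (κ * ρ))) := by
        have : (κ : ℂ) ≠ 0 := by exact_mod_cast hκ'.ne'
        push_cast
        field_simp
      rw [h3, norm_mul, norm_mul, Complex.norm_I, one_mul, Complex.norm_real, Real.norm_eq_abs,
        abs_div, abs_of_pos hκ']
      have h4 := norm_mul_J_succ_le m (κ * ρ)
      have h5 : (m : ℝ) ≤ 1 := by exact_mod_cast hm
      have h6 : |γ κ| / κ ≤ A * M κ / κ := by gcongr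
      have h7 : ‖((κ * ρ : ℝ) : ℂ) * J (m + 1) (κ * ρ)‖ ≤ 6 := by linarith
      nlinarith [norm_nonneg (((κ * ρ : ℝ) : ℂ) * J (m + 1) (κ * ρ)),
        div_nonneg (abs_nonneg (γ κ)) hκ'.le]
    calc _ ≤ _ := norm_add_le _ _
      _ ≤ 2 * (A * M κ / κ) + 6 * (A * M κ / κ) := add_le_add e1 e2
      _ = _ := by ring
  have hlim : ∀ l : Filter ℝ, (∀ᶠ κ in l, 0 < κ) →
      Tendsto (fun κ : ℝ => κ / (1 + κ ^ 2)) l (𝓝 0) → Tendsto (u * v) l (𝓝 0) := by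
    intro l hl ht
    refine squeeze_zero_norm' (a := fun κ => B * (κ / (1 + κ ^ 2)) * 2 * |τ|⁻¹) ?_ ?_
    · filter_upwards [hl] with κ hκ
      rw [Pi.mul_apply, norm_mul, hnv]
      have := hB κ hκ
      have := hnu κ
      gcongr
      linarith
    · simpa using ((ht.const_mul B).mul_const 2).mul_const |τ|⁻¹
  have hcu : ContinuousOn u (Set.Ioi 0) := fun κ hκ =>
    (hdu κ hκ).continuousAt.continuousWithinAt
  have hcv : Continuous v := by
    have : Continuous fun κ : ℝ => Complex.exp (Complex.I * (τ * om κ : ℝ)) := by fun_prop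
    exact this.div_const _
  have hcv' : Continuous v' := by simp only [v']; fun_prop
  have huv' : IntegrableOn (u * v') (Set.Ioi 0) := by
    refine Integrable.mono' (hβ.norm.mul_const 2)
      ((hcu.mul hcv'.continuousOn).aestronglyMeasurable measurableSet_Ioi) ?_
    refine Eventually.of_forall fun κ => ?_
    have hnv' : ‖v' κ‖ = ‖om' κ‖ := by
      simp only [v']
      rw [norm_mul, norm_exp_I, mul_one, Complex.norm_real]
    have huv : ‖(u * v') κ‖ = ‖u κ‖ * ‖om' κ‖ := by rw [Pi.mul_apply, norm_mul, hnv']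
    rw [huv, norm_mul (om' κ), Real.norm_eq_abs (γ κ)]
    nlinarith [hnu κ, norm_nonneg (om' κ)]
  have hMi : IntegrableOn (fun κ => 8 * A * (M κ / κ)) (Set.Ioi 0) := hM.const_mul _
  have hbd : ∀ᵐ κ ∂(volume.restrict (Set.Ioi (0 : ℝ))),
      ‖deriv u κ * v κ‖ ≤ 8 * A * (M κ / κ) * |τ|⁻¹ := by
    filter_upwards [ae_restrict_mem measurableSet_Ioi] with κ hκ
    rw [norm_mul, hnv]
    exact mul_le_mul_of_nonneg_right (hnu' κ hκ) (by positivity)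
  have hu'v : IntegrableOn (deriv u * v) (Set.Ioi 0) :=
    Integrable.mono' (hMi.mul_const |τ|⁻¹)
      ((stronglyMeasurable_deriv u).aestronglyMeasurable.mul hcv.aestronglyMeasurable) hbd
  have key := integral_Ioi_mul_deriv_eq_deriv_mul (u := u) (v := v) (u' := deriv u) (v' := v')
    (fun κ hκ => (hdu κ hκ).differentiableAt.hasDerivAt) hdv huv' hu'v
    (hlim _ self_mem_nhdsWithin ?_) (hlim _ (eventually_gt_atTop 0) ?_)
  · have h1 : ∫ κ in Set.Ioi (0 : ℝ), Complex.exp (Complex.I * (τ * om κ : ℝ)) *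
        (om' κ * γ κ : ℝ) * J m (κ * ρ) = ∫ κ in Set.Ioi (0 : ℝ), u κ * v' κ := by
      refine integral_congr_ae (Eventually.of_forall fun κ => ?_)
      simp only [u, v']
      push_cast
      ring
    rw [h1, key, sub_zero, zero_sub, norm_neg]
    calc _ ≤ ∫ κ in Set.Ioi (0 : ℝ), 8 * A * (M κ / κ) * |τ|⁻¹ :=
          norm_integral_le_of_norm_le (hMi.mul_const |τ|⁻¹) hbd
      _ = _ := by
          rw [integral_mul_const, integral_const_mul]
          ring
  · have : Continuous fun κ : ℝ => κ / (1 + κ ^ 2) :=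
      Continuous.div (by fun_prop) (by fun_prop) fun κ => by positivity
    have h2 := this.tendsto 0
    rw [zero_div] at h2
    exact h2.mono_left nhdsWithin_le_nhds
  · refine squeeze_zero' (g := fun κ : ℝ => κ⁻¹) ?_ ?_ tendsto_inv_atTop_zero
    · filter_upwards [eventually_gt_atTop 0] with κ hκ
      positivity
    · filter_upwards [eventually_gt_atTop 0] with κ hκ
      rw [div_le_iff₀ (by positivity)]
      field_simp
      nlinarith

/-- The oscillating factor `e^{iτω(κ)}`. -/
def osc (τ κ : ℝ) : ℂ := Complex.exp (Complex.I * (τ * om κ : ℝ))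

/-- The plane wave `e^{2πi z·ξ}`. -/
def wave (z ξ : Space) : ℂ := Complex.exp (Complex.I * (2 * Real.pi * inner ℝ z ξ : ℝ))

@[simp]
theorem norm_osc (τ κ : ℝ) : ‖osc τ κ‖ = 1 := norm_exp_I _

@[simp]
theorem norm_wave (z ξ : Space) : ‖wave z ξ‖ = 1 := norm_exp_I _

@[fun_prop]
theorem continuous_osc (τ : ℝ) : Continuous (osc τ) := by unfold osc; fun_prop

@[fun_prop]
theorem continuous_wave (z : Space) : Continuous (wave z) := by unfold wave; fun_prop

theorem wave_add (y z ξ : Space) : wave (y + z) ξ = wave y ξ * wave z ξ := by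
  unfold wave
  rw [← Complex.exp_add, inner_add_left]
  congr 1
  push_cast
  ring

theorem exists_unit_smul (z : Space) : ∃ (e : Space) (ρ : ℝ), ‖e‖ = 1 ∧ z = ρ • e := by
  by_cases hz : z = 0
  · exact ⟨EuclideanSpace.single 0 1, 0, by simp, by simp [hz]⟩
  · exact ⟨‖z‖⁻¹ • z, ‖z‖, norm_smul_inv_norm hz, by
      rw [smul_smul, mul_inv_cancel₀ (norm_ne_zero_iff.2 hz), one_smul]⟩

/-- A linear factor transversal to the axis integrates to zero against an axisymmetric function. -/
theorem integral_transversal_eq_zero {e P' : Space} (h : inner ℝ e P' = (0 : ℝ)) (ρ : ℝ)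
    (F : ℝ → ℂ) :
    ∫ ξ : Space, F ‖ξ‖ * ((inner ℝ P' ξ : ℝ) : ℂ) * wave (ρ • e) ξ = 0 := by
  let S := (Submodule.span ℝ {e}).reflection
  have hSe : S e = e := Submodule.reflection_mem_subspace_eq_self
    (Submodule.mem_span_singleton_self e)
  have hSP : S P' = -P' := Submodule.reflection_mem_subspace_orthogonalComplement_eq_neg
    (Submodule.mem_orthogonal_singleton_iff_inner_right.2 h)
  have hsymm : ∀ x y : Space, inner ℝ x (S y) = inner ℝ (S x) y := fun x y => by
    rw [← S.inner_map_map x (S y), Submodule.reflection_reflection]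
  have h1 := S.measurePreserving.integral_comp S.toHomeomorph.measurableEmbedding
    (fun ξ : Space => F ‖ξ‖ * ((inner ℝ P' ξ : ℝ) : ℂ) * wave (ρ • e) ξ)
  have h2 : ∀ ξ : Space, F ‖S ξ‖ * ((inner ℝ P' (S ξ) : ℝ) : ℂ) * wave (ρ • e) (S ξ) =
      -(F ‖ξ‖ * ((inner ℝ P' ξ : ℝ) : ℂ) * wave (ρ • e) ξ) := fun ξ => by
    unfold wave
    rw [S.norm_map, hsymm, hsymm, map_smul, hSe, hSP, inner_neg_left]
    push_cast
    ring
  simp_rw [h2, integral_neg] at h1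
  exact self_eq_neg.1 h1.symm

/-- The convolution kernel of a radial oscillating multiplier, or of its product with one frequency
component, is bounded by a multiple of `1/τ`. -/
theorem norm_radial_kernel_le {τ : ℝ} (hτ : τ ≠ 0) {m : ℕ} (hm : m ≤ 1) {A B : ℝ}
    {M b : ℝ → ℝ} (hb : Measurable b) (hγ : IsSym A M (fun κ => κ ^ (2 + m) * b κ / om' κ))
    (hM : IntegrableOn (fun κ => M κ / κ) (Set.Ioi 0))
    (hB : ∀ κ, 0 < κ → |κ ^ (2 + m) * b κ / om' κ| ≤ B * (κ / (1 + κ ^ 2)))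
    (hβ : IntegrableOn (fun κ => κ ^ (2 + m) * b κ) (Set.Ioi 0)) {P : Space} (hP : ‖P‖ = 1)
    (z : Space) :
    ‖∫ ξ : Space, osc τ (2 * Real.pi * ‖ξ‖) * (b (2 * Real.pi * ‖ξ‖) : ℂ) *
        ((2 * Real.pi * inner ℝ P ξ : ℝ) : ℂ) ^ m * wave z ξ‖ ≤
      8 * A / |τ| * ∫ κ in Set.Ioi (0 : ℝ), M κ / κ := by
  obtain ⟨e, ρ, he, rfl⟩ := exists_unit_smul z
  let F : ℝ → ℂ := fun κ => osc τ κ * b κ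
  have hF : Measurable F := by fun_prop
  have hFi : IntegrableOn (fun κ => κ ^ (2 + m) * ‖F κ‖) (Set.Ioi 0) := by
    refine IntegrableOn.congr_fun hβ.norm (fun κ hκ => ?_) measurableSet_Ioi
    have : (0 : ℝ) < κ := hκ
    simp only [F]
    rw [norm_mul, norm_mul, norm_osc, one_mul, Complex.norm_real,
      Real.norm_of_nonneg (by positivity : 0 ≤ κ ^ (2 + m))]
  have hform := radial_kernel_formula he ρ m hF hFi
  have hAM : 0 ≤ A * ∫ κ in Set.Ioi (0 : ℝ), M κ / κ := by
    rw [← integral_const_mul]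
    refine setIntegral_nonneg measurableSet_Ioi fun κ hκ => ?_
    have h1 := (abs_nonneg _).trans (hγ κ hκ).2.1
    have h2 : (0 : ℝ) < κ := hκ
    rw [← mul_div_assoc]
    positivity
  have hosc := norm_oscillatory_le hτ ρ hm hγ hM hB (hβ.congr_fun (fun κ _ => by
    have := (om'_pos κ).ne'
    field_simp) measurableSet_Ioi)
  have h1 : ∀ κ, Complex.exp (Complex.I * (τ * om κ : ℝ)) *
      (om' κ * (κ ^ (2 + m) * b κ / om' κ) : ℝ) * J m (κ * ρ) =
      F κ * (κ : ℂ) ^ (2 + m) * J m (κ * ρ) := fun κ => by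
    have := (om'_pos κ).ne'
    rw [mul_div_cancel₀ _ this]
    simp only [F, osc]
    push_cast
    ring
  simp_rw [h1] at hosc
  have haxis : ‖∫ ξ : Space, F (2 * Real.pi * ‖ξ‖) * ((2 * Real.pi * inner ℝ e ξ : ℝ) : ℂ) ^ m *
      wave (ρ • e) ξ‖ ≤ 8 * A / |τ| * ∫ κ in Set.Ioi (0 : ℝ), M κ / κ := by
    have h2 : ∀ ξ, wave (ρ • e) ξ = Complex.exp (Complex.I * (2 * Real.pi * (ρ * inner ℝ e ξ) : ℝ)) :=
      fun ξ => by rw [wave, real_inner_smul_left]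
    simp_rw [h2]
    rw [hform, norm_smul, Real.norm_of_nonneg (by positivity)]
    have hpi : (4 * Real.pi ^ 2)⁻¹ ≤ 1 := inv_le_one_of_one_le₀ (by nlinarith [Real.pi_gt_three])
    exact (mul_le_of_le_one_left (norm_nonneg _) hpi).trans hosc
  rcases Nat.le_one_iff_eq_zero_or_eq_one.1 hm with rfl | rfl
  · simpa [F] using haxis
  · let p : ℝ := inner ℝ e P
    let P' : Space := P - p • e
    have hPe : inner ℝ e P' = (0 : ℝ) := by
      simp [P', inner_sub_right, real_inner_smul_right, he, p]
    have hsplit : ∀ ξ, inner ℝ P ξ = p * inner ℝ e ξ + inner ℝ P' ξ := fun ξ => by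
      simp [P', inner_sub_left, real_inner_smul_left]
    have hint : ∀ Q : Space, Integrable (fun ξ : Space => F (2 * Real.pi * ‖ξ‖) *
        ((2 * Real.pi * inner ℝ Q ξ : ℝ) : ℂ) * wave (ρ • e) ξ) := fun Q => by
      refine ((radial_kernel_integrable hF 1 hFi).norm.mul_const ‖Q‖).mono' (by fun_prop)
        (Eventually.of_forall fun ξ => ?_)
      rw [norm_mul, norm_wave, mul_one]
      have := abs_real_inner_le_norm Q ξ
      calc _ = ‖F (2 * Real.pi * ‖ξ‖)‖ * (2 * Real.pi * |inner ℝ Q ξ|) := by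
            rw [norm_mul (F _), Complex.norm_real, Real.norm_eq_abs, abs_mul,
              abs_of_pos Real.two_pi_pos]
        _ ≤ ‖F (2 * Real.pi * ‖ξ‖)‖ * (2 * Real.pi * (‖Q‖ * ‖ξ‖)) := by gcongr
        _ = _ := by
            rw [norm_mul (F _), pow_one, Complex.norm_real, Real.norm_of_nonneg (by positivity)]
            ring
    have h0 : ∫ ξ : Space, F (2 * Real.pi * ‖ξ‖) * ((2 * Real.pi * inner ℝ P' ξ : ℝ) : ℂ) *
        wave (ρ • e) ξ = 0 := by
      have := integral_transversal_eq_zero hPe ρ (fun r => F (2 * Real.pi * r) * (2 * Real.pi : ℝ))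
      rw [← this]
      refine integral_congr_ae (Eventually.of_forall fun ξ => ?_)
      push_cast
      ring
    have h3 : ∫ ξ : Space, F (2 * Real.pi * ‖ξ‖) * ((2 * Real.pi * inner ℝ P ξ : ℝ) : ℂ) ^ 1 *
        wave (ρ • e) ξ = p * ∫ ξ : Space, F (2 * Real.pi * ‖ξ‖) *
          ((2 * Real.pi * inner ℝ e ξ : ℝ) : ℂ) ^ 1 * wave (ρ • e) ξ := by
      rw [← add_zero ((p : ℂ) * _), ← h0, ← integral_const_mul]
      simp only [pow_one]
      rw [← integral_add ((hint e).const_mul _) (hint P')]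
      refine integral_congr_ae (Eventually.of_forall fun ξ => ?_)
      simp only [hsplit]
      push_cast
      ring
    have hp : ‖(p : ℂ)‖ ≤ 1 := by
      rw [Complex.norm_real, Real.norm_eq_abs]
      simpa [hP] using abs_inner_le_of_unit he P
    change ‖∫ ξ : Space, F (2 * Real.pi * ‖ξ‖) * ((2 * Real.pi * inner ℝ P ξ : ℝ) : ℂ) ^ 1 *
        wave (ρ • e) ξ‖ ≤ _
    rw [h3, norm_mul]
    exact (mul_le_of_le_one_left (norm_nonneg _) hp).trans haxis

/-- The profiles `κ^α (1 + κ²)^β`, of which all frequency weights below are built. -/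
def prof (α β κ : ℝ) : ℝ := κ ^ α * (1 + κ ^ 2) ^ β

@[fun_prop]
theorem measurable_prof (α β : ℝ) : Measurable (prof α β) := by unfold prof; fun_prop

theorem prof_nonneg (α β : ℝ) {κ : ℝ} (hκ : 0 ≤ κ) : 0 ≤ prof α β κ := by
  unfold prof; positivity

theorem prof_mul_prof (α β α' β' : ℝ) {κ : ℝ} (hκ : 0 < κ) :
    prof α β κ * prof α' β' κ = prof (α + α') (β + β') κ := by
  unfold prof
  rw [Real.rpow_add hκ, Real.rpow_add (by positivity)]
  ring

theorem pow_mul_prof (k : ℕ) (α β : ℝ) {κ : ℝ} (hκ : 0 < κ) :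
    κ ^ k * prof α β κ = prof (k + α) β κ := by
  unfold prof
  rw [Real.rpow_add hκ, Real.rpow_natCast]
  ring

theorem prof_le_one {α β κ : ℝ} (hα : 0 ≤ α) (h : α + 2 * β ≤ 0) (hκ : 0 < κ) :
    prof α β κ ≤ 1 := by
  have h1 : (1 : ℝ) ≤ 1 + κ ^ 2 := by nlinarith
  have h2 : κ ^ α ≤ (1 + κ ^ 2) ^ (α / 2) := by
    calc κ ^ α = (κ ^ 2) ^ (α / 2) := by
          rw [← Real.rpow_natCast, ← Real.rpow_mul hκ.le]
          congr 1
          push_cast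
          ring
      _ ≤ _ := Real.rpow_le_rpow (by positivity) (by linarith) (by positivity)
  calc prof α β κ ≤ (1 + κ ^ 2) ^ (α / 2) * (1 + κ ^ 2) ^ β := by
        unfold prof
        gcongr
    _ = (1 + κ ^ 2) ^ (α / 2 + β) := by rw [← Real.rpow_add (by positivity)]
    _ ≤ 1 := Real.rpow_le_one_of_one_le_of_nonpos h1 (by linarith)

theorem one_add_rpow_le (β : ℝ) {x : ℝ} (h1 : 1 ≤ x) (h2 : x ≤ 2) : x ^ β ≤ 2 ^ |β| := by
  rcases le_total 0 β with h | h
  · rw [abs_of_nonneg h]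
    exact Real.rpow_le_rpow (by linarith) h2 h
  · exact (Real.rpow_le_one_of_one_le_of_nonpos h1 h).trans
      (Real.one_le_rpow (by norm_num) (abs_nonneg _))

theorem integrableOn_prof {α β : ℝ} (h0 : -1 < α) (h1 : α + 2 * β < -1) :
    IntegrableOn (prof α β) (Set.Ioi 0) := by
  rw [← Set.Ioc_union_Ioi_eq_Ioi (zero_le_one : (0 : ℝ) ≤ 1)]
  refine IntegrableOn.union ?_ ?_
  · have h2 : IntegrableOn (fun κ : ℝ => κ ^ α * 2 ^ |β|) (Set.Ioc 0 1) := by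
      refine Integrable.mul_const ?_ _
      have := (intervalIntegral.intervalIntegrable_rpow' (a := 0) (b := 1) h0).1
      exact this
    refine Integrable.mono' h2 (measurable_prof α β).aestronglyMeasurable ?_
    filter_upwards [ae_restrict_mem measurableSet_Ioc] with κ hκ
    rw [Real.norm_of_nonneg (prof_nonneg α β hκ.1.le)]
    have := one_add_rpow_le β (x := 1 + κ ^ 2) (by nlinarith) (by nlinarith [hκ.1, hκ.2])
    exact mul_le_mul_of_nonneg_left this (Real.rpow_nonneg hκ.1.le _)
  · have h2 : IntegrableOn (fun κ : ℝ => κ ^ (α + 2 * β) * 2 ^ |β|) (Set.Ioi 1) :=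
      (integrableOn_Ioi_rpow_of_lt h1 zero_lt_one).mul_const _
    refine Integrable.mono' h2 (measurable_prof α β).aestronglyMeasurable ?_
    filter_upwards [ae_restrict_mem measurableSet_Ioi] with κ hκ
    have hκ1 : (1 : ℝ) < κ := hκ
    have hκ0 : (0 : ℝ) < κ := by linarith
    rw [Real.norm_of_nonneg (prof_nonneg α β hκ0.le)]
    have h3 : (1 + κ ^ 2) ^ β = κ ^ (2 * β) * (1 + (κ ^ 2)⁻¹) ^ β := by
      rw [Real.rpow_mul hκ0.le, ← Real.mul_rpow (by positivity) (by positivity)]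
      congr 1
      rw [Real.rpow_two]
      field_simp
      ring
    have h4 := one_add_rpow_le β (x := 1 + (κ ^ 2)⁻¹)
      (by have : 0 < (κ ^ 2)⁻¹ := by positivity
          linarith)
      (by have : (κ ^ 2)⁻¹ ≤ 1 := inv_le_one_of_one_le₀ (by nlinarith)
          linarith)
    unfold prof
    rw [h3, Real.rpow_add hκ0, ← mul_assoc]
    exact mul_le_mul_of_nonneg_left h4 (by positivity)

theorem IsSym.congr {A : ℝ} {M f g : ℝ → ℝ} (hf : IsSym A M f) (h : ∀ κ, 0 < κ → g κ = f κ) :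
    IsSym A M g := by
  intro κ hκ
  have he : g =ᶠ[𝓝 κ] f := by
    filter_upwards [lt_mem_nhds hκ] with x hx using h x hx
  obtain ⟨h1, h2, h3⟩ := hf κ hκ
  exact ⟨h1.congr_of_eventuallyEq he, by rwa [h κ hκ], by rwa [he.deriv_eq]⟩

theorem isSym_prof (α β : ℝ) : IsSym (1 + |α| + 2 * |β|) (prof α β) (prof α β) := by
  refine IsSym.of_hasDerivAt (f' := fun κ => α * κ ^ (α - 1) * (1 + κ ^ 2) ^ β +
    κ ^ α * (2 * κ * β * (1 + κ ^ 2) ^ (β - 1))) (fun κ hκ => ?_) (fun κ hκ => ?_) fun κ hκ => ?_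
  · have h1 := Real.hasDerivAt_rpow_const (p := α) (Or.inl hκ.ne')
    have h2 := ((hasDerivAt_pow 2 κ).const_add 1).rpow_const (p := β)
      (Or.inl (by positivity : (1 : ℝ) + κ ^ 2 ≠ 0))
    refine (h1.mul h2).congr_deriv ?_
    simp
  · rw [abs_of_nonneg (prof_nonneg α β hκ.le)]
    have := prof_nonneg α β hκ.le
    nlinarith [abs_nonneg α, abs_nonneg β, mul_nonneg (abs_nonneg α) this,
      mul_nonneg (abs_nonneg β) this]
  · have h3 : κ * (α * κ ^ (α - 1) * (1 + κ ^ 2) ^ β +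
        κ ^ α * (2 * κ * β * (1 + κ ^ 2) ^ (β - 1))) =
        (α + 2 * β * (κ ^ 2 / (1 + κ ^ 2))) * prof α β κ := by
      unfold prof
      rw [Real.rpow_sub_one hκ.ne', Real.rpow_sub_one (by positivity : (1 : ℝ) + κ ^ 2 ≠ 0)]
      field_simp
    rw [h3, abs_mul, abs_of_nonneg (prof_nonneg α β hκ.le)]
    refine mul_le_mul_of_nonneg_right ?_ (prof_nonneg α β hκ.le)
    refine (abs_add_le _ _).trans ?_
    rw [abs_mul, abs_mul, abs_two]
    have h4 : |κ ^ 2 / (1 + κ ^ 2)| ≤ 1 := by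
      rw [abs_of_nonneg (by positivity), div_le_one (by positivity)]
      linarith
    have := mul_le_mul_of_nonneg_left h4 (by positivity : 0 ≤ 2 * |β|)
    linarith

theorem isSym_rat : IsSym 1 (fun _ => 1) (fun κ => (1 + κ ^ 2) / (1 + 2 * κ ^ 2)) := by
  refine IsSym.of_hasDerivAt (f' := fun κ => -2 * κ / (1 + 2 * κ ^ 2) ^ 2)
    (fun κ hκ => ?_) (fun κ hκ => ?_) fun κ hκ => ?_
  · have h1 := (hasDerivAt_pow 2 κ).const_add 1
    have h2 := ((hasDerivAt_pow 2 κ).const_mul 2).const_add 1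
    refine (h1.div h2 (by positivity)).congr_deriv ?_
    field_simp
    norm_num
    ring
  · rw [abs_of_nonneg (by positivity), div_le_iff₀ (by positivity)]
    nlinarith
  · rw [show κ * (-2 * κ / (1 + 2 * κ ^ 2) ^ 2) = -(2 * κ ^ 2 / (1 + 2 * κ ^ 2) ^ 2) by ring, abs_neg,
      abs_of_nonneg (by positivity), div_le_iff₀ (by positivity)]
    nlinarith [sq_nonneg (κ ^ 2)]

theorem mul_exp_neg_le_one (x : ℝ) : x * Real.exp (-x) ≤ 1 := by
  rw [Real.exp_neg, ← div_eq_mul_inv, div_le_one (Real.exp_pos x)]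
  linarith [Real.add_one_le_exp x]

theorem isSym_gauss {δ : ℝ} (hδ : 0 ≤ δ) :
    IsSym 2 (fun _ => 1) (fun κ => Real.exp (-(δ * κ ^ 2))) := by
  refine IsSym.of_hasDerivAt (f' := fun κ => Real.exp (-(δ * κ ^ 2)) * (-(δ * (2 * κ))))
    (fun κ hκ => ?_) (fun κ hκ => ?_) fun κ hκ => ?_
  · have h1 := ((hasDerivAt_pow 2 κ).const_mul δ).neg.exp
    refine h1.congr_deriv ?_
    simp
  · rw [abs_of_nonneg (Real.exp_nonneg _)]
    have : Real.exp (-(δ * κ ^ 2)) ≤ 1 := Real.exp_le_one_iff.2 (by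
      have : 0 ≤ δ * κ ^ 2 := by positivity
      linarith)
    linarith
  · rw [show κ * (Real.exp (-(δ * κ ^ 2)) * (-(δ * (2 * κ)))) =
      -(2 * (δ * κ ^ 2 * Real.exp (-(δ * κ ^ 2)))) by ring, abs_neg, abs_of_nonneg (by positivity)]
    linarith [mul_exp_neg_le_one (δ * κ ^ 2)]

theorem exp_neg_mul_sq_le {δ : ℝ} (hδ : 0 < δ) (κ : ℝ) :
    Real.exp (-(δ * κ ^ 2)) ≤ (1 + δ⁻¹) * (1 + κ ^ 2)⁻¹ := by
  rw [Real.exp_neg, ← div_eq_mul_inv, inv_le_comm₀ (Real.exp_pos _) (by positivity), inv_div,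
    div_le_iff₀ (by positivity)]
  have h5 := Real.add_one_le_exp (δ * κ ^ 2)
  have h6 : (δ * κ ^ 2 + 1) * (1 + δ⁻¹) = 1 + κ ^ 2 + δ * κ ^ 2 + δ⁻¹ := by
    field_simp
    ring
  have h7 : 0 ≤ δ * κ ^ 2 + δ⁻¹ := by positivity
  have h8 := mul_le_mul_of_nonneg_right h5 (by positivity : 0 ≤ 1 + δ⁻¹)
  linarith

theorem isSym_quartic {s : ℝ} (hs : 0 ≤ s) :
    IsSym 8 (fun κ => Real.exp (-(s * κ ^ 4 / 2))) (fun κ => Real.exp (-(s * κ ^ 4))) := by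
  have hexp : ∀ κ : ℝ, Real.exp (-(s * κ ^ 4)) =
      Real.exp (-(s * κ ^ 4 / 2)) * Real.exp (-(s * κ ^ 4 / 2)) := fun κ => by
    rw [← Real.exp_add]
    congr 1
    ring
  refine IsSym.of_hasDerivAt (f' := fun κ => Real.exp (-(s * κ ^ 4)) * (-(s * (4 * κ ^ 3))))
    (fun κ hκ => ?_) (fun κ hκ => ?_) fun κ hκ => ?_
  · have h1 := ((hasDerivAt_pow 4 κ).const_mul s).neg.exp
    refine h1.congr_deriv ?_
    simp
  · rw [abs_of_nonneg (Real.exp_nonneg _), hexp]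
    have : Real.exp (-(s * κ ^ 4 / 2)) ≤ 1 := Real.exp_le_one_iff.2 (by
      have : 0 ≤ s * κ ^ 4 / 2 := by positivity
      linarith)
    nlinarith [Real.exp_pos (-(s * κ ^ 4 / 2))]
  · rw [show κ * (Real.exp (-(s * κ ^ 4)) * (-(s * (4 * κ ^ 3)))) =
      -(8 * ((s * κ ^ 4 / 2) * Real.exp (-(s * κ ^ 4)))) by ring, abs_neg,
      abs_of_nonneg (by positivity), hexp, ← mul_assoc (s * κ ^ 4 / 2)]
    nlinarith [mul_exp_neg_le_one (s * κ ^ 4 / 2), Real.exp_pos (-(s * κ ^ 4 / 2))]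

theorem inv_om'_eq {κ : ℝ} : (om' κ)⁻¹ = (1 + κ ^ 2) ^ (-(1 / 2) : ℝ) *
    ((1 + κ ^ 2) / (1 + 2 * κ ^ 2)) := by
  have h : (0 : ℝ) < 1 + κ ^ 2 := by positivity
  rw [om', Real.rpow_neg h.le, ← Real.sqrt_eq_rpow]
  have h1 := sqrt_one_add_sq_pos κ
  have h2 := sq_sqrt_one_add_sq κ
  field_simp
  exact h2

theorem kernel_profile_eq (m : ℕ) (α β : ℝ) (g : ℝ → ℝ) {κ : ℝ} (hκ : 0 < κ) :
    κ ^ (2 + m) * (prof α β κ * g κ) / om' κ =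
      prof (2 + m + α) (β - 1 / 2) κ * ((1 + κ ^ 2) / (1 + 2 * κ ^ 2)) * g κ := by
  have h := pow_mul_prof (2 + m) α β hκ
  push_cast at h
  have h3 : prof (2 + m + α) (β - 1 / 2) κ =
      prof (2 + m + α) β κ * (1 + κ ^ 2) ^ (-(1 / 2) : ℝ) := by
    unfold prof
    rw [sub_eq_add_neg, Real.rpow_add (by positivity : (0 : ℝ) < 1 + κ ^ 2)]
    ring
  rw [div_eq_mul_inv, inv_om'_eq, ← mul_assoc, ← mul_assoc (κ ^ (2 + m)), h, h3]
  ring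

theorem prof_div (α β : ℝ) {κ : ℝ} (hκ : 0 < κ) : prof α β κ / κ = prof (α - 1) β κ := by
  unfold prof
  rw [Real.rpow_sub_one hκ.ne']
  ring

theorem prof_le_profile_one {α β κ : ℝ} (hα : 1 ≤ α) (h : α + 2 * β ≤ -1) (hκ : 0 < κ) :
    prof α β κ ≤ κ / (1 + κ ^ 2) := by
  have h1 : κ / (1 + κ ^ 2) = prof 1 (-1) κ := by
    unfold prof
    rw [Real.rpow_one, Real.rpow_neg_one, div_eq_mul_inv]
  have h2 : prof α β κ = prof (α - 1) (β + 1) κ * prof 1 (-1) κ := by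
    rw [prof_mul_prof _ _ _ _ hκ]
    ring_nf
  rw [h1, h2]
  exact mul_le_of_le_one_left (prof_nonneg _ _ hκ.le) (prof_le_one (by linarith) (by linarith) hκ)

/-- Regularized kernels `e^{iτω} κ^α (1 + κ²)^β e^{-δκ²}` decay like `1/τ`, uniformly in `δ`. -/
theorem exists_norm_gauss_kernel_le {α β : ℝ} (hα : -1 ≤ α) (hαβ : α + 2 * β ≤ -2) :
    ∃ C : ℝ, 0 ≤ C ∧ ∀ δ : ℝ, 0 < δ → ∀ τ : ℝ, τ ≠ 0 → ∀ z : Space,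
      ‖∫ ξ : Space, osc τ (2 * Real.pi * ‖ξ‖) *
        ((prof α β (2 * Real.pi * ‖ξ‖) * Real.exp (-(δ * (2 * Real.pi * ‖ξ‖) ^ 2)) : ℝ) : ℂ) *
          wave z ξ‖ ≤ C / |τ| := by
  let M : ℝ → ℝ := fun κ => prof (2 + α) (β - 1 / 2) κ * 1 * 1
  have hMi : IntegrableOn (fun κ => M κ / κ) (Set.Ioi 0) := by
    refine (integrableOn_prof (α := 1 + α) (β := β - 1 / 2) (by linarith) (by linarith)).congr_fun
      (fun κ hκ => ?_) measurableSet_Ioi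
    simp only [M, mul_one]
    rw [prof_div _ _ hκ]
    ring_nf
  let A : ℝ := 2 * (2 * ((1 + |2 + α| + 2 * |β - 1 / 2|) * 1) * 2)
  have hM0 : 0 ≤ ∫ κ in Set.Ioi (0 : ℝ), M κ / κ := by
    refine setIntegral_nonneg measurableSet_Ioi fun κ hκ => ?_
    have h2 : (0 : ℝ) < κ := hκ
    have := prof_nonneg (2 + α) (β - 1 / 2) h2.le
    simp only [M]
    positivity
  have hA : 0 ≤ A := by positivity
  refine ⟨8 * A * ∫ κ in Set.Ioi (0 : ℝ), M κ / κ, by positivity, fun δ hδ τ hτ z => ?_⟩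
  have hsym : IsSym A M (fun κ => κ ^ (2 + 0) * (prof α β κ * Real.exp (-(δ * κ ^ 2))) / om' κ) := by
    refine (((isSym_prof (2 + α) (β - 1 / 2)).mul isSym_rat).mul (isSym_gauss hδ.le)).congr
      fun κ hκ => ?_
    rw [kernel_profile_eq 0 α β (fun κ => Real.exp (-(δ * κ ^ 2))) hκ]
    simp
  have h := norm_radial_kernel_le hτ (m := 0) (by norm_num) (A := A) (B := A)
    (M := M) (b := fun κ => prof α β κ * Real.exp (-(δ * κ ^ 2))) (by fun_prop) hsym hMi
    (fun κ hκ => (hsym κ hκ).2.1.trans ?_) ?_ (P := EuclideanSpace.single 0 1) (by simp) z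
  · simp only [pow_zero, mul_one] at h
    rwa [div_mul_eq_mul_div] at h
  · refine mul_le_mul_of_nonneg_left ?_ hA
    simp only [M, mul_one]
    exact prof_le_profile_one (by linarith) (by linarith) hκ
  · have h1 := (integrableOn_prof (α := 2 + α) (β := β - 1) (by linarith) (by linarith)).const_mul
      (1 + δ⁻¹)
    refine Integrable.mono' h1 (by fun_prop) ?_
    filter_upwards [ae_restrict_mem measurableSet_Ioi] with κ hκ
    have hκ' : (0 : ℝ) < κ := hκ
    have h2 := pow_mul_prof 2 α β hκ'
    push_cast at h2
    have h3 : prof (2 + α) (β - 1) κ = prof (2 + α) β κ * (1 + κ ^ 2)⁻¹ := by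
      unfold prof
      rw [Real.rpow_sub_one (by positivity)]
      ring
    have h4 := exp_neg_mul_sq_le hδ κ
    have h9 := prof_nonneg (2 + α) β hκ'.le
    rw [add_zero, ← mul_assoc, h2, Real.norm_of_nonneg (by positivity), h3]
    calc _ ≤ _ := mul_le_mul_of_nonneg_left h4 h9
      _ = _ := by ring

/-- Kernels cut off by `e^{-sκ⁴}`, with the dependence on `s` that makes the bound integrable. -/
theorem exists_norm_quartic_kernel_le {α β : ℝ} {m : ℕ} (hm : m ≤ 1) (hα : -1 ≤ m + α)
    (hαβ : m + α + 2 * β < -3) :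
    ∃ C : ℝ, 0 ≤ C ∧ ∀ s : ℝ, 0 ≤ s → ∀ τ : ℝ, τ ≠ 0 → ∀ P : Space, ‖P‖ = 1 → ∀ z : Space,
      ‖∫ ξ : Space, osc τ (2 * Real.pi * ‖ξ‖) *
        ((prof α β (2 * Real.pi * ‖ξ‖) * Real.exp (-(s * (2 * Real.pi * ‖ξ‖) ^ 4)) : ℝ) : ℂ) *
          ((2 * Real.pi * inner ℝ P ξ : ℝ) : ℂ) ^ m * wave z ξ‖ ≤
      C / |τ| * ∫ κ in Set.Ioi (0 : ℝ), prof (1 + m + α) (β - 1 / 2) κ *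
        Real.exp (-(s * κ ^ 4 / 2)) := by
  let A : ℝ := 2 * (2 * ((1 + |2 + m + α| + 2 * |β - 1 / 2|) * 1) * 8)
  have hA : 0 ≤ A := by positivity
  refine ⟨8 * A, by positivity, fun s hs τ hτ P hP z => ?_⟩
  let M : ℝ → ℝ := fun κ => prof (2 + m + α) (β - 1 / 2) κ * 1 * Real.exp (-(s * κ ^ 4 / 2))
  have hexp : ∀ {κ : ℝ} {c : ℝ}, 0 ≤ c → Real.exp (-(c * κ ^ 4)) ≤ 1 := fun hc =>
    Real.exp_le_one_iff.2 (by
      rename_i κ c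
      have : 0 ≤ c * κ ^ 4 := by positivity
      linarith)
  have hexp2 : ∀ κ : ℝ, Real.exp (-(s * κ ^ 4 / 2)) ≤ 1 := fun κ => by
    have := hexp (κ := κ) (c := s / 2) (by positivity)
    rwa [show s / 2 * κ ^ 4 = s * κ ^ 4 / 2 by ring] at this
  have hMeq : ∀ κ ∈ Set.Ioi (0 : ℝ),
      prof (1 + m + α) (β - 1 / 2) κ * Real.exp (-(s * κ ^ 4 / 2)) = M κ / κ := fun κ hκ => by
    simp only [M, mul_one]
    rw [mul_div_right_comm (prof _ _ κ), prof_div _ _ hκ]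
    ring_nf
  have hMi : IntegrableOn (fun κ => M κ / κ) (Set.Ioi 0) := by
    refine IntegrableOn.congr_fun ?_ hMeq measurableSet_Ioi
    refine Integrable.mono' (integrableOn_prof (α := 1 + m + α) (β := β - 1 / 2) (by linarith)
      (by linarith)) (by fun_prop) ?_
    filter_upwards [ae_restrict_mem measurableSet_Ioi] with κ hκ
    have hκ' : (0 : ℝ) < κ := hκ
    have := prof_nonneg (1 + m + α) (β - 1 / 2) hκ'.le
    rw [Real.norm_of_nonneg (by positivity)]
    exact mul_le_of_le_one_right this (hexp2 κ)
  have hsym : IsSym A M (fun κ => κ ^ (2 + m) * (prof α β κ * Real.exp (-(s * κ ^ 4))) / om' κ) := by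
    refine (((isSym_prof (2 + m + α) (β - 1 / 2)).mul isSym_rat).mul (isSym_quartic hs)).congr
      fun κ hκ => ?_
    rw [kernel_profile_eq m α β (fun κ => Real.exp (-(s * κ ^ 4))) hκ]
  have h := norm_radial_kernel_le hτ hm (A := A) (B := A)
    (M := M) (b := fun κ => prof α β κ * Real.exp (-(s * κ ^ 4))) (by fun_prop) hsym hMi
    (fun κ hκ => (hsym κ hκ).2.1.trans ?_) ?_ hP z
  · rwa [setIntegral_congr_fun measurableSet_Ioi hMeq]
  · refine mul_le_mul_of_nonneg_left ?_ hA
    simp only [M, mul_one]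
    exact (mul_le_of_le_one_right (prof_nonneg _ _ hκ.le) (hexp2 κ)).trans
      (prof_le_profile_one (by linarith) (by linarith) hκ)
  · refine Integrable.mono' (integrableOn_prof (α := 2 + m + α) (β := β) (by linarith)
      (by linarith)) (by fun_prop) ?_
    filter_upwards [ae_restrict_mem measurableSet_Ioi] with κ hκ
    have hκ' : (0 : ℝ) < κ := hκ
    have h2 := pow_mul_prof (2 + m) α β hκ'
    push_cast at h2
    have h9 := prof_nonneg (2 + m + α) β hκ'.le
    rw [← mul_assoc, h2, Real.norm_of_nonneg (by positivity)]
    exact mul_le_of_le_one_right h9 (hexp hs)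

/-! ### Multipliers that preserve sup norms -/

/-- Multiplying a Fourier transform by that of a finite complex measure does not increase the sup
norm by more than the total mass. -/
theorem norm_integral_average_le {Ω : Type*} [MeasurableSpace Ω] {μ : Measure Ω} [SFinite μ]
    {c : Ω → ℂ} (hc : Integrable c μ) {y : Ω → Space} (hy : Measurable y) {G : Space → ℂ}
    (hG : Integrable G) {B : ℝ} (hB : ∀ z, ‖∫ ξ, G ξ * wave z ξ‖ ≤ B) (z : Space) :
    ‖∫ ξ, (∫ o, c o * wave (y o) ξ ∂μ) * G ξ * wave z ξ‖ ≤ B * ∫ o, ‖c o‖ ∂μ := by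
  have hw : Measurable fun p : Space × Ω => wave (y p.2) p.1 := by
    unfold wave
    fun_prop
  have hint : Integrable (fun p : Space × Ω => c p.2 * wave (y p.2) p.1 * (G p.1 * wave z p.1))
      (volume.prod μ) := by
    have h1 : Integrable (fun p : Space × Ω => G p.1 * c p.2) (volume.prod μ) := hG.mul_prod hc
    have h2 : (fun p : Space × Ω => c p.2 * wave (y p.2) p.1 * (G p.1 * wave z p.1)) =
        fun p => (wave (y p.2) p.1 * wave z p.1) * (G p.1 * c p.2) := by
      ext p; ring
    rw [h2]
    refine h1.bdd_mul (c := 1) ?_ (Eventually.of_forall fun p => ?_)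
    · exact (hw.mul ((continuous_wave z).measurable.comp measurable_fst)).aestronglyMeasurable
    · simp
  calc _ = ‖∫ ξ, ∫ o, c o * wave (y o) ξ * (G ξ * wave z ξ) ∂μ‖ := by
        simp_rw [integral_mul_const, mul_assoc]
    _ = ‖∫ o, (∫ ξ, c o * wave (y o) ξ * (G ξ * wave z ξ)) ∂μ‖ := by
        rw [integral_integral_swap hint]
    _ = ‖∫ o, c o * (∫ ξ, G ξ * wave (y o + z) ξ) ∂μ‖ := by
        congr 2
        ext o
        rw [← integral_const_mul]
        congr 1
        ext ξ
        rw [wave_add]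
        ring
    _ ≤ ∫ o, ‖c o‖ * B ∂μ := by
        refine norm_integral_le_of_norm_le (hc.norm.mul_const B) (Eventually.of_forall fun o => ?_)
        rw [norm_mul]
        exact mul_le_mul_of_nonneg_left (hB _) (norm_nonneg _)
    _ = _ := by rw [integral_mul_const, mul_comm]

theorem fourier_eq_integral_wave (f : 𝓢(Space, ℂ)) (ξ : Space) :
    𝓕 f ξ = ∫ x, f x * wave (-x) ξ := by
  rw [SchwartzMap.fourier_coe, Real.fourier_eq']
  refine integral_congr_ae (Eventually.of_forall fun x => ?_)
  simp only [wave, smul_eq_mul, inner_neg_left]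
  rw [mul_comm]
  congr 2
  push_cast
  ring

theorem norm_integral_fourier_mul_le (f : 𝓢(Space, ℂ)) {G : Space → ℂ}
    (hG : Integrable G) {B : ℝ} (hB : ∀ z, ‖∫ ξ, G ξ * wave z ξ‖ ≤ B) (z : Space) :
    ‖∫ ξ, 𝓕 f ξ * G ξ * wave z ξ‖ ≤ B * ∫ x, ‖f x‖ := by
  simp_rw [fourier_eq_integral_wave]
  exact norm_integral_average_le f.integrable measurable_neg hG hB z

/-- The Gaussian in the frequencies orthogonal to `P` averages over translations. -/
theorem norm_integral_gaussian_mul_le {P : Space} (hP : ‖P‖ = 1) {s : ℝ} (hs : 0 ≤ s)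
    {G : Space → ℂ} (hG : Integrable G) {B : ℝ} (hB : ∀ z, ‖∫ ξ, G ξ * wave z ξ‖ ≤ B)
    (z : Space) :
    ‖∫ ξ, ((Real.exp (-(s * ((2 * Real.pi * ‖ξ‖) ^ 2 - (2 * Real.pi * inner ℝ P ξ) ^ 2))) : ℝ) : ℂ) *
      G ξ * wave z ξ‖ ≤ B := by
  let μ := ProbabilityTheory.stdGaussian Space
  let pr : Space → Space := fun ξ => ξ - inner ℝ P ξ • P
  have hpr : ∀ x ξ, inner ℝ (pr x) ξ = inner ℝ x (pr ξ) := fun x ξ => by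
    simp only [pr, inner_sub_left, inner_sub_right, real_inner_smul_left, real_inner_smul_right]
    rw [real_inner_comm P x]
    ring
  have hprn : ∀ ξ, ‖pr ξ‖ ^ 2 = ‖ξ‖ ^ 2 - inner ℝ P ξ ^ 2 := fun ξ => by
    simp only [pr]
    rw [norm_sub_sq_real, real_inner_smul_right, norm_smul, hP, real_inner_comm P ξ,
      Real.norm_eq_abs, mul_one, sq_abs]
    ring
  have key : ∀ ξ, ((Real.exp (-(s * ((2 * Real.pi * ‖ξ‖) ^ 2 - (2 * Real.pi * inner ℝ P ξ) ^ 2)))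
      : ℝ) : ℂ) = ∫ x, 1 * wave (Real.sqrt (2 * s) • pr x) ξ ∂μ := fun ξ => by
    have h := ProbabilityTheory.charFun_stdGaussian (E := Space)
      ((2 * Real.pi * Real.sqrt (2 * s)) • pr ξ)
    rw [charFun_apply] at h
    calc _ = Complex.exp (-(‖(2 * Real.pi * Real.sqrt (2 * s)) • pr ξ‖ : ℂ) ^ 2 / 2) := by
          rw [Complex.ofReal_exp]
          congr 1
          rw [← Complex.ofReal_pow, norm_smul, mul_pow ‖_‖, hprn, Real.norm_eq_abs, sq_abs, mul_pow _ √(2 * s),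
            Real.sq_sqrt (by positivity)]
          push_cast
          ring
      _ = _ := by
          rw [← h]
          refine integral_congr_ae (Eventually.of_forall fun x => ?_)
          simp only [wave, one_mul]
          rw [real_inner_smul_left, hpr, real_inner_smul_right]
          congr 1
          push_cast
          ring
  simp_rw [key]
  have := norm_integral_average_le (μ := μ) (c := fun _ => 1) (integrable_const 1)
    (y := fun x => Real.sqrt (2 * s) • pr x) (by fun_prop) hG hB z
  simpa using this

/-! ### Decay of oscillating multipliers on Schwartz functions -/

theorem schwartz_norm_le (ψ : 𝓢(Space, ℂ)) (k : ℕ) :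
    ∃ C : ℝ, 0 ≤ C ∧ ∀ ξ, ‖ψ ξ‖ ≤ C * (1 + (2 * Real.pi * ‖ξ‖) ^ 2) ^ (-(k : ℝ)) := by
  obtain ⟨C, hC⟩ : ∃ C : ℝ, ∀ ξ, (1 + ‖ξ‖) ^ (2 * k) * ‖ψ ξ‖ ≤ C := by
    refine ⟨2 ^ (2 * k) * (Finset.Iic (2 * k, 0)).sup
      (fun m => SchwartzMap.seminorm ℝ m.1 m.2) ψ, fun ξ => ?_⟩
    simpa using SchwartzMap.one_add_le_sup_seminorm_apply (𝕜 := ℝ) (m := (2 * k, 0)) (k := 2 * k)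
      (n := 0) le_rfl le_rfl ψ ξ
  have hC0 : 0 ≤ C := le_trans (by positivity) (hC 0)
  refine ⟨(2 * Real.pi) ^ (2 * k) * C, by positivity, fun ξ => ?_⟩
  rw [Real.rpow_neg (by positivity), Real.rpow_natCast, ← div_eq_mul_inv,
    le_div_iff₀ (by positivity)]
  have h1 : 1 + (2 * Real.pi * ‖ξ‖) ^ 2 ≤ (2 * Real.pi * (1 + ‖ξ‖)) ^ 2 := by
    have h2 : 1 ≤ 2 * Real.pi := by linarith [Real.pi_gt_three]
    have h3 := norm_nonneg ξ
    have h4 : 1 ≤ (2 * Real.pi) ^ 2 := by nlinarith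
    have h5 : 0 ≤ (2 * Real.pi) ^ 2 * ‖ξ‖ := by positivity
    calc 1 + (2 * Real.pi * ‖ξ‖) ^ 2 ≤ (2 * Real.pi) ^ 2 + (2 * Real.pi * ‖ξ‖) ^ 2 +
          2 * ((2 * Real.pi) ^ 2 * ‖ξ‖) := by linarith
      _ = _ := by ring
  calc ‖ψ ξ‖ * (1 + (2 * Real.pi * ‖ξ‖) ^ 2) ^ k
      ≤ ‖ψ ξ‖ * ((2 * Real.pi * (1 + ‖ξ‖)) ^ 2) ^ k := by gcongr
    _ = (2 * Real.pi) ^ (2 * k) * ((1 + ‖ξ‖) ^ (2 * k) * ‖ψ ξ‖) := by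
        rw [← pow_mul, mul_pow]
        ring
    _ ≤ _ := by gcongr; exact hC ξ

theorem integrable_prof {α β : ℝ} (hα : -3 < α) (h : α + 2 * β < -3) :
    Integrable (fun ξ : Space => prof α β (2 * Real.pi * ‖ξ‖)) := by
  rw [integrable_radial_iff]
  refine (integrableOn_prof (α := 2 + α) (β := β) (by linarith) (by linarith)).congr_fun
    (fun κ hκ => ?_) measurableSet_Ioi
  have := pow_mul_prof 2 α β hκ
  push_cast at this
  exact this.symm

theorem ae_norm_pos : ∀ᵐ ξ : Space, 0 < 2 * Real.pi * ‖ξ‖ := by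
  have : ∀ᵐ ξ : Space, ξ ≠ 0 := by
    simp [ae_iff, measure_singleton]
  filter_upwards [this] with ξ hξ
  have := norm_pos_iff.2 hξ
  positivity

theorem integrable_prof_mul_schwartz {α : ℝ} (β : ℝ) (hα : -3 < α) (ψ : 𝓢(Space, ℂ)) :
    Integrable (fun ξ : Space => (prof α β (2 * Real.pi * ‖ξ‖) : ℂ) * ψ ξ) := by
  obtain ⟨k, hk⟩ := exists_nat_gt ((α + 2 * β + 3) / 2)
  obtain ⟨C, hC0, hC⟩ := schwartz_norm_le ψ k
  have h1 := (integrable_prof (α := α) (β := β - k) hα (by linarith)).const_mul C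
  refine h1.mono' ?_ ?_
  · have h2 : Measurable fun ξ : Space => (prof α β (2 * Real.pi * ‖ξ‖) : ℂ) := by fun_prop
    exact (h2.mul ψ.continuous.measurable).aestronglyMeasurable
  · filter_upwards [ae_norm_pos] with ξ hξ
    have h2 := prof_nonneg α β hξ.le
    rw [norm_mul, Complex.norm_real, Real.norm_of_nonneg h2]
    calc _ ≤ _ := mul_le_mul_of_nonneg_left (hC ξ) h2
      _ = _ := by
        unfold prof
        rw [sub_eq_add_neg, Real.rpow_add (by positivity)]
        ring

theorem norm_integral_osc_le_of_gauss {α β : ℝ} (hα : -1 ≤ α) (hαβ : α + 2 * β ≤ -2) :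
    ∃ C : ℝ, 0 ≤ C ∧ ∀ f : 𝓢(Space, ℂ), ∀ τ : ℝ, τ ≠ 0 → ∀ z : Space,
      ‖∫ ξ : Space, osc τ (2 * Real.pi * ‖ξ‖) * ((prof α β (2 * Real.pi * ‖ξ‖) : ℂ) * 𝓕 f ξ) *
          wave z ξ‖ ≤ C / |τ| * ∫ x, ‖f x‖ := by
  obtain ⟨C, hC0, hC⟩ := exists_norm_gauss_kernel_le hα hαβ
  refine ⟨C, hC0, fun f τ hτ z => ?_⟩
  let G : ℝ → Space → ℂ := fun δ ξ => osc τ (2 * Real.pi * ‖ξ‖) *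
    ((prof α β (2 * Real.pi * ‖ξ‖) * Real.exp (-(δ * (2 * Real.pi * ‖ξ‖) ^ 2)) : ℝ) : ℂ)
  have hGm : ∀ δ, Measurable (G δ) := fun δ => by
    simp only [G]
    fun_prop
  have hG : ∀ δ, 0 < δ → Integrable (G δ) := fun δ hδ => by
    have h1 := (integrable_prof (α := α) (β := β - 2) (by linarith) (by linarith)).const_mul
      ((1 + (δ / 2)⁻¹) ^ 2)
    refine h1.mono' (hGm δ).aestronglyMeasurable ?_
    filter_upwards [ae_norm_pos] with ξ hξ
    simp only [G]
    set κ := 2 * Real.pi * ‖ξ‖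
    have h2 := prof_nonneg α β hξ.le
    have h3 := exp_neg_mul_sq_le (half_pos hδ) κ
    rw [norm_mul, norm_osc, one_mul, Complex.norm_real, Real.norm_of_nonneg (by positivity)]
    have h4 : Real.exp (-(δ * κ ^ 2)) = Real.exp (-(δ / 2 * κ ^ 2)) ^ 2 := by
      rw [← Real.exp_nat_mul]
      congr 1
      push_cast
      ring
    have h5 : prof α (β - 2) κ = prof α β κ * ((1 + κ ^ 2)⁻¹) ^ 2 := by
      unfold prof
      rw [sub_eq_add_neg, Real.rpow_add (by positivity), Real.rpow_neg (by positivity),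
        Real.rpow_two, inv_pow]
      ring
    rw [h4, h5]
    calc _ ≤ prof α β κ * ((1 + (δ / 2)⁻¹) * (1 + κ ^ 2)⁻¹) ^ 2 := by gcongr
      _ = _ := by ring
  have hbd : ∀ δ, 0 < δ → ‖∫ ξ, 𝓕 f ξ * G δ ξ * wave z ξ‖ ≤ C / |τ| * ∫ x, ‖f x‖ :=
    fun δ hδ => norm_integral_fourier_mul_le f (hG δ hδ) (fun z => hC δ hδ τ hτ z) z
  have hlim : Tendsto (fun δ : ℝ => ∫ ξ, 𝓕 f ξ * G δ ξ * wave z ξ) (𝓝[>] 0)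
      (𝓝 (∫ ξ : Space, osc τ (2 * Real.pi * ‖ξ‖) *
        ((prof α β (2 * Real.pi * ‖ξ‖) : ℂ) * 𝓕 f ξ) * wave z ξ)) := by
    refine tendsto_integral_filter_of_dominated_convergence
      (fun ξ => ‖(prof α β (2 * Real.pi * ‖ξ‖) : ℂ) * 𝓕 f ξ‖) ?_ ?_
      (integrable_prof_mul_schwartz β (by linarith) (𝓕 f)).norm ?_
    · refine Eventually.of_forall fun δ => ?_
      exact (((𝓕 f).continuous.measurable.mul (hGm δ)).mul
        (continuous_wave z).measurable).aestronglyMeasurable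
    · filter_upwards [self_mem_nhdsWithin] with δ hδ
      have hδ' : (0 : ℝ) < δ := hδ
      refine Eventually.of_forall fun ξ => ?_
      simp only [G]
      rw [norm_mul, norm_wave, mul_one, norm_mul, norm_mul, norm_osc, one_mul, norm_mul, mul_comm,
        Complex.norm_real, Complex.norm_real, norm_mul (prof _ _ _)]
      refine mul_le_mul_of_nonneg_right (mul_le_of_le_one_right (norm_nonneg _) ?_) (norm_nonneg _)
      rw [Real.norm_of_nonneg (Real.exp_nonneg _), Real.exp_le_one_iff]
      have : 0 ≤ δ * (2 * Real.pi * ‖ξ‖) ^ 2 := by positivity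
      linarith
    · refine Eventually.of_forall fun ξ => ?_
      have h1 : Continuous fun δ : ℝ => 𝓕 f ξ * G δ ξ * wave z ξ := by
        simp only [G]
        fun_prop
      have h2 := h1.tendsto 0
      have h3 : 𝓕 f ξ * G 0 ξ * wave z ξ = osc τ (2 * Real.pi * ‖ξ‖) *
          ((prof α β (2 * Real.pi * ‖ξ‖) : ℂ) * 𝓕 f ξ) * wave z ξ := by
        simp only [G, zero_mul, neg_zero, Real.exp_zero, mul_one]
        ring
      rw [h3] at h2
      exact h2.mono_left nhdsWithin_le_nhds
  refine le_of_tendsto hlim.norm ?_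
  filter_upwards [self_mem_nhdsWithin] with δ hδ using hbd δ hδ

/-- The `L¹` norm of the Fourier transform weighted by a square-integrable profile. -/
theorem integral_norm_prof_mul_le {α β : ℝ} (hα : -3 < 2 * α) (hαβ : 2 * α + 4 * β < -3) :
    ∃ C : ℝ, 0 ≤ C ∧ ∀ ψ : 𝓢(Space, ℂ),
      ∫ ξ : Space, ‖(prof α β (2 * Real.pi * ‖ξ‖) : ℂ) * ψ ξ‖ ≤
        C * Real.sqrt (∫ ξ, ‖ψ ξ‖ ^ 2) := by
  have h1 : Integrable (fun ξ : Space => prof α β (2 * Real.pi * ‖ξ‖) ^ 2) := by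
    refine (integrable_prof (α := 2 * α) (β := 2 * β) hα (by linarith)).congr ?_
    filter_upwards [ae_norm_pos] with ξ hξ
    rw [sq, prof_mul_prof _ _ _ _ hξ]
    ring_nf
  refine ⟨Real.sqrt (∫ ξ : Space, prof α β (2 * Real.pi * ‖ξ‖) ^ 2), by positivity, fun ψ => ?_⟩
  have hm : Measurable fun ξ : Space => (prof α β (2 * Real.pi * ‖ξ‖) : ℂ) := by fun_prop
  have h2 := integral_mul_norm_le_Lp_mul_Lq (μ := (volume : Measure Space))
    Real.HolderConjugate.two_two
    (f := fun ξ : Space => (prof α β (2 * Real.pi * ‖ξ‖) : ℂ)) (g := ψ)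
    (by
      have : MemLp (fun ξ : Space => (prof α β (2 * Real.pi * ‖ξ‖) : ℂ)) 2 := by
        rw [memLp_two_iff_integrable_sq_norm hm.aestronglyMeasurable]
        simpa using h1
      simpa using this)
    (by simpa using ψ.memLp 2)
  simp only [Real.rpow_two, Complex.norm_real, Real.norm_eq_abs, sq_abs, ← Real.sqrt_eq_rpow] at h2
  simpa using h2

theorem le_inv_one_add_of_le {X A B τ : ℝ} (hA : 0 ≤ A) (hB : 0 ≤ B) (h1 : τ ≠ 0 → X ≤ A / |τ|)
    (h2 : X ≤ B) : X ≤ 2 * (A + B) * (1 + |τ|)⁻¹ := by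
  rw [← div_eq_mul_inv, le_div_iff₀ (by positivity)]
  rcases le_or_gt |τ| 1 with h | h
  · nlinarith [abs_nonneg τ]
  · have h0 : τ ≠ 0 := abs_pos.1 (by linarith)
    have h3 := h1 h0
    rw [le_div_iff₀ (by linarith)] at h3
    nlinarith

/-- Decay of an oscillating radial multiplier of order `-2` applied to a Schwartz function. -/
theorem exists_norm_osc_multiplier_le {α β : ℝ} (hα : -1 ≤ α) (hαβ : α + 2 * β ≤ -2) :
    ∃ C : ℝ, 0 ≤ C ∧ ∀ f : 𝓢(Space, ℂ), ∀ τ : ℝ, ∀ z : Space,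
      ‖∫ ξ : Space, osc τ (2 * Real.pi * ‖ξ‖) * ((prof α β (2 * Real.pi * ‖ξ‖) : ℂ) * 𝓕 f ξ) *
          wave z ξ‖ ≤ C * (1 + |τ|)⁻¹ * ((∫ x, ‖f x‖) + Real.sqrt (∫ x, ‖f x‖ ^ 2)) := by
  obtain ⟨C₁, h10, h1⟩ := norm_integral_osc_le_of_gauss hα hαβ
  obtain ⟨C₂, h20, h2⟩ := integral_norm_prof_mul_le (α := α) (β := β) (by linarith) (by linarith)
  refine ⟨2 * (C₁ + C₂), by positivity, fun f τ z => ?_⟩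
  have hf1 : 0 ≤ ∫ x, ‖f x‖ := integral_nonneg fun _ => norm_nonneg _
  have hf2 := Real.sqrt_nonneg (∫ x, ‖f x‖ ^ 2)
  have h3 := le_inv_one_add_of_le (τ := τ) (mul_nonneg h10 hf1) (mul_nonneg h20 hf2)
    (fun hτ => (h1 f τ hτ z).trans_eq (by ring)) (((norm_integral_le_integral_norm _).trans_eq
      (integral_congr_ae (Eventually.of_forall fun ξ => by
        simp only [norm_mul, norm_wave, norm_osc, one_mul, mul_one]))).trans
      ((h2 (𝓕 f)).trans_eq (by rw [SchwartzMap.integral_norm_sq_fourier])))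
  refine h3.trans ?_
  rw [mul_right_comm (2 * (C₁ + C₂))]
  refine mul_le_mul_of_nonneg_right ?_ (by positivity)
  nlinarith [mul_nonneg h10 hf2, mul_nonneg h20 hf1]

/-! ### Decay with the resonant denominator -/

/-- The determinant `D = ω² - a² = (k² - (P·k)²) + k⁴` of the symbol of `H P`. -/
def symDet (P ξ : Space) : ℝ :=
  ((2 * Real.pi * ‖ξ‖) ^ 2 - (2 * Real.pi * inner ℝ P ξ) ^ 2) + (2 * Real.pi * ‖ξ‖) ^ 4

@[fun_prop]
theorem continuous_symDet (P : Space) : Continuous (symDet P) := by unfold symDet; fun_prop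

theorem abs_freq_le {P : Space} (hP : ‖P‖ = 1) (ξ : Space) :
    |2 * Real.pi * inner ℝ P ξ| ≤ 2 * Real.pi * ‖ξ‖ := by
  rw [abs_mul, abs_of_pos Real.two_pi_pos]
  have := abs_inner_le_of_unit hP ξ
  gcongr

theorem pow_four_le_symDet {P : Space} (hP : ‖P‖ = 1) (ξ : Space) :
    (2 * Real.pi * ‖ξ‖) ^ 4 ≤ symDet P ξ := by
  have h := sq_le_sq' (abs_le.1 (abs_freq_le hP ξ)).1 (abs_le.1 (abs_freq_le hP ξ)).2
  unfold symDet
  linarith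

theorem integral_exp_neg_mul_Ioi {d : ℝ} (hd : 0 < d) :
    ∫ s in Set.Ioi (0 : ℝ), Real.exp (-(s * d)) = d⁻¹ := by
  have h := integral_exp_mul_Ioi (a := -d) (by linarith) 0
  simp only [mul_zero, Real.exp_zero] at h
  rw [show (fun s : ℝ => Real.exp (-(s * d))) = fun s => Real.exp (-d * s) by ext s; ring_nf, h]
  field_simp

theorem integrableOn_exp_neg_mul_Ioi {d : ℝ} (hd : 0 < d) :
    IntegrableOn (fun s : ℝ => Real.exp (-(s * d))) (Set.Ioi 0) := by
  have h := integrableOn_exp_mul_Ioi (a := -d) (by linarith) 0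
  rwa [show (fun s : ℝ => Real.exp (-(s * d))) = fun s => Real.exp (-d * s) by ext s; ring_nf]

/-- The Laplace representation `1/D = ∫₀^∞ e^{-sD} ds` is absolutely convergent against `G` as soon
as `G / D` is integrable. -/
theorem integrable_laplace {X E : Type*} [MeasurableSpace X] {μ : Measure X} [SFinite μ]
    [NormedAddCommGroup E] [NormedSpace ℝ E] {G : X → E} {D : X → ℝ}
    (hG : AEStronglyMeasurable G μ) (hDm : Measurable D) (hD : ∀ᵐ x ∂μ, 0 < D x)
    (hi : Integrable (fun x => (D x)⁻¹ • G x) μ) :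
    Integrable (fun p : X × ℝ => Real.exp (-(p.2 * D p.1)) • G p.1)
      (μ.prod (volume.restrict (Set.Ioi 0))) := by
  rw [integrable_prod_iff]
  · refine ⟨?_, ?_⟩
    · filter_upwards [hD] with x hx
      exact (integrableOn_exp_neg_mul_Ioi hx).smul_const (G x)
    · refine hi.norm.congr ?_
      filter_upwards [hD] with x hx
      simp_rw [norm_smul, Real.norm_of_nonneg (Real.exp_nonneg _)]
      rw [integral_mul_const, integral_exp_neg_mul_Ioi hx, Real.norm_of_nonneg (by positivity)]
  · refine AEStronglyMeasurable.smul ?_ hG.comp_fst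
    exact (by fun_prop : Measurable fun p : X × ℝ => Real.exp (-(p.2 * D p.1))).aestronglyMeasurable

theorem symDet_pos_ae {P : Space} (hP : ‖P‖ = 1) : ∀ᵐ ξ : Space, 0 < symDet P ξ := by
  filter_upwards [ae_norm_pos] with ξ hξ
  exact lt_of_lt_of_le (by positivity) (pow_four_le_symDet hP ξ)

theorem norm_resonant_le {P : Space} (hP : ‖P‖ = 1) (α β : ℝ) (m : ℕ) {c : ℂ} {ξ : Space}
    (hξ : 0 < 2 * Real.pi * ‖ξ‖) :
    ‖(symDet P ξ)⁻¹ • ((prof α β (2 * Real.pi * ‖ξ‖) : ℂ) *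
      ((2 * Real.pi * inner ℝ P ξ : ℝ) : ℂ) ^ m * c)‖ ≤
      ‖(prof (α + m - 4) β (2 * Real.pi * ‖ξ‖) : ℂ) * c‖ := by
  set κ := 2 * Real.pi * ‖ξ‖
  have h4 := pow_four_le_symDet hP ξ
  have hD : 0 < symDet P ξ := lt_of_lt_of_le (by positivity) h4
  have h5 : prof (α + m - 4) β κ = (κ ^ 4)⁻¹ * (prof α β κ * κ ^ m) := by
    unfold prof
    rw [Real.rpow_sub hξ, Real.rpow_add hξ, Real.rpow_natCast,
      show ((4 : ℝ)) = ((4 : ℕ) : ℝ) by norm_num, Real.rpow_natCast]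
    field_simp
  have h6 := prof_nonneg α β hξ.le
  have h7 : (symDet P ξ)⁻¹ ≤ (κ ^ 4)⁻¹ := inv_anti₀ (by positivity) h4
  have h8 := abs_freq_le hP ξ
  have h9 : ‖(prof α β κ : ℂ)‖ = prof α β κ := by
    rw [Complex.norm_real, Real.norm_of_nonneg h6]
  have h10 : ‖(prof (α + m - 4) β κ : ℂ)‖ = (κ ^ 4)⁻¹ * (prof α β κ * κ ^ m) := by
    rw [h5, Complex.norm_real, Real.norm_of_nonneg (by positivity)]
  rw [norm_smul, norm_mul, norm_mul, norm_mul, h9, h10, norm_pow, Complex.norm_real,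
    Real.norm_of_nonneg (by positivity), Real.norm_eq_abs]
  calc _ ≤ (κ ^ 4)⁻¹ * (prof α β κ * κ ^ m * ‖c‖) := by gcongr
    _ = _ := by ring

theorem integrable_resonant {P : Space} (hP : ‖P‖ = 1) {α : ℝ} (β : ℝ) {m : ℕ} (hα : 1 < m + α)
    (ψ : 𝓢(Space, ℂ)) :
    Integrable (fun ξ : Space => (symDet P ξ)⁻¹ • ((prof α β (2 * Real.pi * ‖ξ‖) : ℂ) *
      ((2 * Real.pi * inner ℝ P ξ : ℝ) : ℂ) ^ m * ψ ξ)) := by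
  refine (integrable_prof_mul_schwartz (α := α + m - 4) β (by linarith) ψ).mono ?_ ?_
  · have h1 : Measurable fun ξ : Space => (prof α β (2 * Real.pi * ‖ξ‖) : ℂ) *
      ((2 * Real.pi * inner ℝ P ξ : ℝ) : ℂ) ^ m := by fun_prop
    exact ((continuous_symDet P).measurable.inv.smul
      (h1.mul ψ.continuous.measurable)).aestronglyMeasurable
  · filter_upwards [ae_norm_pos] with ξ hξ
    exact norm_resonant_le hP α β m hξ

/-- Every Schwartz function is `(1 + κ²)^{-N}` times the Fourier transform of a Schwartz
function. -/
theorem exists_schwartz_factor (ψ : 𝓢(Space, ℂ)) (N : ℕ) :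
    ∃ f : 𝓢(Space, ℂ), ∀ ξ, (((1 + (2 * Real.pi * ‖ξ‖) ^ 2) ^ N : ℝ) : ℂ) * ψ ξ = 𝓕 f ξ := by
  have hg : (fun ξ : Space => (((1 + (2 * Real.pi * ‖ξ‖) ^ 2) ^ N : ℝ) : ℂ)).HasTemperateGrowth := by
    have : (fun ξ : Space => (((1 + (2 * Real.pi * ‖ξ‖) ^ 2) ^ N : ℝ) : ℂ)) =
        fun ξ : Space => (1 + (2 * Real.pi : ℂ) ^ 2 * ((‖ξ‖ ^ 2 : ℝ) : ℂ)) ^ N := by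
      ext ξ
      push_cast
      ring
    rw [this]
    fun_prop
  refine ⟨𝓕⁻ (SchwartzMap.smulLeftCLM ℂ
    (fun ξ : Space => (((1 + (2 * Real.pi * ‖ξ‖) ^ 2) ^ N : ℝ) : ℂ)) ψ), fun ξ => ?_⟩
  rw [FourierTransform.fourier_fourierInv_eq, SchwartzMap.smulLeftCLM_apply_apply hg, smul_eq_mul]

/-- For Schwartz data on the frequency side, dividing by the resonant determinant `D` costs no more
than three powers of the frequency. The denominator is removed by the Laplace representation:
`e^{-s(k² - (P·k)²)}` is a Gaussian average of translations, and the remaining kernels with the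
radial cutoff `e^{-sκ⁴}` have bounds that are integrable in `s`. -/
theorem exists_norm_resonant_le {α : ℝ} (β : ℝ) {m : ℕ} (hm : m ≤ 1) (hα : 2 < m + α)
    (ψ : 𝓢(Space, ℂ)) :
    ∃ C : ℝ, 0 ≤ C ∧ ∀ P : Space, ‖P‖ = 1 → ∀ (τ : ℝ) (z : Space),
      ‖∫ ξ : Space, osc τ (2 * Real.pi * ‖ξ‖) * ((symDet P ξ)⁻¹ •
        ((prof α β (2 * Real.pi * ‖ξ‖) : ℂ) * ((2 * Real.pi * inner ℝ P ξ : ℝ) : ℂ) ^ m * ψ ξ)) *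
          wave z ξ‖ ≤ C * (1 + |τ|)⁻¹ := by
  obtain ⟨N, hN⟩ := exists_nat_gt ((m + α + 2 * β + 3) / 2)
  have hN' : m + α + 2 * (β - N) < -3 := by linarith
  obtain ⟨f, hf⟩ := exists_schwartz_factor ψ N
  obtain ⟨C, hC0, hC⟩ := exists_norm_quartic_kernel_le (α := α) (β := β - N) hm (by linarith) hN'
  -- the frequency integral of the kernel bounds, before and after integration in `s`
  let g : ℝ → ℝ := prof (1 + m + α) (β - N - 1 / 2)
  have hgi : IntegrableOn (fun κ => (κ ^ 4 / 2)⁻¹ • g κ) (Set.Ioi 0) := by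
    refine IntegrableOn.congr_fun ((integrableOn_prof (α := m + α - 3) (β := β - N - 1 / 2)
      (by linarith) (by linarith)).const_mul 2) (fun κ hκ => ?_) measurableSet_Ioi
    have hκ' : (0 : ℝ) < κ := hκ
    simp only [g, smul_eq_mul]
    rw [show 1 + (m : ℝ) + α = ((4 : ℕ) : ℝ) + (m + α - 3) by push_cast; ring,
      ← pow_mul_prof 4 _ _ hκ']
    field_simp
  have hgL := integrable_laplace (μ := volume.restrict (Set.Ioi (0 : ℝ))) (G := g)
    (D := fun κ => κ ^ 4 / 2) (measurable_prof _ _).aestronglyMeasurable (by fun_prop)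
    (by filter_upwards [ae_restrict_mem measurableSet_Ioi] with κ hκ
        have : (0 : ℝ) < κ := hκ
        positivity) hgi
  have hgs := hgL.integral_prod_right
  set I : ℝ := ∫ s in Set.Ioi (0 : ℝ), ∫ κ in Set.Ioi (0 : ℝ), Real.exp (-(s * (κ ^ 4 / 2))) • g κ
    with hI
  have hI0 : 0 ≤ I := by
    refine setIntegral_nonneg measurableSet_Ioi fun s _ => ?_
    refine setIntegral_nonneg measurableSet_Ioi fun κ hκ => ?_
    have := prof_nonneg (1 + m + α) (β - N - 1 / 2) (le_of_lt hκ)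
    simp only [smul_eq_mul, g]
    positivity
  have hf0 : 0 ≤ ∫ x, ‖f x‖ := integral_nonneg fun _ => norm_nonneg _
  set B : ℝ := ∫ ξ : Space, ‖(prof (α + m - 4) β (2 * Real.pi * ‖ξ‖) : ℂ) * ψ ξ‖ with hB
  have hB0 : 0 ≤ B := integral_nonneg fun _ => norm_nonneg _
  refine ⟨2 * (C * I * (∫ x, ‖f x‖) + B), by positivity, fun P hP τ z => ?_⟩
  refine le_inv_one_add_of_le (by positivity) hB0 (fun hτ => ?_) ?_
  · let G : Space → ℂ := fun ξ => osc τ (2 * Real.pi * ‖ξ‖) *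
      ((prof α β (2 * Real.pi * ‖ξ‖) : ℂ) * ((2 * Real.pi * inner ℝ P ξ : ℝ) : ℂ) ^ m * ψ ξ) *
        wave z ξ
    have hGm : Measurable G := by
      have h1 : Measurable fun ξ : Space => osc τ (2 * Real.pi * ‖ξ‖) := by fun_prop
      have h2 : Measurable fun ξ : Space => (prof α β (2 * Real.pi * ‖ξ‖) : ℂ) *
        ((2 * Real.pi * inner ℝ P ξ : ℝ) : ℂ) ^ m := by fun_prop
      exact (h1.mul (h2.mul ψ.continuous.measurable)).mul (continuous_wave z).measurable
    have hGi : Integrable (fun ξ => (symDet P ξ)⁻¹ • G ξ) := by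
      refine (integrable_resonant hP (α := α) (m := m) β (by linarith) ψ).mono
        ((continuous_symDet P).measurable.inv.smul hGm).aestronglyMeasurable
        (Eventually.of_forall fun ξ => le_of_eq ?_)
      simp only [G]
      rw [norm_smul, norm_smul, norm_mul _ (wave z ξ), norm_wave, mul_one, norm_mul (osc _ _),
        norm_osc, one_mul]
    have hGL := integrable_laplace hGm.aestronglyMeasurable (continuous_symDet P).measurable
      (symDet_pos_ae hP) hGi
    have hswap := integral_integral_swap
      (f := fun ξ s => Real.exp (-(s * symDet P ξ)) • G ξ) hGL
    have hleft : ∫ ξ, ∫ s in Set.Ioi (0 : ℝ), Real.exp (-(s * symDet P ξ)) • G ξ =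
        ∫ ξ : Space, osc τ (2 * Real.pi * ‖ξ‖) * ((symDet P ξ)⁻¹ •
          ((prof α β (2 * Real.pi * ‖ξ‖) : ℂ) * ((2 * Real.pi * inner ℝ P ξ : ℝ) : ℂ) ^ m * ψ ξ)) *
            wave z ξ := by
      refine integral_congr_ae ?_
      filter_upwards [symDet_pos_ae hP] with ξ hξ
      rw [integral_smul_const, integral_exp_neg_mul_Ioi hξ]
      simp only [G, Complex.real_smul]
      ring
    rw [← hleft, hswap]
    have hs : ∀ s ∈ Set.Ioi (0 : ℝ), ‖∫ ξ, Real.exp (-(s * symDet P ξ)) • G ξ‖ ≤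
        (C / |τ| * ∫ x, ‖f x‖) *
          ∫ κ in Set.Ioi (0 : ℝ), Real.exp (-(s * (κ ^ 4 / 2))) • g κ := by
      intro s hs
      have hs' : (0 : ℝ) ≤ s := le_of_lt hs
      let K : Space → ℂ := fun ξ => osc τ (2 * Real.pi * ‖ξ‖) *
        ((prof α (β - N) (2 * Real.pi * ‖ξ‖) * Real.exp (-(s * (2 * Real.pi * ‖ξ‖) ^ 4)) : ℝ) : ℂ) *
          ((2 * Real.pi * inner ℝ P ξ : ℝ) : ℂ) ^ m
      have hKm : Measurable K := by simp only [K]; fun_prop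
      have hKn : ∀ᵐ ξ, ‖K ξ‖ ≤ prof (m + α) (β - N) (2 * Real.pi * ‖ξ‖) := by
        filter_upwards [ae_norm_pos] with ξ hξ
        have h1 := prof_nonneg α (β - N) hξ.le
        have h2 := abs_freq_le hP ξ
        have h3 : Real.exp (-(s * (2 * Real.pi * ‖ξ‖) ^ 4)) ≤ 1 := Real.exp_le_one_iff.2 (by
          have : 0 ≤ s * (2 * Real.pi * ‖ξ‖) ^ 4 := by positivity
          linarith)
        simp only [K]
        rw [← pow_mul_prof m _ _ hξ, norm_mul, norm_mul, norm_osc, one_mul, norm_pow,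
          Complex.norm_real, Complex.norm_real, Real.norm_of_nonneg (by positivity),
          Real.norm_eq_abs, mul_comm]
        gcongr
        exact mul_le_of_le_one_right h1 h3
      have hKi : Integrable K := (integrable_prof (α := m + α) (β := β - N) (by linarith)
        (by linarith)).mono' hKm.aestronglyMeasurable hKn
      have hfKi : Integrable (fun ξ => 𝓕 f ξ * K ξ) := by
        refine (integrable_prof_mul_schwartz (α := m + α) (β - N) (by linarith) (𝓕 f)).mono
          ((𝓕 f).continuous.measurable.mul hKm).aestronglyMeasurable ?_
        filter_upwards [hKn, ae_norm_pos] with ξ h1 hξ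
        rw [norm_mul, norm_mul (prof _ _ _ : ℂ), mul_comm, Complex.norm_real,
          Real.norm_of_nonneg (prof_nonneg _ _ hξ.le)]
        gcongr
      have h1 := norm_integral_gaussian_mul_le hP hs' hfKi
        (fun z => norm_integral_fourier_mul_le f hKi (fun z => hC s hs' τ hτ P hP z) z) z
      have h2 : ∀ ξ, ((Real.exp (-(s * ((2 * Real.pi * ‖ξ‖) ^ 2 -
          (2 * Real.pi * inner ℝ P ξ) ^ 2))) : ℝ) : ℂ) * (𝓕 f ξ * K ξ) * wave z ξ =
          Real.exp (-(s * symDet P ξ)) • G ξ := by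
        intro ξ
        have h3 : Real.exp (-(s * symDet P ξ)) = Real.exp (-(s * ((2 * Real.pi * ‖ξ‖) ^ 2 -
            (2 * Real.pi * inner ℝ P ξ) ^ 2))) * Real.exp (-(s * (2 * Real.pi * ‖ξ‖) ^ 4)) := by
          rw [← Real.exp_add]
          congr 1
          unfold symDet
          ring
        have h4 : prof α (β - N) (2 * Real.pi * ‖ξ‖) * (1 + (2 * Real.pi * ‖ξ‖) ^ 2) ^ N =
            prof α β (2 * Real.pi * ‖ξ‖) := by
          unfold prof
          rw [mul_assoc, ← Real.rpow_natCast _ N, ← Real.rpow_add (by positivity), sub_add_cancel]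
        simp only [K, G]
        rw [← hf, h3, ← h4, Complex.real_smul]
        push_cast
        ring
      simp_rw [h2] at h1
      refine h1.trans_eq ?_
      rw [mul_right_comm]
      congr 1
      refine setIntegral_congr_fun measurableSet_Ioi fun κ _ => ?_
      simp only [g, smul_eq_mul]
      rw [mul_comm, mul_div_assoc]
    calc _ ≤ ∫ s in Set.Ioi (0 : ℝ), (C / |τ| * ∫ x, ‖f x‖) *
          ∫ κ in Set.Ioi (0 : ℝ), Real.exp (-(s * (κ ^ 4 / 2))) • g κ := by
          refine norm_integral_le_of_norm_le (hgs.const_mul _) ?_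
          filter_upwards [ae_restrict_mem measurableSet_Ioi] with s hs' using hs s hs'
      _ = C * I * (∫ x, ‖f x‖) / |τ| := by
          rw [integral_const_mul, hI]
          ring
  · refine norm_integral_le_of_norm_le
      (integrable_prof_mul_schwartz (α := α + m - 4) β (by linarith) ψ).norm ?_
    filter_upwards [ae_norm_pos] with ξ hξ
    rw [norm_mul, norm_wave, mul_one, norm_mul, norm_osc, one_mul]
    exact norm_resonant_le hP α β m hξ

/-! ### Fourier multipliers on `L²` -/

/-- Multiplication of `L²` functions by a bounded function. -/
def mulL2 {m : Space → ℂ} (hm : MemLp m ∞ volume) : L2 →L[ℂ] L2 :=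
  (ContinuousLinearMap.mul ℂ ℂ).holderL volume ∞ 2 2 (hm.toLp m)

theorem coeFn_mulL2 {m : Space → ℂ} (hm : MemLp m ∞ volume) (f : L2) :
    mulL2 hm f =ᵐ[volume] fun ξ => m ξ * f ξ := by
  have h := (ContinuousLinearMap.mul ℂ ℂ).coeFn_holder (r := 2) (hm.toLp m) f
  filter_upwards [h, hm.coeFn_toLp] with ξ h1 h2
  rw [← h2]
  exact h1

/-- The Fourier multiplier with a bounded symbol, as an operator on `L²`. -/
def fourierMul {m : Space → ℂ} (hm : MemLp m ∞ volume) : L2 →L[ℂ] L2 :=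
  ((Lp.fourierTransformₗᵢ Space ℂ).symm : L2 →L[ℂ] L2).comp
    ((mulL2 hm).comp (Lp.fourierTransformₗᵢ Space ℂ : L2 →L[ℂ] L2))

theorem fourier_fourierMul {m : Space → ℂ} (hm : MemLp m ∞ volume) (f : L2) :
    (𝓕 (fourierMul hm f) : L2) =ᵐ[volume] fun ξ => m ξ * (𝓕 f : L2) ξ := by
  have h : (𝓕 (fourierMul hm f) : L2) = mulL2 hm (𝓕 f : L2) :=
    (Lp.fourierTransformₗᵢ Space ℂ).apply_symm_apply _
  rw [h]
  exact coeFn_mulL2 hm _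

theorem ext_fourier {f g : L2} (h : (𝓕 f : L2) =ᵐ[volume] (𝓕 g : L2)) : f = g :=
  (Lp.fourierTransformₗᵢ Space ℂ).injective (Lp.ext h)

theorem norm_sq_L2_eq (f : L2) : ‖f‖ ^ 2 = ∫ x, ‖f x‖ ^ 2 := by
  have h := @inner_self_eq_norm_sq_to_K ℂ L2 _ _ _ f
  rw [L2.inner_def] at h
  have h2 : ∀ x, inner ℂ (f x) (f x) = ((‖f x‖ ^ 2 : ℝ) : ℂ) := fun x => by
    rw [inner_self_eq_norm_sq_to_K]; push_cast; rfl
  simp_rw [h2] at h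
  rw [integral_complex_ofReal] at h
  exact Complex.ofReal_injective (by rw [h]; push_cast; rfl)

/-- Dominated convergence in `L²`, for functions given by almost everywhere representatives. -/
theorem tendsto_L2_of_dominated {ι : Type*} {l : Filter ι} [l.IsCountablyGenerated]
    {f : ι → L2} {f₀ : L2} {F : ι → Space → ℂ} {F₀ : Space → ℂ} {g : Space → ℝ}
    (hf : ∀ i, f i =ᵐ[volume] F i) (hf₀ : f₀ =ᵐ[volume] F₀) (hg : MemLp g 2 volume)
    (hb : ∀ᶠ i in l, ∀ᵐ ξ, ‖F i ξ - F₀ ξ‖ ≤ g ξ)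
    (hlim : ∀ᵐ ξ, Tendsto (fun i => F i ξ) l (𝓝 (F₀ ξ))) : Tendsto f l (𝓝 f₀) := by
  have hsub : ∀ i, (f i - f₀ : L2) =ᵐ[volume] fun ξ => F i ξ - F₀ ξ := fun i => by
    filter_upwards [Lp.coeFn_sub (f i) f₀, hf i, hf₀] with ξ h1 h2 h3
    rw [h1, Pi.sub_apply, h2, h3]
  have h2 : ∀ i, ‖f i - f₀‖ ^ 2 = ∫ ξ, ‖F i ξ - F₀ ξ‖ ^ 2 := fun i => by
    rw [norm_sq_L2_eq]
    exact integral_congr_ae ((hsub i).fun_comp fun z => ‖z‖ ^ 2)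
  have h3 : Tendsto (fun i => ∫ ξ, ‖F i ξ - F₀ ξ‖ ^ 2) l (𝓝 (∫ _ : Space, (0 : ℝ))) := by
    refine tendsto_integral_filter_of_dominated_convergence (fun ξ => g ξ ^ 2) ?_ ?_
      hg.integrable_sq ?_
    · refine Eventually.of_forall fun i => ?_
      exact (((Lp.aestronglyMeasurable (f i - f₀)).congr (hsub i)).norm.pow 2)
    · filter_upwards [hb] with i hi
      filter_upwards [hi] with ξ hξ
      rw [Real.norm_of_nonneg (by positivity)]
      gcongr
    · filter_upwards [hlim] with ξ hξ
      have := ((hξ.sub_const (F₀ ξ)).norm).pow 2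
      simpa using this
  rw [tendsto_iff_norm_sub_tendsto_zero]
  have h4 : Tendsto (fun i => √(‖f i - f₀‖ ^ 2)) l (𝓝 √0) := by
    refine (Real.continuous_sqrt.tendsto 0).comp ?_
    simp_rw [h2]
    simpa using h3
  simpa [Real.sqrt_sq] using h4

theorem tendsto_state_iff {ι : Type*} {l : Filter ι} {u : ι → State} {g : State} :
    Tendsto u l (𝓝 g) ↔ Tendsto (fun i => (𝓕 (u i).1 : L2)) l (𝓝 (𝓕 g.1)) ∧
      Tendsto (fun i => (𝓕 (u i).2 : L2)) l (𝓝 (𝓕 g.2)) := by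
  rw [Prod.tendsto_iff]
  have h : ∀ (f : ι → L2) (f₀ : L2), Tendsto f l (𝓝 f₀) ↔
      Tendsto (fun i => (𝓕 (f i) : L2)) l (𝓝 (𝓕 f₀)) := fun f f₀ =>
    (Lp.fourierTransformₗᵢ Space ℂ).toHomeomorph.isInducing.tendsto_nhds_iff
  rw [h (fun i => (u i).1), h (fun i => (u i).2)]

/-! ### The semigroup -/

/-- The upper component, at the frequency `ξ`, of the flow of
`u₁' = i a u₁ + κ² u₂`, `u₂' = -(1 + κ²) u₁ + i a u₂`, where `κ = 2π|ξ|` and `a = 2π P · ξ`. -/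
def flowUp (P : Space) (t : ℝ) (ξ : Space) (a b : ℂ) : ℂ :=
  wave (t • P) ξ * ((Real.cos (t * om (2 * Real.pi * ‖ξ‖)) : ℝ) : ℂ) * a +
  wave (t • P) ξ * ((2 * Real.pi * ‖ξ‖ / √(1 + (2 * Real.pi * ‖ξ‖) ^ 2) *
    Real.sin (t * om (2 * Real.pi * ‖ξ‖)) : ℝ) : ℂ) * b

/-- The lower component of the flow whose upper component is `flowUp`. -/
def flowLow (P : Space) (t : ℝ) (ξ : Space) (a b : ℂ) : ℂ :=
  wave (t • P) ξ * ((-(√(1 + (2 * Real.pi * ‖ξ‖) ^ 2) / (2 * Real.pi * ‖ξ‖) *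
    Real.sin (t * om (2 * Real.pi * ‖ξ‖))) : ℝ) : ℂ) * a +
  wave (t • P) ξ * ((Real.cos (t * om (2 * Real.pi * ‖ξ‖)) : ℝ) : ℂ) * b

theorem abs_up_le (κ s : ℝ) : |κ / √(1 + κ ^ 2) * Real.sin s| ≤ 1 := by
  have h := sqrt_one_add_sq_pos κ
  have h1 : |κ| ≤ √(1 + κ ^ 2) := Real.abs_le_sqrt (by linarith)
  rw [abs_mul, abs_div, abs_of_pos h]
  exact mul_le_one₀ ((div_le_one h).2 h1) (abs_nonneg _) (Real.abs_sin_le_one s)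

theorem abs_low_le (t : ℝ) {κ : ℝ} (hκ : 0 ≤ κ) :
    |-(√(1 + κ ^ 2) / κ * Real.sin (t * om κ))| ≤ 2 + 2 * |t| := by
  rcases hκ.eq_or_lt with rfl | hκ
  · simp; positivity
  have h := sqrt_one_add_sq_pos κ
  have hsq := sq_sqrt_one_add_sq κ
  rw [abs_neg, abs_mul, abs_div, abs_of_pos h, abs_of_pos hκ, div_mul_eq_mul_div, div_le_iff₀ hκ]
  rcases le_total κ 1 with h1 | h1
  · have h2 : |Real.sin (t * om κ)| ≤ |t| * (κ * √(1 + κ ^ 2)) := by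
      refine Real.abs_sin_le_abs.trans ?_
      rw [abs_mul, om, abs_of_pos (by positivity : 0 < κ * √(1 + κ ^ 2))]
    calc √(1 + κ ^ 2) * |Real.sin (t * om κ)|
        ≤ √(1 + κ ^ 2) * (|t| * (κ * √(1 + κ ^ 2))) := by gcongr
      _ = |t| * κ * √(1 + κ ^ 2) ^ 2 := by ring
      _ = |t| * κ * (1 + κ ^ 2) := by rw [hsq]
      _ ≤ |t| * κ * 2 := by gcongr; nlinarith
      _ ≤ (2 + 2 * |t|) * κ := by nlinarith
  · have h2 : √(1 + κ ^ 2) ≤ 2 * κ := Real.sqrt_le_iff.2 ⟨by positivity, by nlinarith⟩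
    calc √(1 + κ ^ 2) * |Real.sin (t * om κ)| ≤ (2 * κ) * 1 := by
          gcongr; exact Real.abs_sin_le_one _
      _ ≤ (2 + 2 * |t|) * κ := by nlinarith [abs_nonneg t]

theorem memLp_wave_mul (z : Space) {m : Space → ℝ} (hm : Measurable m) {B : ℝ}
    (hB : ∀ ξ, |m ξ| ≤ B) : MemLp (fun ξ => wave z ξ * ((m ξ : ℝ) : ℂ)) ∞ volume := by
  refine memLp_top_of_bound (by fun_prop) B (Eventually.of_forall fun ξ => ?_)
  rw [norm_mul, norm_wave, one_mul, Complex.norm_real]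
  exact hB ξ

theorem memLp_cos (P : Space) (t : ℝ) :
    MemLp (fun ξ => wave (t • P) ξ * ((Real.cos (t * om (2 * Real.pi * ‖ξ‖)) : ℝ) : ℂ)) ∞
      volume := by
  have := continuous_om.measurable
  exact memLp_wave_mul _ (by fun_prop) fun ξ => Real.abs_cos_le_one _

theorem memLp_sinUp (P : Space) (t : ℝ) :
    MemLp (fun ξ => wave (t • P) ξ * ((2 * Real.pi * ‖ξ‖ / √(1 + (2 * Real.pi * ‖ξ‖) ^ 2) *
      Real.sin (t * om (2 * Real.pi * ‖ξ‖)) : ℝ) : ℂ)) ∞ volume := by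
  have := continuous_om.measurable
  exact memLp_wave_mul _ (by fun_prop) fun ξ => abs_up_le _ _

theorem memLp_sinLow (P : Space) (t : ℝ) :
    MemLp (fun ξ => wave (t • P) ξ * ((-(√(1 + (2 * Real.pi * ‖ξ‖) ^ 2) / (2 * Real.pi * ‖ξ‖) *
      Real.sin (t * om (2 * Real.pi * ‖ξ‖))) : ℝ) : ℂ)) ∞ volume := by
  have := continuous_om.measurable
  exact memLp_wave_mul _ (by fun_prop) fun ξ => abs_low_le _ (by positivity)

/-- The semigroup `e^{tH_P}`: at each frequency, the flow of the symbol of `H_P`. -/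
def semigroup (P : Space) (t : ℝ≥0) : State →L[ℂ] State :=
  ((fourierMul (memLp_cos P t)).coprod (fourierMul (memLp_sinUp P t))).prod
    ((fourierMul (memLp_sinLow P t)).coprod (fourierMul (memLp_cos P t)))

theorem coeFn_fourier_add (f g : L2) :
    (𝓕 (f + g) : L2) =ᵐ[volume] fun ξ => (𝓕 f : L2) ξ + (𝓕 g : L2) ξ := by
  have : (𝓕 (f + g) : L2) = 𝓕 f + 𝓕 g := map_add (Lp.fourierTransformₗᵢ Space ℂ) f g
  rw [this]
  exact Lp.coeFn_add _ _

theorem fourier_semigroup_fst (P : Space) (t : ℝ≥0) (u : State) :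
    (𝓕 (semigroup P t u).1 : L2) =ᵐ[volume]
      fun ξ => flowUp P t ξ ((𝓕 u.1 : L2) ξ) ((𝓕 u.2 : L2) ξ) := by
  filter_upwards [coeFn_fourier_add (fourierMul (memLp_cos P t) u.1)
    (fourierMul (memLp_sinUp P t) u.2), fourier_fourierMul (memLp_cos P t) u.1,
    fourier_fourierMul (memLp_sinUp P t) u.2] with ξ h1 h2 h3
  rw [flowUp, ← h2, ← h3, ← h1]
  rfl

theorem fourier_semigroup_snd (P : Space) (t : ℝ≥0) (u : State) :
    (𝓕 (semigroup P t u).2 : L2) =ᵐ[volume]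
      fun ξ => flowLow P t ξ ((𝓕 u.1 : L2) ξ) ((𝓕 u.2 : L2) ξ) := by
  filter_upwards [coeFn_fourier_add (fourierMul (memLp_sinLow P t) u.1)
    (fourierMul (memLp_cos P t) u.2), fourier_fourierMul (memLp_sinLow P t) u.1,
    fourier_fourierMul (memLp_cos P t) u.2] with ξ h1 h2 h3
  rw [flowLow, ← h2, ← h3, ← h1]
  rfl

theorem wave_zero (ξ : Space) : wave 0 ξ = 1 := by simp [wave]

theorem flowUp_zero (P ξ : Space) (a b : ℂ) : flowUp P 0 ξ a b = a := by
  simp [flowUp, wave_zero]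

theorem flowLow_zero (P ξ : Space) (a b : ℂ) : flowLow P 0 ξ a b = b := by
  simp [flowLow, wave_zero]

theorem flowUp_add (P : Space) (s t : ℝ) {ξ : Space} (hξ : 0 < 2 * Real.pi * ‖ξ‖) (a b : ℂ) :
    flowUp P (s + t) ξ a b = flowUp P s ξ (flowUp P t ξ a b) (flowLow P t ξ a b) := by
  have h := sqrt_one_add_sq_pos (2 * Real.pi * ‖ξ‖)
  unfold flowUp flowLow
  rw [add_smul, wave_add, add_mul, Real.cos_add, Real.sin_add]
  generalize 2 * Real.pi * ‖ξ‖ = κ at *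
  have hc : (κ : ℂ) ≠ 0 := by exact_mod_cast hξ.ne'
  have hd : (√(1 + κ ^ 2) : ℂ) ≠ 0 := by exact_mod_cast h.ne'
  generalize √(1 + κ ^ 2) = r at *
  push_cast
  field_simp
  ring

theorem flowLow_add (P : Space) (s t : ℝ) {ξ : Space} (hξ : 0 < 2 * Real.pi * ‖ξ‖) (a b : ℂ) :
    flowLow P (s + t) ξ a b = flowLow P s ξ (flowUp P t ξ a b) (flowLow P t ξ a b) := by
  have h := sqrt_one_add_sq_pos (2 * Real.pi * ‖ξ‖)
  unfold flowUp flowLow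
  rw [add_smul, wave_add, add_mul, Real.cos_add, Real.sin_add]
  generalize 2 * Real.pi * ‖ξ‖ = κ at *
  have hc : (κ : ℂ) ≠ 0 := by exact_mod_cast hξ.ne'
  have hd : (√(1 + κ ^ 2) : ℂ) ≠ 0 := by exact_mod_cast h.ne'
  generalize √(1 + κ ^ 2) = r at *
  push_cast
  field_simp
  ring

theorem norm_flowUp_le (P : Space) (t : ℝ) (ξ : Space) (a b : ℂ) :
    ‖flowUp P t ξ a b‖ ≤ ‖a‖ + ‖b‖ := by
  refine (norm_add_le _ _).trans ?_
  simp only [norm_mul, norm_wave, one_mul, Complex.norm_real, Real.norm_eq_abs]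
  refine add_le_add (mul_le_of_le_one_left (norm_nonneg _) (Real.abs_cos_le_one _)) ?_
  rw [← abs_mul]
  exact mul_le_of_le_one_left (norm_nonneg _) (abs_up_le _ _)

theorem norm_flowLow_le (P : Space) (t : ℝ) (ξ : Space) (a b : ℂ) :
    ‖flowLow P t ξ a b‖ ≤ (2 + 2 * |t|) * ‖a‖ + ‖b‖ := by
  refine (norm_add_le _ _).trans ?_
  rw [norm_mul, norm_mul, norm_mul, norm_mul, norm_wave, one_mul, one_mul, Complex.norm_real,
    Complex.norm_real, Real.norm_eq_abs, Real.norm_eq_abs]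
  refine add_le_add ?_ (mul_le_of_le_one_left (norm_nonneg _) (Real.abs_cos_le_one _))
  exact mul_le_mul_of_nonneg_right (abs_low_le t (by positivity)) (norm_nonneg _)

theorem hasDerivAt_wave_smul (P ξ : Space) (t : ℝ) :
    HasDerivAt (fun t : ℝ => wave (t • P) ξ)
      (Complex.I * ((2 * Real.pi * inner ℝ P ξ : ℝ) : ℂ) * wave (t • P) ξ) t := by
  have h : ∀ t : ℝ, wave (t • P) ξ =
      Complex.exp (Complex.I * ((t * (2 * Real.pi * inner ℝ P ξ) : ℝ) : ℂ)) := fun t => by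
    rw [wave, real_inner_smul_left]; congr 3; ring
  simp_rw [h]
  have h1 := (((hasDerivAt_id t).mul_const (2 * Real.pi * inner ℝ P ξ)).ofReal_comp.const_mul
    Complex.I).cexp
  refine h1.congr_deriv ?_
  simp [mul_comm]

theorem hasDerivAt_flowUp (P : Space) (t : ℝ) {ξ : Space} (hξ : 0 < 2 * Real.pi * ‖ξ‖)
    (a b : ℂ) :
    HasDerivAt (fun t => flowUp P t ξ a b)
      (flowUp P t ξ
        (Complex.I * ((2 * Real.pi * inner ℝ P ξ : ℝ) : ℂ) * a +
          (((2 * Real.pi * ‖ξ‖) ^ 2 : ℝ) : ℂ) * b)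
        (-((((2 * Real.pi * ‖ξ‖) ^ 2 + 1 : ℝ) : ℂ) * a) +
          Complex.I * ((2 * Real.pi * inner ℝ P ξ : ℝ) : ℂ) * b)) t := by
  have hw := hasDerivAt_wave_smul P ξ t
  have h := sqrt_one_add_sq_pos (2 * Real.pi * ‖ξ‖)
  have hsq := sq_sqrt_one_add_sq (2 * Real.pi * ‖ξ‖)
  unfold flowUp om
  generalize 2 * Real.pi * ‖ξ‖ = κ at *
  generalize √(1 + κ ^ 2) = r at *
  have h0 : HasDerivAt (fun t : ℝ => t * (κ * r)) (κ * r) t := by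
    simpa using (hasDerivAt_id t).mul_const (κ * r)
  have h1 := h0.cos.ofReal_comp
  have h2 := (h0.sin.const_mul (κ / r)).ofReal_comp
  have h3 := ((hw.mul h1).mul_const a).add ((hw.mul h2).mul_const b)
  refine h3.congr_deriv ?_
  have hc : (κ : ℂ) ≠ 0 := by exact_mod_cast hξ.ne'
  have hd : (r : ℂ) ≠ 0 := by exact_mod_cast h.ne'
  have hsq' : (κ : ℂ) ^ 2 = r ^ 2 - 1 := by
    rw [← Complex.ofReal_pow, ← Complex.ofReal_pow, hsq]; push_cast; ring
  generalize Real.cos (t * (κ * r)) = C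
  generalize Real.sin (t * (κ * r)) = S
  push_cast
  field_simp
  linear_combination (wave (t • P) ξ * S * κ * a) * hsq'

theorem hasDerivAt_flowLow (P : Space) (t : ℝ) {ξ : Space} (hξ : 0 < 2 * Real.pi * ‖ξ‖)
    (a b : ℂ) :
    HasDerivAt (fun t => flowLow P t ξ a b)
      (flowLow P t ξ
        (Complex.I * ((2 * Real.pi * inner ℝ P ξ : ℝ) : ℂ) * a +
          (((2 * Real.pi * ‖ξ‖) ^ 2 : ℝ) : ℂ) * b)
        (-((((2 * Real.pi * ‖ξ‖) ^ 2 + 1 : ℝ) : ℂ) * a) +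
          Complex.I * ((2 * Real.pi * inner ℝ P ξ : ℝ) : ℂ) * b)) t := by
  have hw := hasDerivAt_wave_smul P ξ t
  have h := sqrt_one_add_sq_pos (2 * Real.pi * ‖ξ‖)
  have hsq := sq_sqrt_one_add_sq (2 * Real.pi * ‖ξ‖)
  unfold flowLow om
  generalize 2 * Real.pi * ‖ξ‖ = κ at *
  generalize √(1 + κ ^ 2) = r at *
  have h0 : HasDerivAt (fun t : ℝ => t * (κ * r)) (κ * r) t := by
    simpa using (hasDerivAt_id t).mul_const (κ * r)
  have h1 := h0.cos.ofReal_comp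
  have h2 : HasDerivAt (fun y : ℝ => ((-(r / κ * Real.sin (y * (κ * r))) : ℝ) : ℂ)) _ t :=
    (h0.sin.const_mul (r / κ)).neg.ofReal_comp
  have h3 := ((hw.mul h2).mul_const a).add ((hw.mul h1).mul_const b)
  refine h3.congr_deriv ?_
  have hc : (κ : ℂ) ≠ 0 := by exact_mod_cast hξ.ne'
  have hd : (r : ℂ) ≠ 0 := by exact_mod_cast h.ne'
  have hsq' : (r : ℂ) ^ 2 = κ ^ 2 + 1 := by
    rw [← Complex.ofReal_pow, hsq]; push_cast; ring
  generalize Real.cos (t * (κ * r)) = C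
  generalize Real.sin (t * (κ * r)) = S
  push_cast
  field_simp
  linear_combination (-(wave (t • P) ξ * κ * C * a)) * hsq'

theorem semigroup_zero (P : Space) : semigroup P 0 = ContinuousLinearMap.id ℂ State := by
  refine ContinuousLinearMap.ext fun u => ?_
  refine Prod.ext (ext_fourier ?_) (ext_fourier ?_)
  · filter_upwards [fourier_semigroup_fst P 0 u] with ξ h
    rw [h, NNReal.coe_zero, flowUp_zero]; rfl
  · filter_upwards [fourier_semigroup_snd P 0 u] with ξ h
    rw [h, NNReal.coe_zero, flowLow_zero]; rfl

theorem semigroup_add (P : Space) (s t : ℝ≥0) :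
    semigroup P (s + t) = (semigroup P s).comp (semigroup P t) := by
  refine ContinuousLinearMap.ext fun u => ?_
  refine Prod.ext (ext_fourier ?_) (ext_fourier ?_)
  · filter_upwards [fourier_semigroup_fst P (s + t) u, fourier_semigroup_fst P t u,
      fourier_semigroup_snd P t u, fourier_semigroup_fst P s (semigroup P t u), ae_norm_pos]
      with ξ h1 h2 h3 h4 hξ
    rw [h1, ContinuousLinearMap.comp_apply, h4, h2, h3, NNReal.coe_add, flowUp_add P _ _ hξ]
  · filter_upwards [fourier_semigroup_snd P (s + t) u, fourier_semigroup_fst P t u,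
      fourier_semigroup_snd P t u, fourier_semigroup_snd P s (semigroup P t u), ae_norm_pos]
      with ξ h1 h2 h3 h4 hξ
    rw [h1, ContinuousLinearMap.comp_apply, h4, h2, h3, NNReal.coe_add, flowLow_add P _ _ hξ]

theorem memLp_norm_fourier (f : L2) : MemLp (fun ξ => ‖(𝓕 f : L2) ξ‖) 2 volume :=
  (Lp.memLp _).norm

theorem continuous_semigroup (P : Space) (u : State) : Continuous fun t => semigroup P t u := by
  rw [continuous_iff_continuousAt]
  intro t₀
  have hu1 := memLp_norm_fourier u.1
  have hu2 := memLp_norm_fourier u.2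
  have hnear : ∀ᶠ t : ℝ≥0 in 𝓝 t₀, (t : ℝ) ≤ t₀ + 1 :=
    (NNReal.continuous_coe.tendsto t₀).eventually_le_const (by linarith)
  refine tendsto_state_iff.2 ⟨?_, ?_⟩
  · refine tendsto_L2_of_dominated (fun t => fourier_semigroup_fst P t u)
      (fourier_semigroup_fst P t₀ u) ((hu1.add hu2).add (hu1.add hu2)) ?_ ?_
    · refine Eventually.of_forall fun t => Eventually.of_forall fun ξ => ?_
      exact (norm_sub_le _ _).trans
        (add_le_add (norm_flowUp_le _ _ _ _ _) (norm_flowUp_le _ _ _ _ _))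
    · filter_upwards [ae_norm_pos] with ξ hξ
      exact ((hasDerivAt_flowUp P t₀ hξ _ _).continuousAt.tendsto).comp
        (NNReal.continuous_coe.tendsto t₀)
  · refine tendsto_L2_of_dominated (fun t => fourier_semigroup_snd P t u)
      (fourier_semigroup_snd P t₀ u) (((hu1.const_mul (2 + 2 * ((t₀ : ℝ) + 1))).add hu2).add
        ((hu1.const_mul (2 + 2 * ((t₀ : ℝ) + 1))).add hu2)) ?_ ?_
    · filter_upwards [hnear] with t ht
      refine Eventually.of_forall fun ξ => ?_
      have hb : ∀ s : ℝ≥0, (s : ℝ) ≤ t₀ + 1 → ∀ a b : ℂ,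
          ‖flowLow P s ξ a b‖ ≤ (2 + 2 * ((t₀ : ℝ) + 1)) * ‖a‖ + ‖b‖ := fun s hs a b => by
        refine (norm_flowLow_le _ _ _ _ _).trans ?_
        rw [abs_of_nonneg s.coe_nonneg]
        gcongr
      exact (norm_sub_le _ _).trans (add_le_add (hb t ht _ _) (hb t₀ (by linarith) _ _))
    · filter_upwards [ae_norm_pos] with ξ hξ
      exact ((hasDerivAt_flowLow P t₀ hξ _ _).continuousAt.tendsto).comp
        (NNReal.continuous_coe.tendsto t₀)

/-! ### The generator -/

theorem integrable_schwartz_mul (ψ : 𝓢(Space, ℂ)) (f : L2) :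
    Integrable (fun x => ψ x * f x) volume :=
  MemLp.integrable_mul (p := 2) (q := 2) (ψ.memLp 2 volume) (Lp.memLp f)

/-- An identity `m₁ u₁ + m₂ u₂ = g` between tempered distributions, with `m₁`, `m₂` of temperate
growth and `u₁`, `u₂`, `g` in `L²`, is an identity between functions almost everywhere. -/
theorem smulLeftCLM_add_eq_iff {m₁ m₂ : Space → ℂ} (h₁ : m₁.HasTemperateGrowth)
    (h₂ : m₂.HasTemperateGrowth) (u₁ u₂ g : L2) :
    TemperedDistribution.smulLeftCLM ℂ m₁ (Lp.toTemperedDistribution u₁) +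
        TemperedDistribution.smulLeftCLM ℂ m₂ (Lp.toTemperedDistribution u₂) =
      Lp.toTemperedDistribution g ↔ ∀ᵐ ξ, m₁ ξ * u₁ ξ + m₂ ξ * u₂ ξ = g ξ := by
  have key : ∀ ψ : 𝓢(Space, ℂ),
      ((TemperedDistribution.smulLeftCLM ℂ m₁ (Lp.toTemperedDistribution u₁) +
        TemperedDistribution.smulLeftCLM ℂ m₂ (Lp.toTemperedDistribution u₂)) ψ =
      Lp.toTemperedDistribution g ψ ↔ ∫ x, ψ x * (m₁ x * u₁ x + m₂ x * u₂ x - g x) = 0) := by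
    intro ψ
    have e1 : (TemperedDistribution.smulLeftCLM ℂ m₁ (Lp.toTemperedDistribution u₁) +
        TemperedDistribution.smulLeftCLM ℂ m₂ (Lp.toTemperedDistribution u₂)) ψ =
        (∫ x, SchwartzMap.smulLeftCLM ℂ m₁ ψ x * u₁ x) +
          ∫ x, SchwartzMap.smulLeftCLM ℂ m₂ ψ x * u₂ x := by
      change TemperedDistribution.smulLeftCLM ℂ m₁ (Lp.toTemperedDistribution u₁) ψ +
        TemperedDistribution.smulLeftCLM ℂ m₂ (Lp.toTemperedDistribution u₂) ψ = _
      simp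
    have i1 := integrable_schwartz_mul (SchwartzMap.smulLeftCLM ℂ m₁ ψ) u₁
    have i2 := integrable_schwartz_mul (SchwartzMap.smulLeftCLM ℂ m₂ ψ) u₂
    have i3 := integrable_schwartz_mul ψ g
    rw [e1, Lp.toTemperedDistribution_apply, ← sub_eq_zero]
    simp only [smul_eq_mul]
    rw [← integral_add i1 i2]
    erw [← integral_sub (i1.add i2) i3]
    have e2 : ∀ x, SchwartzMap.smulLeftCLM ℂ m₁ ψ x * u₁ x +
        SchwartzMap.smulLeftCLM ℂ m₂ ψ x * u₂ x - ψ x * g x =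
        ψ x * (m₁ x * u₁ x + m₂ x * u₂ x - g x) := fun x => by
      rw [SchwartzMap.smulLeftCLM_apply_apply h₁, SchwartzMap.smulLeftCLM_apply_apply h₂]
      simp only [smul_eq_mul]
      ring
    exact Iff.of_eq (congrArg (· = 0) (integral_congr_ae (Eventually.of_forall e2)))
  constructor
  · intro h
    have hloc : ∀ f : L2, LocallyIntegrable f volume := fun f =>
      (Lp.memLp f).locallyIntegrable (by norm_num)
    have hz : (fun x => m₁ x * u₁ x + m₂ x * u₂ x - g x) =ᵐ[volume] 0 := by
      apply ae_eq_zero_of_integral_contDiff_smul_eq_zero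
      · refine LocallyIntegrable.sub (LocallyIntegrable.add ?_ ?_) (hloc g)
        · exact (hloc u₁).continuous_smul h₁.1.continuous
        · exact (hloc u₂).continuous_smul h₂.1.continuous
      · intro φ φ_smooth φ_cpt
        have hφ₁ : HasCompactSupport (Complex.ofRealCLM ∘ φ) := φ_cpt.comp_left rfl
        have hφ₂ : ContDiff ℝ ∞ (Complex.ofRealCLM ∘ φ) := by fun_prop
        have := (key (hφ₁.toSchwartzMap hφ₂)).1 (by rw [h])
        simpa using this
    filter_upwards [hz] with x hx
    exact sub_eq_zero.1 hx
  · intro h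
    ext ψ
    rw [key ψ]
    have : ∀ᵐ x, ψ x * (m₁ x * u₁ x + m₂ x * u₂ x - g x) = 0 := by
      filter_upwards [h] with x hx
      rw [hx, sub_self, mul_zero]
    rw [integral_congr_ae this, integral_zero]

theorem smul_smulLeftCLM {g : Space → ℂ} (hg : g.HasTemperateGrowth) (c : ℂ)
    (f : 𝓢'(Space, ℂ)) :
    c • TemperedDistribution.smulLeftCLM ℂ g f =
      TemperedDistribution.smulLeftCLM ℂ (fun ξ => c * g ξ) f :=
  (congrArg (· f) (TemperedDistribution.smulLeftCLM_smul (F := ℂ) hg c)).symm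

theorem fourier_lineDeriv (P : Space) (f : 𝓢'(Space, ℂ)) :
    𝓕 (∂_{P} f) = TemperedDistribution.smulLeftCLM ℂ
      (fun ξ : Space => Complex.I * ((2 * Real.pi * inner ℝ P ξ : ℝ) : ℂ)) (𝓕 f) := by
  have hg : (fun ξ : Space => ((inner ℝ ξ P : ℝ) : ℂ)).HasTemperateGrowth := by fun_prop
  rw [TemperedDistribution.fourier_lineDerivOp_eq, smul_smulLeftCLM hg]
  congr 2
  ext ξ
  rw [real_inner_comm]
  push_cast
  ring

theorem temperate_normSq :
    (fun ξ : Space => (((2 * Real.pi * ‖ξ‖) ^ 2 : ℝ) : ℂ)).HasTemperateGrowth := by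
  have h : (fun ξ : Space => (((2 * Real.pi * ‖ξ‖) ^ 2 : ℝ) : ℂ)) =
      fun ξ : Space => ((((2 * Real.pi) ^ 2 : ℝ)) : ℂ) * ((‖ξ‖ ^ 2 : ℝ) : ℂ) := by
    ext ξ; push_cast; ring
  rw [h]
  fun_prop

theorem temperate_axial (P : Space) :
    (fun ξ : Space => Complex.I * ((2 * Real.pi * inner ℝ P ξ : ℝ) : ℂ)).HasTemperateGrowth := by
  fun_prop

theorem fourier_laplacian (f : 𝓢'(Space, ℂ)) :
    𝓕 (Δ f) = TemperedDistribution.smulLeftCLM ℂ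
      (fun ξ : Space => -(((2 * Real.pi * ‖ξ‖) ^ 2 : ℝ) : ℂ)) (𝓕 f) := by
  have hg : (fun ξ : Space => ((‖ξ‖ ^ 2 : ℝ) : ℂ)).HasTemperateGrowth := by fun_prop
  rw [TemperedDistribution.laplacian_eq_fourierMultiplierCLM,
    TemperedDistribution.fourierMultiplierCLM_apply, ← Complex.coe_smul, ← FourierTransform.fourierInv_smul,
    FourierTransform.fourier_fourierInv_eq, smul_smulLeftCLM hg]
  congr 2
  ext ξ
  push_cast
  ring

theorem diffOp_eq_iff (P : Space) (u g : State) :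
    diffOp P (toDistr u) = toDistr g ↔ ∀ᵐ ξ : Space,
      Complex.I * ((2 * Real.pi * inner ℝ P ξ : ℝ) : ℂ) * (𝓕 u.1 : L2) ξ +
          (((2 * Real.pi * ‖ξ‖) ^ 2 : ℝ) : ℂ) * (𝓕 u.2 : L2) ξ = (𝓕 g.1 : L2) ξ ∧
        -((((2 * Real.pi * ‖ξ‖) ^ 2 + 1 : ℝ) : ℂ) * (𝓕 u.1 : L2) ξ) +
          Complex.I * ((2 * Real.pi * inner ℝ P ξ : ℝ) : ℂ) * (𝓕 u.2 : L2) ξ =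
            (𝓕 g.2 : L2) ξ := by
  have hinj : ∀ f g : 𝓢'(Space, ℂ), f = g ↔ 𝓕 f = 𝓕 g := fun f g =>
    (FourierTransform.fourierEquiv ℂ 𝓢'(Space, ℂ)).injective.eq_iff.symm
  have hF : ∀ f : L2, 𝓕 (Lp.toTemperedDistribution f) = Lp.toTemperedDistribution (𝓕 f : L2) :=
    Lp.fourier_toTemperedDistribution_eq
  have hsq := temperate_normSq
  have hneg : (fun ξ : Space => -(((2 * Real.pi * ‖ξ‖) ^ 2 : ℝ) : ℂ)).HasTemperateGrowth :=
    hsq.neg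
  have hc : (fun _ : Space => (-1 : ℂ)).HasTemperateGrowth := .const _
  have e : (fun ξ : Space => -(((2 * Real.pi * ‖ξ‖) ^ 2 + 1 : ℝ) : ℂ)) =
      (fun ξ : Space => -(((2 * Real.pi * ‖ξ‖) ^ 2 : ℝ) : ℂ)) + fun _ => (-1 : ℂ) := by
    ext ξ; simp only [Pi.add_apply]; push_cast; ring
  have hsq1 : (fun ξ : Space => -(((2 * Real.pi * ‖ξ‖) ^ 2 + 1 : ℝ) : ℂ)).HasTemperateGrowth := by
    rw [e]; exact hneg.add hc
  have h1 : 𝓕 (∂_{P} (Lp.toTemperedDistribution u.1) + -Δ (Lp.toTemperedDistribution u.2)) =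
      TemperedDistribution.smulLeftCLM ℂ
        (fun ξ : Space => Complex.I * ((2 * Real.pi * inner ℝ P ξ : ℝ) : ℂ))
        (Lp.toTemperedDistribution (𝓕 u.1 : L2)) +
      TemperedDistribution.smulLeftCLM ℂ
        (fun ξ : Space => (((2 * Real.pi * ‖ξ‖) ^ 2 : ℝ) : ℂ))
        (Lp.toTemperedDistribution (𝓕 u.2 : L2)) := by
    rw [FourierTransform.fourier_add, FourierTransform.fourier_neg,
      fourier_lineDeriv, fourier_laplacian, hF, hF, ← neg_one_smul ℂ, smul_smulLeftCLM hneg]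
    simp
  have h2 : 𝓕 (-(-Δ (Lp.toTemperedDistribution u.1) + Lp.toTemperedDistribution u.1) +
        ∂_{P} (Lp.toTemperedDistribution u.2)) =
      TemperedDistribution.smulLeftCLM ℂ
        (fun ξ : Space => -(((2 * Real.pi * ‖ξ‖) ^ 2 + 1 : ℝ) : ℂ))
        (Lp.toTemperedDistribution (𝓕 u.1 : L2)) +
      TemperedDistribution.smulLeftCLM ℂ
        (fun ξ : Space => Complex.I * ((2 * Real.pi * inner ℝ P ξ : ℝ) : ℂ))
        (Lp.toTemperedDistribution (𝓕 u.2 : L2)) := by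
    rw [FourierTransform.fourier_add, FourierTransform.fourier_neg, FourierTransform.fourier_add,
      FourierTransform.fourier_neg, fourier_lineDeriv, fourier_laplacian, hF, hF, e,
      TemperedDistribution.smulLeftCLM_add hneg hc]
    congr 1
    rw [neg_add, neg_neg]
    change _ = TemperedDistribution.smulLeftCLM ℂ _ _ + TemperedDistribution.smulLeftCLM ℂ _ _
    rw [TemperedDistribution.smulLeftCLM_const]
    exact congrArg _ (neg_one_smul ℂ _).symm
  have h3 : diffOp P (toDistr u) = toDistr g ↔
      ∂_{P} (Lp.toTemperedDistribution u.1) + -Δ (Lp.toTemperedDistribution u.2) =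
        Lp.toTemperedDistribution g.1 ∧
      -(-Δ (Lp.toTemperedDistribution u.1) + Lp.toTemperedDistribution u.1) +
        ∂_{P} (Lp.toTemperedDistribution u.2) = Lp.toTemperedDistribution g.2 := Prod.ext_iff
  rw [h3, hinj, hinj _ (Lp.toTemperedDistribution g.2), h1, h2, hF, hF,
    smulLeftCLM_add_eq_iff (temperate_axial P) hsq,
    smulLeftCLM_add_eq_iff hsq1 (temperate_axial P), ← eventually_and]
  simp only [neg_mul]

theorem coeFn_quotient {v : ℝ≥0 → L2} {v₀ : L2} {φ : ℝ → Space → ℂ}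
    (hv : ∀ t : ℝ≥0, v t =ᵐ[volume] φ t) (hv₀ : v₀ =ᵐ[volume] φ 0) (t : ℝ≥0) :
    ((t : ℝ)⁻¹ • (v t - v₀) : L2) =ᵐ[volume] fun ξ => (t : ℝ)⁻¹ • (φ t ξ - φ 0 ξ) := by
  filter_upwards [Lp.coeFn_smul (t : ℝ)⁻¹ (v t - v₀), Lp.coeFn_sub (v t) v₀, hv t, hv₀]
    with ξ h1 h2 h3 h4
  rw [h1, Pi.smul_apply, h2, Pi.sub_apply, h3, h4]

theorem tendsto_coe_nhdsGT : Tendsto (fun t : ℝ≥0 => (t : ℝ)) (𝓝[>] 0) (𝓝[>] 0) := by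
  refine tendsto_nhdsWithin_iff.2 ⟨?_, ?_⟩
  · exact (NNReal.continuous_coe.tendsto' 0 0 rfl).mono_left nhdsWithin_le_nhds
  · filter_upwards [self_mem_nhdsWithin] with t ht
    exact NNReal.coe_pos.2 ht

theorem tendsto_quotient_apply {φ : ℝ → ℂ} {φ' : ℂ} (hd : HasDerivAt φ φ' 0) :
    Tendsto (fun t : ℝ≥0 => (t : ℝ)⁻¹ • (φ t - φ 0)) (𝓝[>] 0) (𝓝 φ') := by
  have h := hd.tendsto_slope_zero_right
  simp only [zero_add] at h
  exact h.comp tendsto_coe_nhdsGT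

/-- If difference quotients converge in `L²` and pointwise, the limits agree. -/
theorem ae_eq_of_tendsto_quotient {v : ℝ≥0 → L2} {v₀ g : L2} {φ : ℝ → Space → ℂ}
    {φ' : Space → ℂ} (hv : ∀ t : ℝ≥0, v t =ᵐ[volume] φ t) (hv₀ : v₀ =ᵐ[volume] φ 0)
    (hd : ∀ᵐ ξ, HasDerivAt (fun t => φ t ξ) (φ' ξ) 0)
    (h : Tendsto (fun t : ℝ≥0 => (t : ℝ)⁻¹ • (v t - v₀)) (𝓝[>] 0) (𝓝 g)) :
    g =ᵐ[volume] φ' := by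
  obtain ⟨ns, hns, hae⟩ := (tendstoInMeasure_of_tendsto_Lp h).exists_seq_tendsto_ae'
  have hall : ∀ᵐ ξ, ∀ i, ((ns i : ℝ)⁻¹ • (v (ns i) - v₀) : L2) ξ =
      (ns i : ℝ)⁻¹ • (φ (ns i) ξ - φ 0 ξ) :=
    ae_all_iff.2 fun i => coeFn_quotient hv hv₀ (ns i)
  filter_upwards [hae, hall, hd] with ξ h1 h2 h3
  simp_rw [h2] at h1
  exact tendsto_nhds_unique h1 ((tendsto_quotient_apply h3).comp hns)

/-- Difference quotients with a square integrable bound on the derivative converge in `L²`. -/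
theorem tendsto_quotient {v : ℝ≥0 → L2} {v₀ g : L2} {φ : ℝ → Space → ℂ}
    {b : Space → ℝ} (hv : ∀ t : ℝ≥0, v t =ᵐ[volume] φ t) (hv₀ : v₀ =ᵐ[volume] φ 0)
    (hd : ∀ᵐ ξ, HasDerivAt (fun t => φ t ξ) (g ξ) 0) (hb : MemLp b 2 volume)
    (hφ : ∀ᵐ ξ, ∀ t ∈ Set.Icc (0 : ℝ) 1, ∃ d, HasDerivAt (fun t => φ t ξ) d t ∧ ‖d‖ ≤ b ξ) :
    Tendsto (fun t : ℝ≥0 => (t : ℝ)⁻¹ • (v t - v₀)) (𝓝[>] 0) (𝓝 g) := by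
  refine tendsto_L2_of_dominated (F₀ := g) (coeFn_quotient hv hv₀) ae_eq_rfl
    (hb.add (Lp.memLp g).norm) ?_ ?_
  · have h1 : ∀ᶠ t : ℝ≥0 in 𝓝[>] 0, t < 1 :=
      nhdsWithin_le_nhds (Iio_mem_nhds zero_lt_one)
    filter_upwards [h1, self_mem_nhdsWithin] with t ht1 ht0
    filter_upwards [hφ] with ξ hξ
    refine (norm_sub_le _ _).trans (add_le_add ?_ le_rfl)
    choose! d hd1 hd2 using hξ
    have ht : (0 : ℝ) < t := NNReal.coe_pos.2 ht0
    have ht' : (t : ℝ) ≤ 1 := by exact_mod_cast ht1.le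
    have hmv := norm_image_sub_le_of_norm_deriv_le_segment' (f := fun t => φ t ξ) (f' := d)
      (a := 0) (b := t) (C := b ξ)
      (fun x hx => (hd1 x ⟨hx.1, hx.2.trans ht'⟩).hasDerivWithinAt)
      (fun x hx => hd2 x ⟨hx.1, hx.2.le.trans ht'⟩) t ⟨ht.le, le_rfl⟩
    rw [norm_smul, norm_inv, Real.norm_of_nonneg ht.le, inv_mul_le_iff₀ ht, mul_comm]
    simpa using hmv
  · filter_upwards [hd] with ξ hξ
    exact tendsto_quotient_apply hξ

theorem fourier_sub_smul (c : ℝ) (f g : L2) :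
    (𝓕 (c • (f - g)) : L2) = c • ((𝓕 f : L2) - 𝓕 g) := by
  have h := (Lp.fourierTransformₗᵢ Space ℂ).map_smul (c : ℂ) (f - g)
  rw [map_sub, Complex.coe_smul, Complex.coe_smul] at h
  exact h

theorem isSemigroupGeneratedBy_semigroup (P : Space) :
    IsSemigroupGeneratedBy (H P) (semigroup P) where
  zero := semigroup_zero P
  add := semigroup_add P
  continuous := continuous_semigroup P
  generator u g := by
    have z1 : (𝓕 u.1 : L2) =ᵐ[volume]
        fun ξ => flowUp P 0 ξ ((𝓕 u.1 : L2) ξ) ((𝓕 u.2 : L2) ξ) :=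
      Eventually.of_forall fun ξ => (flowUp_zero _ _ _ _).symm
    have z2 : (𝓕 u.2 : L2) =ᵐ[volume]
        fun ξ => flowLow P 0 ξ ((𝓕 u.1 : L2) ξ) ((𝓕 u.2 : L2) ξ) :=
      Eventually.of_forall fun ξ => (flowLow_zero _ _ _ _).symm
    rw [mem_H_graph, diffOp_eq_iff, tendsto_state_iff]
    simp only [Prod.smul_fst, Prod.smul_snd, Prod.fst_sub, Prod.snd_sub, fourier_sub_smul]
    constructor
    · intro h
      have hg1 := memLp_norm_fourier g.1
      have hg2 := memLp_norm_fourier g.2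
      constructor
      · refine tendsto_quotient
          (φ := fun t ξ => flowUp P t ξ ((𝓕 u.1 : L2) ξ) ((𝓕 u.2 : L2) ξ))
          (fun t => fourier_semigroup_fst P t u) z1 ?_ (hg1.add hg2) ?_
        · filter_upwards [h, ae_norm_pos] with ξ h1 hξ
          have := hasDerivAt_flowUp P 0 hξ ((𝓕 u.1 : L2) ξ) ((𝓕 u.2 : L2) ξ)
          rwa [flowUp_zero, h1.1] at this
        · filter_upwards [h, ae_norm_pos] with ξ h1 hξ t _
          have := hasDerivAt_flowUp P t hξ ((𝓕 u.1 : L2) ξ) ((𝓕 u.2 : L2) ξ)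
          rw [h1.1, h1.2] at this
          exact ⟨_, this, norm_flowUp_le _ _ _ _ _⟩
      · refine tendsto_quotient
          (φ := fun t ξ => flowLow P t ξ ((𝓕 u.1 : L2) ξ) ((𝓕 u.2 : L2) ξ))
          (fun t => fourier_semigroup_snd P t u) z2 ?_
          ((hg1.const_mul (2 + 2)).add hg2) ?_
        · filter_upwards [h, ae_norm_pos] with ξ h1 hξ
          have := hasDerivAt_flowLow P 0 hξ ((𝓕 u.1 : L2) ξ) ((𝓕 u.2 : L2) ξ)
          rwa [flowLow_zero, h1.2] at this
        · filter_upwards [h, ae_norm_pos] with ξ h1 hξ t ht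
          have := hasDerivAt_flowLow P t hξ ((𝓕 u.1 : L2) ξ) ((𝓕 u.2 : L2) ξ)
          rw [h1.1, h1.2] at this
          refine ⟨_, this, (norm_flowLow_le _ _ _ _ _).trans ?_⟩
          rw [abs_of_nonneg ht.1]
          have := ht.2
          simp only [Pi.add_apply]
          gcongr
          linarith
    · rintro ⟨h1, h2⟩
      have e1 := ae_eq_of_tendsto_quotient
        (φ := fun t ξ => flowUp P t ξ ((𝓕 u.1 : L2) ξ) ((𝓕 u.2 : L2) ξ))
        (fun t => fourier_semigroup_fst P t u) z1 (ae_norm_pos.mono fun ξ hξ =>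
          hasDerivAt_flowUp P 0 hξ ((𝓕 u.1 : L2) ξ) ((𝓕 u.2 : L2) ξ)) h1
      have e2 := ae_eq_of_tendsto_quotient
        (φ := fun t ξ => flowLow P t ξ ((𝓕 u.1 : L2) ξ) ((𝓕 u.2 : L2) ξ))
        (fun t => fourier_semigroup_snd P t u) z2 (ae_norm_pos.mono fun ξ hξ =>
          hasDerivAt_flowLow P 0 hξ ((𝓕 u.1 : L2) ξ) ((𝓕 u.2 : L2) ξ)) h2
      filter_upwards [e1, e2] with ξ h3 h4
      rw [flowUp_zero] at h3
      rw [flowLow_zero] at h4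
      exact ⟨h3.symm, h4.symm⟩

theorem coeFn_fourier_zero : (𝓕 (0 : L2) : L2) =ᵐ[volume] fun _ => (0 : ℂ) := by
  have : (𝓕 (0 : L2) : L2) = 0 := map_zero (Lp.fourierTransformₗᵢ Space ℂ)
  rw [this]
  exact Lp.coeFn_zero _ _ _

/-- `H_P` is injective, since the determinant of its symbol vanishes only at the origin. -/
theorem ker_H {P : Space} (hP : ‖P‖ = 1) : (H P).toFun.ker = ⊥ := by
  rw [LinearMap.ker_eq_bot']
  intro u hu
  have hg : ((u : State), (0 : State)) ∈ (H P).graph := by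
    rw [LinearPMap.mem_graph_iff]
    exact ⟨u, rfl, hu⟩
  rw [mem_H_graph, diffOp_eq_iff] at hg
  have hz : ∀ᵐ ξ : Space, (𝓕 (u : State).1 : L2) ξ = 0 ∧ (𝓕 (u : State).2 : L2) ξ = 0 := by
    filter_upwards [hg, coeFn_fourier_zero, symDet_pos_ae hP] with ξ h h0 hD
    obtain ⟨h1, h2⟩ := h
    simp only [Prod.fst_zero, Prod.snd_zero] at h1 h2
    rw [h0] at h1 h2
    have hD' : (symDet P ξ : ℂ) ≠ 0 := by exact_mod_cast hD.ne'
    have hs : (symDet P ξ : ℂ) = ((2 * Real.pi * ‖ξ‖) ^ 2 - (2 * Real.pi * inner ℝ P ξ : ℝ) ^ 2) +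
        (2 * Real.pi * ‖ξ‖) ^ 4 := by
      rw [symDet]; push_cast; ring
    constructor
    · refine (mul_eq_zero.1 ?_).resolve_left hD'
      rw [hs]
      push_cast at h1 h2 ⊢
      linear_combination (Complex.I * (2 * Real.pi * inner ℝ P ξ)) * h1 -
        (2 * Real.pi * ‖ξ‖) ^ 2 * h2 -
        (2 * Real.pi * inner ℝ P ξ) ^ 2 * (𝓕 (u : State).1 : L2) ξ * Complex.I_sq
    · refine (mul_eq_zero.1 ?_).resolve_left hD'
      rw [hs]
      push_cast at h1 h2 ⊢
      linear_combination ((2 * Real.pi * ‖ξ‖) ^ 2 + 1) * h1 +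
        (Complex.I * (2 * Real.pi * inner ℝ P ξ)) * h2 -
        (2 * Real.pi * inner ℝ P ξ) ^ 2 * (𝓕 (u : State).2 : L2) ξ * Complex.I_sq
  refine Subtype.ext (Prod.ext (ext_fourier ?_) (ext_fourier ?_))
  · filter_upwards [hz, coeFn_fourier_zero] with ξ h1 h0
    rw [h1.1]; exact h0.symm
  · filter_upwards [hz, coeFn_fourier_zero] with ξ h1 h0
    rw [h1.2]; exact h0.symm

theorem exists_inverse_apply {P : Space} (hP : ‖P‖ = 1) {u g : State}
    (h : diffOp P (toDistr u) = toDistr g) :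
    ∃ hD : g ∈ (H P).inverse.domain, (H P).inverse ⟨g, hD⟩ = u := by
  have hg := (mem_H_graph P u g).2 h
  rw [LinearPMap.mem_graph_iff] at hg
  obtain ⟨y, hy, hyg⟩ := hg
  simp only at hy hyg
  have hD : g ∈ (H P).inverse.domain := by
    rw [LinearPMap.inverse_domain]
    exact ⟨y, hyg⟩
  refine ⟨hD, ?_⟩
  rw [LinearPMap.inverse_apply_eq (ker_H hP) (x := y) hyg, hy]

/-! ### Inversion of integrable Fourier transforms -/

theorem fourierInv_eq_integral_wave (g : Space → ℂ) (x : Space) :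
    𝓕⁻ g x = ∫ ξ, g ξ * wave x ξ := by
  rw [Real.fourierInv_eq']
  refine integral_congr_ae (Eventually.of_forall fun ξ => ?_)
  simp only [wave, smul_eq_mul]
  rw [mul_comm, real_inner_comm]
  congr 2
  push_cast
  ring

theorem continuous_fourierInv {g : Space → ℂ} (hg : Integrable g) : Continuous (𝓕⁻ g) := by
  have h : (𝓕⁻ g : Space → ℂ) = fun x => ∫ ξ, g ξ * wave x ξ :=
    funext (fourierInv_eq_integral_wave g)
  rw [h]
  refine continuous_of_dominated (bound := fun ξ => ‖g ξ‖) ?_ ?_ hg.norm ?_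
  · exact fun x => hg.aestronglyMeasurable.mul (by fun_prop)
  · exact fun x => Eventually.of_forall fun ξ => by rw [norm_mul, norm_wave, mul_one]
  · refine Eventually.of_forall fun ξ => ?_
    unfold wave
    fun_prop

theorem integral_schwartz_mul_fourierInv (φ : 𝓢(Space, ℂ)) {g : Space → ℂ} (hg : Integrable g) :
    ∫ x, φ x * 𝓕⁻ g x = ∫ ξ, 𝓕⁻ φ ξ * g ξ := by
  have h := VectorFourier.integral_bilin_fourierIntegral_eq_flip (ContinuousLinearMap.mul ℂ ℂ)
    (μ := volume) (ν := volume) (L := innerₗ Space) (f := fun x => φ (-x)) (g := g)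
    Real.continuous_fourierChar continuous_inner φ.integrable.comp_neg hg
  have e1 : ∀ ξ, VectorFourier.fourierIntegral Real.fourierChar volume (innerₗ Space)
      (fun x => φ (-x)) ξ = 𝓕⁻ φ ξ := fun ξ => by
    rw [SchwartzMap.fourierInv_coe, Real.fourierInv_eq_fourier_comp_neg]
    rfl
  have e2 : ∀ x, VectorFourier.fourierIntegral Real.fourierChar volume (innerₗ Space).flip
      g x = 𝓕⁻ g (-x) := fun x => by
    rw [Real.fourierInv_eq_fourier_neg, neg_neg, flip_innerₗ]
    rfl
  simp only [ContinuousLinearMap.mul_apply', e1, e2] at h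
  rw [h, ← integral_neg_eq_self]

/-- An `L²` function with integrable Fourier transform `g` is the inverse Fourier integral of
`g`. -/
theorem ae_eq_fourierInv {f : L2} {g : Space → ℂ} (hg : Integrable g)
    (hf : (𝓕 f : L2) =ᵐ[volume] g) : f =ᵐ[volume] 𝓕⁻ g := by
  refine ae_eq_of_integral_contDiff_smul_eq ((Lp.memLp f).locallyIntegrable (by norm_num))
    (continuous_fourierInv hg).locallyIntegrable fun φ φ_smooth φ_cpt => ?_
  have hφ₁ : HasCompactSupport (Complex.ofRealCLM ∘ φ) := φ_cpt.comp_left rfl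
  have hφ₂ : ContDiff ℝ ∞ (Complex.ofRealCLM ∘ φ) := by fun_prop
  set ψ : 𝓢(Space, ℂ) := hφ₁.toSchwartzMap hφ₂ with hψ
  have h1 := integral_schwartz_mul_fourierInv ψ hg
  have h2 : (Lp.toTemperedDistribution f : 𝓢'(Space, ℂ)) ψ = 
      (Lp.toTemperedDistribution (𝓕 f : L2) : 𝓢'(Space, ℂ)) (𝓕⁻ ψ) := by
    have h3 := Lp.fourierInv_toTemperedDistribution_eq (𝓕 f : L2)
    rw [FourierTransform.fourierInv_fourier_eq] at h3
    rw [← h3]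
    rfl
  rw [Lp.toTemperedDistribution_apply, Lp.toTemperedDistribution_apply] at h2
  have h4 : ∫ ξ, 𝓕⁻ ψ ξ • (𝓕 f : L2) ξ = ∫ ξ, 𝓕⁻ ψ ξ * g ξ :=
    integral_congr_ae (by filter_upwards [hf] with ξ h; rw [h, smul_eq_mul])
  rw [h4, ← h1] at h2
  simpa [hψ] using h2

theorem ae_norm_le_of_fourier {f : L2} {g : Space → ℂ} (hg : Integrable g)
    (hf : (𝓕 f : L2) =ᵐ[volume] g) {B : ℝ} (hB : ∀ z, ‖∫ ξ, g ξ * wave z ξ‖ ≤ B) :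
    ∀ᵐ x, ‖f x‖ ≤ B := by
  filter_upwards [ae_eq_fourierInv hg hf] with x hx
  rw [hx, fourierInv_eq_integral_wave]
  exact hB x

theorem supNorm_le {u : State} {B₁ B₂ : ℝ} (h₁ : ∀ᵐ x, ‖u.1 x‖ ≤ B₁) (h₂ : ∀ᵐ x, ‖u.2 x‖ ≤ B₂) :
    supNorm u ≤ ENNReal.ofReal (B₁ + B₂) := by
  refine (eLpNorm_le_of_ae_bound (C := B₁ + B₂) ?_).trans (by simp)
  filter_upwards [h₁, h₂] with x hx₁ hx₂
  rw [Real.norm_of_nonneg (Real.sqrt_nonneg _)]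
  have := norm_nonneg (u.1 x)
  have := norm_nonneg (u.2 x)
  refine Real.sqrt_le_iff.2 ⟨by linarith, ?_⟩
  nlinarith [mul_nonneg (norm_nonneg (u.1 x)) (norm_nonneg (u.2 x))]

theorem exists_fourier_eq {g : Space → ℂ} (hg : MemLp g 2 volume) :
    ∃ f : L2, (𝓕 f : L2) =ᵐ[volume] g := by
  refine ⟨(Lp.fourierTransformₗᵢ Space ℂ).symm (hg.toLp g), ?_⟩
  rw [show (𝓕 ((Lp.fourierTransformₗᵢ Space ℂ).symm (hg.toLp g)) : L2) = hg.toLp g from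
    (Lp.fourierTransformₗᵢ Space ℂ).apply_symm_apply _]
  exact hg.coeFn_toLp

theorem fourierInv_memLp {g : Space → ℂ} (hg : Integrable g) (hg2 : MemLp g 2 volume) :
    ∃ h : MemLp (𝓕⁻ g) 2 volume, (𝓕 (h.toLp (𝓕⁻ g)) : L2) =ᵐ[volume] g := by
  obtain ⟨f, hf⟩ := exists_fourier_eq hg2
  have h := ae_eq_fourierInv hg hf
  have hm : MemLp (𝓕⁻ g) 2 volume := (memLp_congr_ae h).1 (Lp.memLp f)
  have : hm.toLp (𝓕⁻ g) = f := Lp.ext (hm.coeFn_toLp.trans h.symm)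
  exact ⟨hm, by rwa [this]⟩

/-! ### Decay of the resonant states -/

/-- The quadratic form `κ² - a²` is the square of the transverse frequency, whose inverse `3/4`
power is square integrable near the axis. -/
theorem memLp_transverse {P : Space} (hP : ‖P‖ = 1) :
    MemLp (fun ξ : Space =>
      ((2 * Real.pi * ‖ξ‖) ^ 2 - (2 * Real.pi * inner ℝ P ξ) ^ 2) ^ (-(3 / 8) : ℝ) *
        (1 + (2 * Real.pi * ‖ξ‖) ^ 2)⁻¹) 2 volume ∧
    ∀ᵐ ξ : Space, 0 < (2 * Real.pi * ‖ξ‖) ^ 2 - (2 * Real.pi * inner ℝ P ξ) ^ 2 := by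
  obtain ⟨Φ, hΦ, hin, hnorm⟩ := exists_axis_coordinates P hP
  have key : ∀ p, (2 * Real.pi * ‖Φ p‖) ^ 2 - (2 * Real.pi * inner ℝ P (Φ p)) ^ 2 =
      (2 * Real.pi * ‖p.2‖) ^ 2 := fun p => by
    rw [hin, hnorm, mul_pow, Real.sq_sqrt (by positivity)]; ring
  have key2 : ∀ p, (2 * Real.pi * ‖Φ p‖) ^ 2 = (2 * Real.pi) ^ 2 * (p.1 ^ 2 + ‖p.2‖ ^ 2) :=
    fun p => by rw [hnorm, mul_pow, Real.sq_sqrt (by positivity)]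
  constructor
  · rw [memLp_two_iff_integrable_sq (by
      refine Measurable.aestronglyMeasurable ?_
      fun_prop), ← hΦ.integrable_comp_emb Φ.measurableEmbedding]
    have i1 : Integrable (fun u : ℝ => (1 + u ^ 2)⁻¹) := integrable_inv_one_add_sq
    have i2 : Integrable (fun y : EuclideanSpace ℝ (Fin 2) =>
        prof (-(3 / 2)) (-1) ‖y‖) := by
      rw [integrable_fun_norm_addHaar (volume : Measure (EuclideanSpace ℝ (Fin 2)))]
      refine (integrableOn_prof (α := -(1 / 2)) (β := -1) (by norm_num) (by norm_num)).congr_fun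
        (fun r hr => ?_) measurableSet_Ioi
      have hr' : (0 : ℝ) < r := hr
      simp only [finrank_euclideanSpace, Fintype.card_fin, smul_eq_mul, Nat.add_one_sub_one]
      rw [pow_mul_prof 1 _ _ hr']
      norm_num
    refine (i1.mul_prod i2).mono' ?_ (Eventually.of_forall fun p => ?_)
    · refine Measurable.aestronglyMeasurable ?_
      have := Φ.continuous.measurable
      fun_prop
    · rw [Function.comp_apply, key, key2]
      rw [Real.norm_of_nonneg (by positivity), mul_pow]
      have e1 : (((2 * Real.pi * ‖p.2‖) ^ 2) ^ (-(3 / 8) : ℝ)) ^ 2 =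
          (2 * Real.pi * ‖p.2‖) ^ (-(3 / 2) : ℝ) := by
        rw [← Real.rpow_natCast, ← Real.rpow_natCast, ← Real.rpow_mul (by positivity),
          ← Real.rpow_mul (by positivity)]
        norm_num
      have h2pi : (1 : ℝ) ≤ 2 * Real.pi := by linarith [Real.pi_gt_three]
      have e2 : (2 * Real.pi * ‖p.2‖) ^ (-(3 / 2) : ℝ) ≤ ‖p.2‖ ^ (-(3 / 2) : ℝ) := by
        rw [Real.mul_rpow (by positivity) (by positivity)]
        exact mul_le_of_le_one_left (by positivity)
          (Real.rpow_le_one_of_one_le_of_nonpos h2pi (by norm_num))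
      have e3 : (1 + p.1 ^ 2) * (1 + ‖p.2‖ ^ 2) ≤
          (1 + (2 * Real.pi) ^ 2 * (p.1 ^ 2 + ‖p.2‖ ^ 2)) ^ 2 := by
        have : p.1 ^ 2 + ‖p.2‖ ^ 2 ≤ (2 * Real.pi) ^ 2 * (p.1 ^ 2 + ‖p.2‖ ^ 2) :=
          le_mul_of_one_le_left (by positivity) (by nlinarith)
        nlinarith [sq_nonneg p.1, sq_nonneg ‖p.2‖]
      rw [e1, prof, Real.rpow_neg_one]
      calc _ ≤ ‖p.2‖ ^ (-(3 / 2) : ℝ) * ((1 + p.1 ^ 2) * (1 + ‖p.2‖ ^ 2))⁻¹ := by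
            rw [inv_pow]; gcongr
        _ = _ := by rw [mul_inv]; ring
  · rw [← hΦ.map_eq, Φ.measurableEmbedding.ae_map_iff]
    have h1 : ∀ᵐ y : EuclideanSpace ℝ (Fin 2), y ≠ 0 := by
      simp [ae_iff]
    have h2 : ∀ᵐ p : ℝ × EuclideanSpace ℝ (Fin 2), p.2 ≠ 0 :=
      Measure.quasiMeasurePreserving_snd.ae h1
    filter_upwards [h2] with p hp
    rw [key]
    have := norm_pos_iff.2 hp
    positivity

theorem memLp_resonant {P : Space} (hP : ‖P‖ = 1) {α : ℝ} {m : ℕ} (hα : 5 / 2 ≤ α + m)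
    (ψ : 𝓢(Space, ℂ)) :
    MemLp (fun ξ : Space => (symDet P ξ)⁻¹ • ((prof α 0 (2 * Real.pi * ‖ξ‖) : ℂ) *
      ((2 * Real.pi * inner ℝ P ξ : ℝ) : ℂ) ^ m * ψ ξ)) 2 volume := by
  obtain ⟨h1, h2⟩ := memLp_transverse hP
  obtain ⟨N, hN⟩ := exists_nat_ge (α + m - 5 / 2 + 1)
  obtain ⟨C, hC0, hC⟩ := schwartz_norm_le ψ N
  refine (h1.const_mul C).mono' ?_ ?_
  · have h1 : Measurable fun ξ : Space => (prof α 0 (2 * Real.pi * ‖ξ‖) : ℂ) *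
      ((2 * Real.pi * inner ℝ P ξ : ℝ) : ℂ) ^ m := by fun_prop
    exact ((continuous_symDet P).measurable.inv.smul
      (h1.mul ψ.continuous.measurable)).aestronglyMeasurable
  · filter_upwards [h2, ae_norm_pos, symDet_pos_ae hP] with ξ hξ hκ hD
    have ha := abs_freq_le hP ξ
    have hψ := hC ξ
    rw [norm_smul, norm_mul, norm_mul, norm_pow, Complex.norm_real, Complex.norm_real,
      Real.norm_of_nonneg (inv_nonneg.2 hD.le), Real.norm_of_nonneg (prof_nonneg _ _ hκ.le),
      Real.norm_eq_abs, inv_mul_le_iff₀ hD]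
    have hDdef : symDet P ξ = ((2 * Real.pi * ‖ξ‖) ^ 2 - (2 * Real.pi * inner ℝ P ξ) ^ 2) +
      (2 * Real.pi * ‖ξ‖) ^ 4 := rfl
    rw [hDdef]
    generalize (2 * Real.pi * ‖ξ‖) ^ 2 - (2 * Real.pi * inner ℝ P ξ) ^ 2 = p at *
    generalize 2 * Real.pi * ‖ξ‖ = κ at *
    generalize 2 * Real.pi * inner ℝ P ξ = a at *
    -- weighted arithmetic-geometric comparison `p^{3/8} κ^{5/2} ≤ p + κ⁴`
    have hamgm : κ ^ (5 / 2 : ℝ) ≤ (p + κ ^ 4) * p ^ (-(3 / 8) : ℝ) := by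
      rw [Real.rpow_neg hξ.le, ← div_eq_mul_inv, le_div_iff₀ (by positivity)]
      calc κ ^ (5 / 2 : ℝ) * p ^ (3 / 8 : ℝ) = (κ ^ 4) ^ (5 / 8 : ℝ) * p ^ (3 / 8 : ℝ) := by
            rw [← Real.rpow_natCast κ 4, ← Real.rpow_mul hκ.le]; norm_num
        _ ≤ (p + κ ^ 4) ^ (5 / 8 : ℝ) * (p + κ ^ 4) ^ (3 / 8 : ℝ) := by
            gcongr
            · linarith
            · have : 0 < κ ^ 4 := by positivity
              linarith
        _ = p + κ ^ 4 := by
            rw [← Real.rpow_add (by positivity)]; norm_num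
    have hdecay : prof α 0 κ * |a| ^ m * ‖ψ ξ‖ ≤ κ ^ (5 / 2 : ℝ) * (C * (1 + κ ^ 2)⁻¹) := by
      have e1 : κ ^ (α + m - 5 / 2) ≤ (1 + κ ^ 2) ^ (α + m - 5 / 2) :=
        Real.rpow_le_rpow hκ.le (by nlinarith [sq_nonneg (κ - 1)]) (by linarith)
      calc prof α 0 κ * |a| ^ m * ‖ψ ξ‖
          ≤ κ ^ α * κ ^ m * (C * (1 + κ ^ 2) ^ (-(N : ℝ))) := by
            unfold prof
            rw [Real.rpow_zero, mul_one]
            gcongr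
        _ = κ ^ (5 / 2 : ℝ) * κ ^ (α + m - 5 / 2) * (C * (1 + κ ^ 2) ^ (-(N : ℝ))) := by
            rw [← Real.rpow_natCast, ← Real.rpow_add hκ, ← Real.rpow_add hκ]
            ring_nf
        _ ≤ κ ^ (5 / 2 : ℝ) * (1 + κ ^ 2) ^ (α + m - 5 / 2) *
            (C * (1 + κ ^ 2) ^ (-(N : ℝ))) := by gcongr
        _ = κ ^ (5 / 2 : ℝ) * (C * (1 + κ ^ 2) ^ (α + m - 5 / 2 - N)) := by
            rw [Real.rpow_sub (by positivity) _ (N : ℝ), Real.rpow_neg (by positivity)]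
            ring
        _ ≤ κ ^ (5 / 2 : ℝ) * (C * (1 + κ ^ 2)⁻¹) := by
            rw [← Real.rpow_neg_one (1 + κ ^ 2)]
            gcongr
            · nlinarith
            · linarith
    calc _ ≤ κ ^ (5 / 2 : ℝ) * (C * (1 + κ ^ 2)⁻¹) := hdecay
      _ ≤ (p + κ ^ 4) * p ^ (-(3 / 8) : ℝ) * (C * (1 + κ ^ 2)⁻¹) := by gcongr
      _ = _ := by ring

theorem integrable_mul_wave {A : Space → ℂ} (hA : Integrable A) (z : Space) :
    Integrable (fun ξ => A ξ * wave z ξ) :=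
  hA.mul_bdd (c := 1) (by fun_prop) (Eventually.of_forall fun ξ => (norm_wave z ξ).le)

/-- Linear combinations and modulations preserve uniform bounds on Fourier integrals. -/
theorem norm_integral_comb_le {A : Fin 4 → Space → ℂ} {M : Fin 4 → ℝ}
    (hA : ∀ i, Integrable (A i)) (hM : ∀ i z, ‖∫ ξ, A i ξ * wave z ξ‖ ≤ M i) {c : Fin 4 → ℂ}
    (hc : ∀ i, ‖c i‖ ≤ 1) (y : Space) {G : Space → ℂ}
    (hG : G =ᵐ[volume] fun ξ => wave y ξ * ∑ i, c i * A i ξ) :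
    Integrable G ∧ ∀ z, ‖∫ ξ, G ξ * wave z ξ‖ ≤ ∑ i, M i := by
  have hi : Integrable fun ξ => ∑ i, c i * A i ξ :=
    integrable_finsetSum _ fun i _ => (hA i).const_mul (c i)
  constructor
  · refine (integrable_mul_wave hi y).congr ?_
    filter_upwards [hG] with ξ h
    rw [h, mul_comm]
  · intro z
    have h1 : ∫ ξ, G ξ * wave z ξ = ∑ i, c i * ∫ ξ, A i ξ * wave (y + z) ξ := by
      have h2 : ∀ᵐ ξ, G ξ * wave z ξ = ∑ i, c i * (A i ξ * wave (y + z) ξ) := by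
        filter_upwards [hG] with ξ h
        rw [h, wave_add, Finset.mul_sum, Finset.sum_mul]
        exact Finset.sum_congr rfl fun i _ => by ring
      rw [integral_congr_ae h2, integral_finsetSum _ fun i _ =>
        (integrable_mul_wave (hA i) (y + z)).const_mul (c i)]
      exact Finset.sum_congr rfl fun i _ => integral_const_mul _ _
    rw [h1]
    refine (norm_sum_le _ _).trans (Finset.sum_le_sum fun i _ => ?_)
    rw [norm_mul]
    exact (mul_le_of_le_one_left (norm_nonneg _) (hc i)).trans (hM i _)

theorem prof_one_neg_half {κ : ℝ} : prof 1 (-(1 / 2)) κ = κ / √(1 + κ ^ 2) := by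
  rw [prof, Real.rpow_one, Real.rpow_neg (by positivity), ← Real.sqrt_eq_rpow, div_eq_mul_inv]

theorem prof_neg_one_half {κ : ℝ} (hκ : 0 ≤ κ) : prof (-1) (1 / 2) κ = √(1 + κ ^ 2) / κ := by
  rw [prof, Real.rpow_neg hκ, Real.rpow_one, ← Real.sqrt_eq_rpow, div_eq_mul_inv, mul_comm]

theorem cos_eq_osc (τ κ : ℝ) :
    ((Real.cos (τ * om κ) : ℝ) : ℂ) = 1 / 2 * osc τ κ + 1 / 2 * osc (-τ) κ := by
  rw [Complex.ofReal_cos, Complex.cos, osc, osc]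
  push_cast
  ring_nf

theorem sin_eq_osc (τ κ : ℝ) :
    ((Real.sin (τ * om κ) : ℝ) : ℂ) = -(Complex.I / 2) * osc τ κ + Complex.I / 2 * osc (-τ) κ := by
  rw [Complex.ofReal_sin, Complex.sin, osc, osc]
  push_cast
  ring_nf

theorem integrable_osc_mul {A : Space → ℂ} (hA : Integrable A) (τ : ℝ) :
    Integrable (fun ξ : Space => osc τ (2 * Real.pi * ‖ξ‖) * A ξ) :=
  hA.bdd_mul (c := 1) (by fun_prop) (Eventually.of_forall fun ξ => (norm_osc τ _).le)

/-- The frequency profile `e^{iτω} D⁻¹ κ^α (1 + κ²)^β a^m ψ` of the resonant states. -/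
def resonant (P : Space) (α β : ℝ) (m : ℕ) (ψ : 𝓢(Space, ℂ)) (τ : ℝ) (ξ : Space) : ℂ :=
  osc τ (2 * Real.pi * ‖ξ‖) * ((symDet P ξ)⁻¹ • ((prof α β (2 * Real.pi * ‖ξ‖) : ℂ) *
    ((2 * Real.pi * inner ℝ P ξ : ℝ) : ℂ) ^ m * ψ ξ))

/-- The solution of `H_P u = (0, g)ᵀ` on the frequency side, where `g = κ^{2n} ψ` up to a
modulation, and the flow of this solution as a combination of resonant profiles. -/
theorem flow_resonant {n : ℝ} {κ a : ℝ} (hκ : 0 < κ) {d c : ℂ} {τ : ℝ} :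
    ((Real.cos (τ * om κ) : ℝ) : ℂ) * (-(d * ((prof (2 * n + 2) 0 κ : ℂ) * a ^ 0 * c))) +
      ((κ / √(1 + κ ^ 2) * Real.sin (τ * om κ) : ℝ) : ℂ) *
        (Complex.I * (d * ((prof (2 * n) 0 κ : ℂ) * a ^ 1 * c))) =
    (-1 / 2) * (osc τ κ * (d * ((prof (2 * n + 2) 0 κ : ℂ) * a ^ 0 * c))) +
    (-1 / 2) * (osc (-τ) κ * (d * ((prof (2 * n + 2) 0 κ : ℂ) * a ^ 0 * c))) +
    (1 / 2) * (osc τ κ * (d * ((prof (2 * n + 1) (-(1 / 2)) κ : ℂ) * a ^ 1 * c))) +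
    (-1 / 2) * (osc (-τ) κ * (d * ((prof (2 * n + 1) (-(1 / 2)) κ : ℂ) * a ^ 1 * c))) ∧
    ((-(√(1 + κ ^ 2) / κ * Real.sin (τ * om κ)) : ℝ) : ℂ) *
        (-(d * ((prof (2 * n + 2) 0 κ : ℂ) * a ^ 0 * c))) +
      ((Real.cos (τ * om κ) : ℝ) : ℂ) *
        (Complex.I * (d * ((prof (2 * n) 0 κ : ℂ) * a ^ 1 * c))) =
    (-(Complex.I / 2)) * (osc τ κ * (d * ((prof (2 * n + 1) (1 / 2) κ : ℂ) * a ^ 0 * c))) +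
    (Complex.I / 2) * (osc (-τ) κ * (d * ((prof (2 * n + 1) (1 / 2) κ : ℂ) * a ^ 0 * c))) +
    (Complex.I / 2) * (osc τ κ * (d * ((prof (2 * n) 0 κ : ℂ) * a ^ 1 * c))) +
    (Complex.I / 2) * (osc (-τ) κ * (d * ((prof (2 * n) 0 κ : ℂ) * a ^ 1 * c))) := by
  have e1 : prof (2 * n + 1) (-(1 / 2)) κ = κ / √(1 + κ ^ 2) * prof (2 * n) 0 κ := by
    rw [← prof_one_neg_half, prof_mul_prof _ _ _ _ hκ]; congr 1 <;> ring
  have e2 : prof (2 * n + 1) (1 / 2) κ = √(1 + κ ^ 2) / κ * prof (2 * n + 2) 0 κ := by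
    rw [← prof_neg_one_half hκ.le, prof_mul_prof _ _ _ _ hκ]; congr 1 <;> ring
  rw [e1, e2]
  constructor
  · rw [Complex.ofReal_mul _ (Real.sin _), cos_eq_osc, sin_eq_osc]
    push_cast
    linear_combination (-(κ / √(1 + κ ^ 2) * (osc τ κ - osc (-τ) κ) / 2 *
      (d * ((prof (2 * n) 0 κ : ℂ) * a * c)))) * Complex.I_sq
  · rw [Complex.ofReal_neg, Complex.ofReal_mul _ (Real.sin _), cos_eq_osc, sin_eq_osc]
    push_cast
    ring

/-- Decay of `e^{tH} H⁻¹ (0, f)ᵀ` when the Fourier transform of `f` is `|k|^{2n}` times a Schwartz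
function. The vanishing of order `2n ≥ 3/2` at zero frequency compensates the singularity of
`H⁻¹`. -/
theorem exists_inverse_decay {n : ℝ} (hn : 3 / 4 ≤ n) (ψ : 𝓢(Space, ℂ)) :
    ∃ C : ℝ, 0 < C ∧ ∀ P : Space, ‖P‖ = 1 → ∀ (Y : Space) (f : Space → ℂ)
      (hf : MemLp f 2 volume), (𝓕 (hf.toLp f) : L2) =ᵐ[volume]
        (fun ξ => (prof (2 * n) 0 (2 * Real.pi * ‖ξ‖) : ℂ) * (wave Y ξ * ψ ξ)) →
      ∃ hD : lower hf ∈ (H P).inverse.domain, ∀ t : ℝ≥0,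
        supNorm (semigroup P t ((H P).inverse ⟨lower hf, hD⟩)) ≤
          ENNReal.ofReal (C * (1 + (t : ℝ))⁻¹) := by
  obtain ⟨C₁, hC₁, h₁⟩ := exists_norm_resonant_le (α := 2 * n + 2) (m := 0) 0 (by norm_num)
    (by push_cast; linarith) ψ
  obtain ⟨C₂, hC₂, h₂⟩ := exists_norm_resonant_le (α := 2 * n + 1) (m := 1) (-(1 / 2)) (by norm_num)
    (by push_cast; linarith) ψ
  obtain ⟨C₃, hC₃, h₃⟩ := exists_norm_resonant_le (α := 2 * n + 1) (m := 0) (1 / 2) (by norm_num)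
    (by push_cast; linarith) ψ
  obtain ⟨C₄, hC₄, h₄⟩ := exists_norm_resonant_le (α := 2 * n) (m := 1) 0 (by norm_num)
    (by push_cast; linarith) ψ
  refine ⟨2 * (C₁ + C₂ + C₃ + C₄) + 1, by positivity, fun P hP Y f hf hff => ?_⟩
  have hw : Measurable (wave Y) := (continuous_wave Y).measurable
  have hm1 : MemLp (fun ξ : Space => -(wave Y ξ * resonant P (2 * n + 2) 0 0 ψ 0 ξ)) 2 volume := by
    refine MemLp.neg (MemLp.of_le (memLp_resonant hP (α := 2 * n + 2) (m := 0)
      (by push_cast; linarith) ψ) ?_ (Eventually.of_forall fun ξ => ?_))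
    · exact hw.aestronglyMeasurable.mul ((by fun_prop : Measurable fun ξ : Space =>
        osc 0 (2 * Real.pi * ‖ξ‖)).aestronglyMeasurable.mul (memLp_resonant hP (α := 2 * n + 2)
          (m := 0) (by push_cast; linarith) ψ).1)
    · rw [resonant, norm_mul, norm_mul, norm_wave, norm_osc, one_mul, one_mul]
  have hm2 : MemLp (fun ξ : Space => Complex.I * (wave Y ξ * resonant P (2 * n) 0 1 ψ 0 ξ)) 2
      volume := by
    refine MemLp.const_mul (MemLp.of_le (memLp_resonant hP (α := 2 * n) (m := 1)
      (by push_cast; linarith) ψ) ?_ (Eventually.of_forall fun ξ => ?_)) _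
    · exact hw.aestronglyMeasurable.mul ((by fun_prop : Measurable fun ξ : Space =>
        osc 0 (2 * Real.pi * ‖ξ‖)).aestronglyMeasurable.mul (memLp_resonant hP (α := 2 * n)
          (m := 1) (by push_cast; linarith) ψ).1)
    · rw [resonant, norm_mul, norm_mul, norm_wave, norm_osc, one_mul, one_mul]
  obtain ⟨u₁, hu1⟩ := exists_fourier_eq hm1
  obtain ⟨u₂, hu2⟩ := exists_fourier_eq hm2
  let u : State := (u₁, u₂)
  have hosc0 : ∀ κ, osc 0 κ = 1 := fun κ => by simp [osc]
  have hsolve : diffOp P (toDistr u) = toDistr (lower hf) := by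
    rw [diffOp_eq_iff]
    filter_upwards [hu1, hu2, hff, coeFn_fourier_zero, ae_norm_pos, symDet_pos_ae hP]
      with ξ h1 h2 h3 h0 hκ hD
    rw [h1, h2]
    have hl1 : (𝓕 (lower hf).1 : L2) ξ = 0 := h0
    have hl2 : (𝓕 (lower hf).2 : L2) ξ = _ := h3
    rw [hl1, hl2]
    have hD' : (symDet P ξ : ℂ) ≠ 0 := by exact_mod_cast hD.ne'
    have hs : (symDet P ξ : ℂ) = ((2 * Real.pi * ‖ξ‖ : ℝ) ^ 2 - (2 * Real.pi * inner ℝ P ξ : ℝ) ^ 2) +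
        (2 * Real.pi * ‖ξ‖ : ℝ) ^ 4 := by
      rw [symDet]; push_cast; ring
    have e1 : prof (2 * n + 2) 0 (2 * Real.pi * ‖ξ‖) =
        (2 * Real.pi * ‖ξ‖) ^ 2 * prof (2 * n) 0 (2 * Real.pi * ‖ξ‖) := by
      rw [pow_mul_prof 2 _ _ hκ, add_comm]; norm_num
    simp only [resonant, hosc0, one_mul, Complex.real_smul, e1]
    generalize 2 * Real.pi * ‖ξ‖ = κ at *
    generalize 2 * Real.pi * inner ℝ P ξ = a at *
    generalize symDet P ξ = D at *
    constructor
    · push_cast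
      ring
    · push_cast
      field_simp
      rw [hs]
      linear_combination (wave Y ξ * (prof (2 * n) 0 κ : ℂ) * ψ ξ * a ^ 2) * Complex.I_sq
  obtain ⟨hD, hinv⟩ := exists_inverse_apply hP hsolve
  refine ⟨hD, fun t => ?_⟩
  rw [hinv]
  have hτ : |(t : ℝ)| = t := abs_of_nonneg t.coe_nonneg
  have hb : ∀ {α β : ℝ} {m : ℕ} {C : ℝ}, (∀ P : Space, ‖P‖ = 1 → ∀ (τ : ℝ) (z : Space),
      ‖∫ ξ : Space, osc τ (2 * Real.pi * ‖ξ‖) * ((symDet P ξ)⁻¹ •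
        ((prof α β (2 * Real.pi * ‖ξ‖) : ℂ) * ((2 * Real.pi * inner ℝ P ξ : ℝ) : ℂ) ^ m * ψ ξ)) *
          wave z ξ‖ ≤ C * (1 + |τ|)⁻¹) → ∀ z,
      ‖∫ ξ, resonant P α β m ψ t ξ * wave z ξ‖ ≤ C * (1 + (t : ℝ))⁻¹ ∧
      ‖∫ ξ, resonant P α β m ψ (-t) ξ * wave z ξ‖ ≤ C * (1 + (t : ℝ))⁻¹ := by
    intro α β m C h z
    have h1 := h P hP t z
    have h2 := h P hP (-t) z
    rw [hτ] at h1
    rw [abs_neg, hτ] at h2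
    exact ⟨h1, h2⟩
  have hres : ∀ {α : ℝ} (β : ℝ) {m : ℕ}, 1 < m + α → ∀ τ,
      Integrable (resonant P α β m ψ τ) := fun β m h τ =>
    integrable_osc_mul (integrable_resonant hP β h ψ) τ
  have hup := norm_integral_comb_le
    (A := ![resonant P (2 * n + 2) 0 0 ψ t, resonant P (2 * n + 2) 0 0 ψ (-t),
      resonant P (2 * n + 1) (-(1 / 2)) 1 ψ t, resonant P (2 * n + 1) (-(1 / 2)) 1 ψ (-t)])
    (M := ![C₁ * (1 + (t : ℝ))⁻¹, C₁ * (1 + (t : ℝ))⁻¹, C₂ * (1 + (t : ℝ))⁻¹,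
      C₂ * (1 + (t : ℝ))⁻¹])
    (c := ![-1 / 2, -1 / 2, 1 / 2, -1 / 2])
    (by
      intro i
      fin_cases i
      · exact hres 0 (by push_cast; linarith) t
      · exact hres 0 (by push_cast; linarith) (-t)
      · exact hres (-(1 / 2)) (by push_cast; linarith) t
      · exact hres (-(1 / 2)) (by push_cast; linarith) (-t))
    (by
      intro i z
      fin_cases i
      · exact (hb h₁ z).1
      · exact (hb h₁ z).2
      · exact (hb h₂ z).1
      · exact (hb h₂ z).2)
    (by intro i; fin_cases i <;> norm_num) ((t : ℝ) • P + Y)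
    (G := fun ξ => flowUp P t ξ ((𝓕 u.1 : L2) ξ) ((𝓕 u.2 : L2) ξ)) (by
      filter_upwards [hu1, hu2, ae_norm_pos] with ξ h1 h2 hκ
      have h := (flow_resonant (n := n) (a := 2 * Real.pi * inner ℝ P ξ) hκ
        (d := ((symDet P ξ)⁻¹ : ℝ)) (c := ψ ξ) (τ := t)).1
      rw [h1, h2, flowUp, wave_add]
      simp only [Fin.sum_univ_four, Matrix.cons_val, resonant, hosc0, one_mul, Complex.real_smul]
      linear_combination (wave ((t : ℝ) • P) ξ * wave Y ξ) * h)
  have hlow := norm_integral_comb_le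
    (A := ![resonant P (2 * n + 1) (1 / 2) 0 ψ t, resonant P (2 * n + 1) (1 / 2) 0 ψ (-t),
      resonant P (2 * n) 0 1 ψ t, resonant P (2 * n) 0 1 ψ (-t)])
    (M := ![C₃ * (1 + (t : ℝ))⁻¹, C₃ * (1 + (t : ℝ))⁻¹, C₄ * (1 + (t : ℝ))⁻¹,
      C₄ * (1 + (t : ℝ))⁻¹])
    (c := ![-(Complex.I / 2), Complex.I / 2, Complex.I / 2, Complex.I / 2])
    (by
      intro i
      fin_cases i
      · exact hres (1 / 2) (by push_cast; linarith) t
      · exact hres (1 / 2) (by push_cast; linarith) (-t)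
      · exact hres 0 (by push_cast; linarith) t
      · exact hres 0 (by push_cast; linarith) (-t))
    (by
      intro i z
      fin_cases i
      · exact (hb h₃ z).1
      · exact (hb h₃ z).2
      · exact (hb h₄ z).1
      · exact (hb h₄ z).2)
    (by intro i; fin_cases i <;> simp <;> norm_num) ((t : ℝ) • P + Y)
    (G := fun ξ => flowLow P t ξ ((𝓕 u.1 : L2) ξ) ((𝓕 u.2 : L2) ξ)) (by
      filter_upwards [hu1, hu2, ae_norm_pos] with ξ h1 h2 hκ
      have h := (flow_resonant (n := n) (a := 2 * Real.pi * inner ℝ P ξ) hκ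
        (d := ((symDet P ξ)⁻¹ : ℝ)) (c := ψ ξ) (τ := t)).2
      rw [h1, h2, flowLow, wave_add]
      simp only [Fin.sum_univ_four, Matrix.cons_val, resonant, hosc0, one_mul, Complex.real_smul]
      linear_combination (wave ((t : ℝ) • P) ξ * wave Y ξ) * h)
  refine (supNorm_le (ae_norm_le_of_fourier hup.1 (fourier_semigroup_fst P t u) hup.2)
    (ae_norm_le_of_fourier hlow.1 (fourier_semigroup_snd P t u) hlow.2)).trans
      (ENNReal.ofReal_le_ofReal ?_)
  simp only [Fin.sum_univ_four, Matrix.cons_val]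
  have : 0 < (1 + (t : ℝ))⁻¹ := by positivity
  nlinarith

/-! ### The potentials -/

theorem IsAdmissible.exists_schwartz {V : Space → ℝ} (hV : IsAdmissible V) :
    ∃ v : 𝓢(Space, ℂ), ∀ x, v x = (V x : ℂ) := by
  obtain ⟨δ, hδ, hdec⟩ := hV.decay
  refine ⟨⟨fun x => (V x : ℂ), Complex.ofRealCLM.contDiff.comp hV.smooth, fun k m => ?_⟩,
    fun x => rfl⟩
  obtain ⟨C, hC⟩ := hdec m
  refine ⟨C * (k.factorial / δ ^ k), fun x => ?_⟩
  have h1 : ‖iteratedFDeriv ℝ m (fun x => (V x : ℂ)) x‖ = ‖iteratedFDeriv ℝ m V x‖ :=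
    Complex.ofRealLI.norm_iteratedFDeriv_comp_left (hV.smooth.contDiffAt) (mod_cast le_top)
  have h2 : ‖x‖ ^ k * Real.exp (-δ * ‖x‖) ≤ k.factorial / δ ^ k := by
    have := Real.pow_div_factorial_le_exp (δ * ‖x‖) (by positivity) k
    rw [div_le_iff₀ (by positivity), mul_pow] at this
    rw [neg_mul, Real.exp_neg, ← div_eq_mul_inv, div_le_div_iff₀ (Real.exp_pos _) (by positivity)]
    linarith
  have hC0 : 0 ≤ C := by
    have := (norm_nonneg _).trans (hC 0)
    simpa using this
  rw [h1]
  calc ‖x‖ ^ k * ‖iteratedFDeriv ℝ m V x‖ ≤ ‖x‖ ^ k * (C * Real.exp (-δ * ‖x‖)) := by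
        gcongr
        exact hC x
    _ = C * (‖x‖ ^ k * Real.exp (-δ * ‖x‖)) := by ring
    _ ≤ _ := by gcongr

theorem memLp_prof_mul_schwartz {α : ℝ} (hα : 0 ≤ α) (ψ : 𝓢(Space, ℂ)) :
    MemLp (fun ξ : Space => (prof α 0 (2 * Real.pi * ‖ξ‖) : ℂ) * ψ ξ) 2 volume := by
  have hi := integrable_prof_mul_schwartz (α := α) 0 (by linarith) ψ
  obtain ⟨N, hN⟩ := exists_nat_ge α
  obtain ⟨C, hC0, hC⟩ := schwartz_norm_le ψ N
  rw [memLp_two_iff_integrable_sq_norm hi.1]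
  refine (hi.norm.const_mul C).mono' (hi.1.norm.pow 2) ?_
  filter_upwards [ae_norm_pos] with ξ hξ
  rw [Real.norm_of_nonneg (by positivity), sq]
  refine mul_le_mul_of_nonneg_right ?_ (norm_nonneg _)
  have h1 := prof_le_one (α := α) (β := -N) hα (by linarith) hξ
  have h2 := prof_nonneg α 0 hξ.le
  rw [norm_mul, Complex.norm_real, Real.norm_of_nonneg h2]
  calc _ ≤ prof α 0 (2 * Real.pi * ‖ξ‖) * (C * (1 + (2 * Real.pi * ‖ξ‖) ^ 2) ^ (-(N : ℝ))) := by
        gcongr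
        exact hC ξ
    _ = C * prof α (-N) (2 * Real.pi * ‖ξ‖) := by
        unfold prof
        rw [Real.rpow_zero]
        ring
    _ ≤ C := mul_le_of_le_one_right hC0 h1

/-- On the frequency side, `W^Y` is `|k|^{2n}` times a modulated Schwartz function. -/
theorem shifted_eq (n : ℝ) {V : Space → ℝ} {v : 𝓢(Space, ℂ)} (hv : ∀ x, v x = (V x : ℂ))
    (Y : Space) :
    shifted n V Y = 𝓕⁻ (fun ξ : Space => (prof (2 * n) 0 (2 * Real.pi * ‖ξ‖) : ℂ) *
      (wave (-Y) ξ * 𝓕⁻ v ξ)) := by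
  have hv' : (fun x => (V x : ℂ)) = v := (funext hv).symm
  ext x
  rw [shifted, potential, fourierInv_eq_integral_wave, fourierInv_eq_integral_wave, hv',
    ← integral_neg_eq_self]
  refine integral_congr_ae (Eventually.of_forall fun ξ => ?_)
  have h1 : wave (Y - x) (-ξ) = wave (-Y) ξ * wave x ξ := by
    rw [← wave_add, wave, wave, inner_neg_right, ← inner_neg_left]
    congr 5
    abel
  have h2 : 𝓕 (v : Space → ℂ) (-ξ) = 𝓕⁻ v ξ := by
    rw [SchwartzMap.fourierInv_coe, Real.fourierInv_eq_fourier_neg]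
  simp only [norm_neg, h1, h2, prof, Real.rpow_zero, mul_one]
  ring

/-- Differentiation of inverse Fourier integrals. -/
theorem hasFDerivAt_fourierInv {g : Space → ℂ} (hg : Integrable g)
    (hg' : Integrable fun ξ => ‖ξ‖ * ‖g ξ‖) (x : Space) :
    DifferentiableAt ℝ (𝓕⁻ g) x ∧ ∀ e, fderiv ℝ (𝓕⁻ g) x e =
      𝓕⁻ (fun ξ => 2 * Real.pi * Complex.I * inner ℝ e ξ * g ξ) x := by
  have h0 : (𝓕⁻ g : Space → ℂ) = 𝓕 (fun ξ => g (-ξ)) := Real.fourierInv_eq_fourier_comp_neg g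
  have h1 : Integrable fun ξ : Space => ‖ξ‖ * ‖g (-ξ)‖ := by simpa using hg'.comp_neg
  have h := Real.hasFDerivAt_fourier hg.comp_neg h1 x
  rw [← h0] at h
  refine ⟨h.differentiableAt, fun e => ?_⟩
  have hi : Integrable (VectorFourier.fourierSMulRight (innerSL ℝ) fun ξ : Space => g (-ξ)) := by
    refine (h1.const_mul (2 * Real.pi * ‖innerSL ℝ (E := Space)‖)).mono'
      (hg.comp_neg.1.fourierSMulRight) (Eventually.of_forall fun ξ => ?_)
    rw [← mul_assoc]
    exact VectorFourier.norm_fourierSMulRight_le _ _ _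
  rw [h.fderiv, Real.fourier_continuousLinearMap_apply hi, Real.fourierInv_eq_fourier_comp_neg]
  refine congrFun (congrArg _ (funext fun ξ => ?_)) x
  have hin : innerSL ℝ ξ e = inner ℝ e ξ := (innerSL_apply_apply ℝ ξ e).trans (real_inner_comm _ _)
  simp only [VectorFourier.fourierSMulRight_apply, smul_eq_mul, inner_neg_right, Complex.real_smul]
  rw [hin]
  push_cast
  ring

theorem exists_potential_decay {n : ℝ} (hn : 3 / 4 ≤ n) {V : Space → ℝ} (hV : IsAdmissible V) :
    ∃ C : ℝ, 0 < C ∧ ∀ P : Space, ‖P‖ = 1 → ∀ Y : Space,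
      (∃ hW : MemLp (shifted n V Y) 2 volume, ∃ hD : lower hW ∈ (H P).inverse.domain, ∀ t : ℝ≥0,
        supNorm (semigroup P t ((H P).inverse ⟨lower hW, hD⟩)) ≤
          ENNReal.ofReal (C * (1 + (t : ℝ))⁻¹)) ∧
      Differentiable ℝ (shifted n V Y) ∧
      ∀ j : Fin 3, ∃ hW : MemLp (shiftedDeriv n V Y j) 2 volume,
        ∃ hD : lower hW ∈ (H P).inverse.domain, ∀ t : ℝ≥0,
          supNorm (semigroup P t ((H P).inverse ⟨lower hW, hD⟩)) ≤
            ENNReal.ofReal (C * (1 + (t : ℝ))⁻¹) := by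
  obtain ⟨v, hv⟩ := hV.exists_schwartz
  have hτ : ∀ j : Fin 3, (fun ξ : Space => 2 * Real.pi * Complex.I *
      ((inner ℝ (EuclideanSpace.single j 1) ξ : ℝ) : ℂ)).HasTemperateGrowth := fun j => by fun_prop
  let ψ : Fin 3 → 𝓢(Space, ℂ) := fun j => SchwartzMap.smulLeftCLM ℂ (fun ξ : Space =>
    2 * Real.pi * Complex.I * ((inner ℝ (EuclideanSpace.single j 1) ξ : ℝ) : ℂ)) (𝓕⁻ v)
  have hψ : ∀ j ξ, ψ j ξ = 2 * Real.pi * Complex.I *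
      ((inner ℝ (EuclideanSpace.single j 1) ξ : ℝ) : ℂ) * 𝓕⁻ v ξ := fun j ξ => by
    simp only [ψ]
    rw [SchwartzMap.smulLeftCLM_apply_apply (hτ j), smul_eq_mul]
  obtain ⟨C₀, hC₀, h₀⟩ := exists_inverse_decay hn (𝓕⁻ v)
  choose C hC h using fun j => exists_inverse_decay hn (ψ j)
  have hmul : ∀ (φ : 𝓢(Space, ℂ)) (Y : Space),
      Integrable (fun ξ : Space => (prof (2 * n) 0 (2 * Real.pi * ‖ξ‖) : ℂ) * (wave Y ξ * φ ξ)) ∧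
      MemLp (fun ξ : Space => (prof (2 * n) 0 (2 * Real.pi * ‖ξ‖) : ℂ) * (wave Y ξ * φ ξ)) 2 volume := by
    intro φ Y
    have e : (fun ξ : Space => (prof (2 * n) 0 (2 * Real.pi * ‖ξ‖) : ℂ) * (wave Y ξ * φ ξ)) =
        fun ξ => wave Y ξ * ((prof (2 * n) 0 (2 * Real.pi * ‖ξ‖) : ℂ) * φ ξ) := by ext ξ; ring
    rw [e]
    have hi := integrable_prof_mul_schwartz (α := 2 * n) 0 (by linarith) φ
    have hm := memLp_prof_mul_schwartz (α := 2 * n) (by linarith) φ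
    refine ⟨hi.bdd_mul (c := 1) (by fun_prop) (Eventually.of_forall fun ξ => (norm_wave Y ξ).le),
      hm.of_le ((by fun_prop : AEStronglyMeasurable (wave Y) volume).mul hm.1)
        (Eventually.of_forall fun ξ => ?_)⟩
    rw [norm_mul, norm_wave, one_mul]
  -- one constant for the four decay estimates
  obtain ⟨B, hB0, hB⟩ : ∃ B, C₀ ≤ B ∧ ∀ j, C j ≤ B :=
    ⟨C₀ + ∑ j, C j, le_add_of_nonneg_right (Finset.sum_nonneg fun j _ => (hC j).le), fun j =>
      (Finset.single_le_sum (fun j _ => (hC j).le) (Finset.mem_univ j)).trans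
        (le_add_of_nonneg_left hC₀.le)⟩
  have hmono : ∀ {c : ℝ}, c ≤ B → ∀ t : ℝ≥0,
      ENNReal.ofReal (c * (1 + (t : ℝ))⁻¹) ≤ ENNReal.ofReal (B * (1 + (t : ℝ))⁻¹) := fun h t =>
    ENNReal.ofReal_le_ofReal (mul_le_mul_of_nonneg_right h (by positivity))
  refine ⟨B, hC₀.trans_le hB0, fun P hP Y => ?_⟩
  have hS := shifted_eq n hv Y
  have hg' : Integrable fun ξ : Space => ‖ξ‖ * ‖(prof (2 * n) 0 (2 * Real.pi * ‖ξ‖) : ℂ) *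
      (wave (-Y) ξ * 𝓕⁻ v ξ)‖ := by
    refine (integrable_prof_mul_schwartz (α := 2 * n + 1) 0 (by linarith) (𝓕⁻ v)).norm.mono' ?_ ?_
    · exact (continuous_norm.aestronglyMeasurable).mul (hmul (𝓕⁻ v) (-Y)).1.1.norm
    · filter_upwards [ae_norm_pos] with ξ hξ
      have h1 : prof (2 * n + 1) 0 (2 * Real.pi * ‖ξ‖) =
          (2 * Real.pi * ‖ξ‖) * prof (2 * n) 0 (2 * Real.pi * ‖ξ‖) := by
        have := pow_mul_prof 1 (2 * n) 0 hξ
        rw [pow_one] at this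
        rw [this]
        congr 1
        push_cast
        ring
      have h2 := prof_nonneg (2 * n) 0 hξ.le
      have h3 : ‖ξ‖ ≤ ‖((2 * Real.pi * ‖ξ‖ : ℝ) : ℂ)‖ := by
        rw [Complex.norm_real, Real.norm_of_nonneg hξ.le]
        have : (1 : ℝ) ≤ 2 * Real.pi := by linarith [Real.pi_gt_three]
        exact le_mul_of_one_le_left (norm_nonneg _) this
      have h4 : ∀ A c : ℂ, ‖‖ξ‖ * ‖A * (wave (-Y) ξ * c)‖‖ = ‖ξ‖ * (‖A‖ * ‖c‖) := fun A c => by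
        rw [norm_mul, norm_norm, norm_norm, norm_mul, norm_mul, norm_wave, one_mul]
      rw [h4, h1, Complex.ofReal_mul, norm_mul, norm_mul, ← mul_assoc]
      gcongr
  have hder := hasFDerivAt_fourierInv (hmul (𝓕⁻ v) (-Y)).1 hg'
  refine ⟨?_, ?_, fun j => ?_⟩
  · obtain ⟨hm, hF⟩ := fourierInv_memLp (hmul (𝓕⁻ v) (-Y)).1 (hmul (𝓕⁻ v) (-Y)).2
    rw [← hS] at hm
    refine ⟨hm, ?_⟩
    obtain ⟨hD, hdec⟩ := h₀ P hP (-Y) (shifted n V Y) hm (by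
      simp only [hS]
      exact hF)
    exact ⟨hD, fun t => (hdec t).trans (hmono hB0 t)⟩
  · rw [hS]
    exact fun x => (hder x).1
  · have hSD : shiftedDeriv n V Y j = 𝓕⁻ (fun ξ : Space =>
        (prof (2 * n) 0 (2 * Real.pi * ‖ξ‖) : ℂ) * (wave (-Y) ξ * ψ j ξ)) := by
      ext x
      rw [shiftedDeriv, hS, (hder x).2]
      refine congrFun (congrArg _ (funext fun ξ => ?_)) x
      rw [hψ]
      ring
    obtain ⟨hm, hF⟩ := fourierInv_memLp (hmul (ψ j) (-Y)).1 (hmul (ψ j) (-Y)).2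
    rw [← hSD] at hm
    refine ⟨hm, ?_⟩
    obtain ⟨hD, hdec⟩ := h j P hP (-Y) (shiftedDeriv n V Y j) hm (by
      simp only [hSD]
      exact hF)
    exact ⟨hD, fun t => (hdec t).trans (hmono (hB j) t)⟩

/-! ### Decay for Schwartz data -/

/-- The sum of the `L¹` and `L²` norms, the data norm that controls the decay of the flow. -/
def mass (f : 𝓢(Space, ℂ)) : ℝ := (∫ x, ‖f x‖) + √(∫ x, ‖f x‖ ^ 2)

theorem mass_nonneg (f : 𝓢(Space, ℂ)) : 0 ≤ mass f :=
  add_nonneg (integral_nonneg fun _ => norm_nonneg _) (Real.sqrt_nonneg _)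

/-- The flow of `(1 - Δ)⁻¹` applied to a pair, as a combination of oscillatory multipliers. -/
theorem flow_smoothed {κ : ℝ} (hκ : 0 < κ) {a b : ℂ} {τ : ℝ} :
    ((Real.cos (τ * om κ) : ℝ) : ℂ) * ((prof 0 (-1) κ : ℂ) * a) +
      ((κ / √(1 + κ ^ 2) * Real.sin (τ * om κ) : ℝ) : ℂ) * ((prof 0 (-1) κ : ℂ) * b) =
    (1 / 2) * (osc τ κ * ((prof 0 (-1) κ : ℂ) * a)) +
    (1 / 2) * (osc (-τ) κ * ((prof 0 (-1) κ : ℂ) * a)) +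
    (-(Complex.I / 2)) * (osc τ κ * ((prof 1 (-(3 / 2)) κ : ℂ) * b)) +
    (Complex.I / 2) * (osc (-τ) κ * ((prof 1 (-(3 / 2)) κ : ℂ) * b)) ∧
    ((-(√(1 + κ ^ 2) / κ * Real.sin (τ * om κ)) : ℝ) : ℂ) * ((prof 0 (-1) κ : ℂ) * a) +
      ((Real.cos (τ * om κ) : ℝ) : ℂ) * ((prof 0 (-1) κ : ℂ) * b) =
    (Complex.I / 2) * (osc τ κ * ((prof (-1) (-(1 / 2)) κ : ℂ) * a)) +
    (-(Complex.I / 2)) * (osc (-τ) κ * ((prof (-1) (-(1 / 2)) κ : ℂ) * a)) +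
    (1 / 2) * (osc τ κ * ((prof 0 (-1) κ : ℂ) * b)) +
    (1 / 2) * (osc (-τ) κ * ((prof 0 (-1) κ : ℂ) * b)) := by
  have e1 : prof 1 (-(3 / 2)) κ = κ / √(1 + κ ^ 2) * prof 0 (-1) κ := by
    rw [← prof_one_neg_half, prof_mul_prof _ _ _ _ hκ]; congr 1 <;> norm_num
  have e2 : prof (-1) (-(1 / 2)) κ = √(1 + κ ^ 2) / κ * prof 0 (-1) κ := by
    rw [← prof_neg_one_half hκ.le, prof_mul_prof _ _ _ _ hκ]; congr 1 <;> norm_num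
  rw [e1, e2]
  constructor
  · rw [Complex.ofReal_mul _ (Real.sin _), cos_eq_osc, sin_eq_osc]
    push_cast
    ring
  · rw [Complex.ofReal_neg, Complex.ofReal_mul _ (Real.sin _), cos_eq_osc, sin_eq_osc]
    push_cast
    ring

theorem exists_supNorm_semigroup_le :
    ∃ C : ℝ, 0 ≤ C ∧ ∀ (P : Space) (f₁ f₂ : 𝓢(Space, ℂ)) (u : State),
      (𝓕 u.1 : L2) =ᵐ[volume] (fun ξ => (prof 0 (-1) (2 * Real.pi * ‖ξ‖) : ℂ) * 𝓕 f₁ ξ) →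
      (𝓕 u.2 : L2) =ᵐ[volume] (fun ξ => (prof 0 (-1) (2 * Real.pi * ‖ξ‖) : ℂ) * 𝓕 f₂ ξ) →
      ∀ t : ℝ≥0, supNorm (semigroup P t u) ≤
        ENNReal.ofReal (C * (1 + (t : ℝ))⁻¹ * (mass f₁ + mass f₂)) := by
  obtain ⟨C₁, hC₁, h₁⟩ := exists_norm_osc_multiplier_le (α := 0) (β := -1) (by norm_num)
    (by norm_num)
  obtain ⟨C₂, hC₂, h₂⟩ := exists_norm_osc_multiplier_le (α := 1) (β := -(3 / 2)) (by norm_num)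
    (by norm_num)
  obtain ⟨C₃, hC₃, h₃⟩ := exists_norm_osc_multiplier_le (α := -1) (β := -(1 / 2)) (by norm_num)
    (by norm_num)
  refine ⟨2 * (C₁ + C₂ + C₃), by positivity, fun P f₁ f₂ u hu1 hu2 t => ?_⟩
  have hτ : |(t : ℝ)| = t := abs_of_nonneg t.coe_nonneg
  let A : ℝ → ℝ → 𝓢(Space, ℂ) → ℝ → Space → ℂ := fun α β f τ ξ =>
    osc τ (2 * Real.pi * ‖ξ‖) * ((prof α β (2 * Real.pi * ‖ξ‖) : ℂ) * 𝓕 f ξ)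
  have hA : ∀ {α : ℝ} (β : ℝ) (f τ), -3 < α → Integrable (A α β f τ) := fun β f τ h =>
    integrable_osc_mul (integrable_prof_mul_schwartz β h (𝓕 f)) τ
  have hb : ∀ {α β C : ℝ}, (∀ (f : 𝓢(Space, ℂ)) (τ : ℝ) (z : Space),
      ‖∫ ξ, osc τ (2 * Real.pi * ‖ξ‖) * ((prof α β (2 * Real.pi * ‖ξ‖) : ℂ) * 𝓕 f ξ) *
        wave z ξ‖ ≤ C * (1 + |τ|)⁻¹ * ((∫ x, ‖f x‖) + √(∫ x, ‖f x‖ ^ 2))) → ∀ f z,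
      ‖∫ ξ, A α β f t ξ * wave z ξ‖ ≤ C * (1 + (t : ℝ))⁻¹ * mass f ∧
      ‖∫ ξ, A α β f (-t) ξ * wave z ξ‖ ≤ C * (1 + (t : ℝ))⁻¹ * mass f := by
    intro α β C h f z
    have h1 := h f t z
    have h2 := h f (-t) z
    rw [hτ] at h1
    rw [abs_neg, hτ] at h2
    exact ⟨h1, h2⟩
  have hup := norm_integral_comb_le
    (A := ![A 0 (-1) f₁ t, A 0 (-1) f₁ (-t), A 1 (-(3 / 2)) f₂ t, A 1 (-(3 / 2)) f₂ (-t)])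
    (M := ![C₁ * (1 + (t : ℝ))⁻¹ * mass f₁, C₁ * (1 + (t : ℝ))⁻¹ * mass f₁,
      C₂ * (1 + (t : ℝ))⁻¹ * mass f₂, C₂ * (1 + (t : ℝ))⁻¹ * mass f₂])
    (c := ![1 / 2, 1 / 2, -(Complex.I / 2), Complex.I / 2])
    (by intro i; fin_cases i <;> exact hA _ _ _ (by norm_num))
    (by
      intro i z
      fin_cases i
      · exact (hb h₁ f₁ z).1
      · exact (hb h₁ f₁ z).2
      · exact (hb h₂ f₂ z).1
      · exact (hb h₂ f₂ z).2)
    (by intro i; fin_cases i <;> simp <;> norm_num) ((t : ℝ) • P)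
    (G := fun ξ => flowUp P t ξ ((𝓕 u.1 : L2) ξ) ((𝓕 u.2 : L2) ξ)) (by
      filter_upwards [hu1, hu2, ae_norm_pos] with ξ h1 h2 hκ
      have h := (flow_smoothed hκ (a := 𝓕 f₁ ξ) (b := 𝓕 f₂ ξ) (τ := t)).1
      rw [h1, h2, flowUp]
      simp only [Fin.sum_univ_four, Matrix.cons_val, A]
      linear_combination (wave ((t : ℝ) • P) ξ) * h)
  have hlow := norm_integral_comb_le
    (A := ![A (-1) (-(1 / 2)) f₁ t, A (-1) (-(1 / 2)) f₁ (-t), A 0 (-1) f₂ t, A 0 (-1) f₂ (-t)])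
    (M := ![C₃ * (1 + (t : ℝ))⁻¹ * mass f₁, C₃ * (1 + (t : ℝ))⁻¹ * mass f₁,
      C₁ * (1 + (t : ℝ))⁻¹ * mass f₂, C₁ * (1 + (t : ℝ))⁻¹ * mass f₂])
    (c := ![Complex.I / 2, -(Complex.I / 2), 1 / 2, 1 / 2])
    (by intro i; fin_cases i <;> exact hA _ _ _ (by norm_num))
    (by
      intro i z
      fin_cases i
      · exact (hb h₃ f₁ z).1
      · exact (hb h₃ f₁ z).2
      · exact (hb h₁ f₂ z).1
      · exact (hb h₁ f₂ z).2)
    (by intro i; fin_cases i <;> simp <;> norm_num) ((t : ℝ) • P)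
    (G := fun ξ => flowLow P t ξ ((𝓕 u.1 : L2) ξ) ((𝓕 u.2 : L2) ξ)) (by
      filter_upwards [hu1, hu2, ae_norm_pos] with ξ h1 h2 hκ
      have h := (flow_smoothed hκ (a := 𝓕 f₁ ξ) (b := 𝓕 f₂ ξ) (τ := t)).2
      rw [h1, h2, flowLow]
      simp only [Fin.sum_univ_four, Matrix.cons_val, A]
      linear_combination (wave ((t : ℝ) • P) ξ) * h)
  refine (supNorm_le (ae_norm_le_of_fourier hup.1 (fourier_semigroup_fst P t u) hup.2)
    (ae_norm_le_of_fourier hlow.1 (fourier_semigroup_snd P t u) hlow.2)).trans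
      (ENNReal.ofReal_le_ofReal ?_)
  simp only [Fin.sum_univ_four, Matrix.cons_val]
  have hm₁ := mass_nonneg f₁
  have hm₂ := mass_nonneg f₂
  have ht : 0 < (1 + (t : ℝ))⁻¹ := by positivity
  have h1 := mul_nonneg (mul_nonneg hC₂ ht.le) hm₁
  have h2 := mul_nonneg (mul_nonneg hC₃ ht.le) hm₂
  linarith

/-! ### Lower semicontinuity of the sup norm -/

theorem supNorm_le_ofReal_iff {u : State} {B : ℝ} (hB : 0 ≤ B) :
    supNorm u ≤ ENNReal.ofReal B ↔ ∀ᵐ x, √(‖u.1 x‖ ^ 2 + ‖u.2 x‖ ^ 2) ≤ B := by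
  constructor
  · intro h
    rw [supNorm, eLpNorm_exponent_top] at h
    filter_upwards [ae_le_eLpNormEssSup (f := fun x => √(‖u.1 x‖ ^ 2 + ‖u.2 x‖ ^ 2))
      (μ := (volume : Measure Space))] with x hx
    have h1 := hx.trans h
    rwa [Real.enorm_of_nonneg (Real.sqrt_nonneg _), ENNReal.ofReal_le_ofReal_iff hB] at h1
  · intro h
    refine (eLpNorm_le_of_ae_bound (C := B) ?_).trans (by simp)
    filter_upwards [h] with x hx
    rwa [Real.norm_of_nonneg (Real.sqrt_nonneg _)]

theorem isClosed_supNorm_le {B : ℝ} (hB : 0 ≤ B) :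
    IsClosed {u : State | supNorm u ≤ ENNReal.ofReal B} := by
  refine IsSeqClosed.isClosed fun u v hu hlim => ?_
  have h1 : Tendsto (fun n => (u n).1) atTop (𝓝 v.1) := (continuous_fst.tendsto v).comp hlim
  have h2 : Tendsto (fun n => (u n).2) atTop (𝓝 v.2) := (continuous_snd.tendsto v).comp hlim
  obtain ⟨n₁, hn₁, hae₁⟩ := (tendstoInMeasure_of_tendsto_Lp h1).exists_seq_tendsto_ae
  obtain ⟨n₂, hn₂, hae₂⟩ :=
    (tendstoInMeasure_of_tendsto_Lp (h2.comp hn₁.tendsto_atTop)).exists_seq_tendsto_ae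
  rw [Set.mem_ofPred_eq, supNorm_le_ofReal_iff hB]
  have hb : ∀ᵐ x, ∀ n, √(‖(u n).1 x‖ ^ 2 + ‖(u n).2 x‖ ^ 2) ≤ B :=
    ae_all_iff.2 fun n => (supNorm_le_ofReal_iff hB).1 (hu n)
  filter_upwards [hae₁, hae₂, hb] with x hx₁ hx₂ hx
  have hx₁' := hx₁.comp hn₂.tendsto_atTop
  exact le_of_tendsto' (((hx₁'.norm.pow 2).add (hx₂.norm.pow 2)).sqrt) fun k => hx (n₁ (n₂ k))

/-! ### Regularized weights -/

/-- A smooth positive function that agrees with `|x|` for `ε = 0`. -/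
def softNorm (ε : ℝ) (x : Space) : ℝ := √(ε ^ 2 + ‖x‖ ^ 2)

/-- The inverse of the weight `(1 + |x|)⁴`, with the singularity of `|x|` at the origin smoothed
on the scale `ε`. -/
def weight (ε : ℝ) (x : Space) : ℝ := ((1 + softNorm ε x) ^ 4)⁻¹

theorem norm_le_softNorm (ε : ℝ) (x : Space) : ‖x‖ ≤ softNorm ε x :=
  Real.le_sqrt_of_sq_le (le_add_of_nonneg_left (sq_nonneg ε))

theorem softNorm_pos {ε : ℝ} (hε : 0 < ε) (x : Space) : 0 < softNorm ε x :=
  Real.sqrt_pos.2 (by positivity)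

theorem softNorm_nonneg (ε : ℝ) (x : Space) : 0 ≤ softNorm ε x := Real.sqrt_nonneg _

theorem weight_nonneg (ε : ℝ) (x : Space) : 0 ≤ weight ε x := by
  have := softNorm_nonneg ε x
  unfold weight
  positivity

theorem weight_le (ε : ℝ) (x : Space) : weight ε x ≤ ((1 + ‖x‖) ^ 4)⁻¹ := by
  unfold weight
  gcongr
  exact norm_le_softNorm ε x

theorem weight_zero (x : Space) : weight 0 x = ((1 + ‖x‖) ^ 4)⁻¹ := by
  rw [weight, softNorm]
  simp

theorem inv_one_add_norm_pow_le_one (x : Space) : ((1 + ‖x‖) ^ 4)⁻¹ ≤ 1 :=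
  inv_le_one_of_one_le₀ (one_le_pow₀ (le_add_of_nonneg_right (norm_nonneg x)))

theorem continuous_weight (ε : ℝ) : Continuous (weight ε) := by
  unfold weight softNorm
  refine Continuous.inv₀ (by fun_prop) fun x => ?_
  positivity

theorem tendsto_weight (x : Space) : Tendsto (fun ε => weight ε x) (𝓝[>] 0) (𝓝 (weight 0 x)) := by
  have : Continuous fun ε => weight ε x := by
    unfold weight softNorm
    refine Continuous.inv₀ (by fun_prop) fun ε => ?_
    positivity
  exact (this.tendsto 0).mono_left nhdsWithin_le_nhds

theorem hasTemperateGrowth_weight {ε : ℝ} (hε : 0 < ε) : (weight ε).HasTemperateGrowth := by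
  -- `1 + softNorm ε x = 1 + F(x)²`, where `F` and `y ↦ (1 + y²)⁻⁴` have temperate growth
  let F : Space → ℝ := fun x => √ε * (1 + ‖ε⁻¹ • x‖ ^ 2) ^ (1 / 4 : ℝ)
  have hF : F.HasTemperateGrowth := by
    have h1 : (fun x : Space => (1 + ‖ε⁻¹ • x‖ ^ 2) ^ (1 / 4 : ℝ)).HasTemperateGrowth :=
      (Function.hasTemperateGrowth_one_add_norm_sq_rpow Space (1 / 4)).comp
        (ε⁻¹ • ContinuousLinearMap.id ℝ Space).hasTemperateGrowth
    exact (Function.HasTemperateGrowth.const (√ε)).mul h1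
  have h2 := (Function.hasTemperateGrowth_one_add_norm_sq_rpow ℝ (-4)).comp hF
  have h4 : weight ε = (fun y : ℝ => (1 + ‖y‖ ^ 2) ^ (-4 : ℝ)) ∘ F := by
    ext x
    have h3 : F x ^ 2 = softNorm ε x := by
      simp only [F, softNorm]
      rw [mul_pow, Real.sq_sqrt hε.le, ← Real.rpow_natCast, ← Real.rpow_mul (by positivity),
        norm_smul, Real.norm_of_nonneg (by positivity)]
      rw [show (1 / 4 : ℝ) * (2 : ℕ) = 1 / 2 by norm_num, ← Real.sqrt_eq_rpow]
      nth_rewrite 1 [← Real.sqrt_sq hε.le]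
      rw [← Real.sqrt_mul (by positivity)]
      congr 1
      field_simp
    simp only [Function.comp_apply, Real.norm_eq_abs, sq_abs, h3, weight]
    rw [Real.rpow_neg (by have := softNorm_nonneg ε x; positivity)]
    norm_cast
  rwa [h4]

theorem hasDerivAt_softNorm {ε : ℝ} (hε : 0 < ε) (x e : Space) :
    HasDerivAt (fun t : ℝ => softNorm ε (x + t • e)) (inner ℝ x e / softNorm ε x) 0 := by
  have h1 : HasDerivAt (fun t : ℝ => x + t • e) e 0 := by
    simpa using ((hasDerivAt_id (0 : ℝ)).smul_const e).const_add x
  have h2 := (h1.norm_sq.const_add (ε ^ 2)).sqrt (by simp; positivity)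
  refine HasDerivAt.congr_deriv (f := fun t : ℝ => softNorm ε (x + t • e)) h2 ?_
  simp only [zero_smul, add_zero]
  rw [softNorm]
  have := softNorm_pos hε x
  unfold softNorm at this
  field_simp

/-- The directional derivative of the weight. -/
def weightDeriv (ε : ℝ) (e x : Space) : ℝ :=
  -4 * inner ℝ x e / (softNorm ε x * (1 + softNorm ε x) ^ 5)

/-- The second directional derivative of the weight in a unit direction. -/
def weightDeriv2 (ε : ℝ) (e x : Space) : ℝ :=
  -4 / (softNorm ε x * (1 + softNorm ε x) ^ 5) +
    4 * inner ℝ x e ^ 2 / (softNorm ε x ^ 3 * (1 + softNorm ε x) ^ 5) +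
    20 * inner ℝ x e ^ 2 / (softNorm ε x ^ 2 * (1 + softNorm ε x) ^ 6)

theorem hasDerivAt_weight {ε : ℝ} (hε : 0 < ε) (x e : Space) :
    HasDerivAt (fun t : ℝ => weight ε (x + t • e)) (weightDeriv ε e x) 0 := by
  have hs := softNorm_pos hε x
  have h := (((hasDerivAt_softNorm hε x e).const_add 1).pow 4).inv (by simp; positivity)
  refine HasDerivAt.congr_deriv (f := fun t : ℝ => weight ε (x + t • e)) h ?_
  simp only [zero_smul, add_zero, weightDeriv, Pi.pow_apply]
  field_simp
  norm_num
  ring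

theorem hasDerivAt_weightDeriv {ε : ℝ} (hε : 0 < ε) (x : Space) {e : Space} (he : ‖e‖ = 1) :
    HasDerivAt (fun t : ℝ => weightDeriv ε e (x + t • e)) (weightDeriv2 ε e x) 0 := by
  have hs := softNorm_pos hε x
  have h0 := hasDerivAt_softNorm hε x e
  have h1 : HasDerivAt (fun t : ℝ => inner ℝ (x + t • e) e) 1 0 := by
    simp only [inner_add_left, inner_smul_left, real_inner_self_eq_norm_sq, he]
    simpa using (hasDerivAt_id (0 : ℝ)).const_add (inner ℝ x e)
  have h := (h1.const_mul (-4)).div (h0.mul ((h0.const_add 1).pow 5)) (by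
    simp only [zero_smul, add_zero, Pi.pow_apply, Pi.mul_apply]; positivity)
  refine HasDerivAt.congr_deriv (f := fun t : ℝ => weightDeriv ε e (x + t • e)) h ?_
  simp only [zero_smul, add_zero, weightDeriv2, Pi.pow_apply, Pi.mul_apply]
  field_simp
  norm_num
  ring

theorem abs_weightDeriv_le {ε : ℝ} (hε : 0 < ε) (x : Space) {e : Space} (he : ‖e‖ = 1) :
    |weightDeriv ε e x| ≤ 4 * ((1 + ‖x‖) ^ 4)⁻¹ := by
  have hs := softNorm_pos hε x
  have hxs := norm_le_softNorm ε x
  have hi : |inner ℝ x e| ≤ softNorm ε x :=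
    (abs_real_inner_le_norm x e).trans (by rw [he, mul_one]; exact hxs)
  refine le_trans ?_ (mul_le_mul_of_nonneg_left (weight_le ε x) (by norm_num))
  unfold weightDeriv weight
  generalize softNorm ε x = s at *
  rw [abs_div, abs_mul, abs_of_pos (by positivity : 0 < s * (1 + s) ^ 5), div_le_iff₀ (by positivity)]
  norm_num
  calc 4 * |inner ℝ x e| ≤ 4 * (s * (1 + s)) := by gcongr; nlinarith
    _ = _ := by field_simp

theorem abs_weightDeriv2_le {ε : ℝ} (hε : 0 < ε) {x : Space} (hx : x ≠ 0) {e : Space}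
    (he : ‖e‖ = 1) :
    |weightDeriv2 ε e x| ≤ ((1 + ‖x‖) ^ 4)⁻¹ * (20 + 4 * ‖x‖⁻¹) := by
  have hs := softNorm_pos hε x
  have hx' := norm_pos_iff.2 hx
  have hxs := norm_le_softNorm ε x
  have hi : inner ℝ x e ^ 2 ≤ softNorm ε x ^ 2 := sq_le_sq.2 (by
    rw [abs_of_pos hs]
    exact (abs_real_inner_le_norm x e).trans (by rw [he, mul_one]; exact hxs))
  have h1 : |weightDeriv2 ε e x| ≤ weight ε x * (20 + 4 * (softNorm ε x)⁻¹) := by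
    unfold weightDeriv2 weight
    have hg : 0 ≤ inner ℝ x e ^ 2 := sq_nonneg _
    generalize softNorm ε x = s at *
    generalize inner ℝ x e ^ 2 = g at *
    have e1 : -4 / (s * (1 + s) ^ 5) + 4 * g / (s ^ 3 * (1 + s) ^ 5) =
        -(4 * (1 - g / s ^ 2) * (s⁻¹ * ((1 + s) ^ 5)⁻¹)) := by field_simp; ring
    have hq0 : 0 ≤ g / s ^ 2 := by positivity
    have hq1 : g / s ^ 2 ≤ 1 := (div_le_one (by positivity)).2 hi
    have e2 : 20 * g / (s ^ 2 * (1 + s) ^ 6) = 20 * (g / s ^ 2) * ((1 + s) ^ 6)⁻¹ := by field_simp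
    rw [e1, e2]
    have p1 : (1:ℝ) ≤ 1 + s := by linarith
    have p5 : ((1 + s) ^ 5)⁻¹ ≤ ((1 + s) ^ 4)⁻¹ := by gcongr; norm_num
    have p6 : ((1 + s) ^ 6)⁻¹ ≤ ((1 + s) ^ 4)⁻¹ := by gcongr; norm_num
    refine (abs_add_le _ _).trans ?_
    rw [abs_neg, abs_of_nonneg (by
      have : 0 ≤ 1 - g / s ^ 2 := by linarith
      positivity), abs_of_nonneg (by positivity)]
    have q1 : 4 * (1 - g / s ^ 2) * (s⁻¹ * ((1 + s) ^ 5)⁻¹) ≤ 4 * 1 * (s⁻¹ * ((1 + s) ^ 4)⁻¹) := by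
      gcongr
      linarith
    have q2 : 20 * (g / s ^ 2) * ((1 + s) ^ 6)⁻¹ ≤ 20 * 1 * ((1 + s) ^ 4)⁻¹ := by gcongr
    linarith
  refine h1.trans ?_
  have := weight_le ε x
  have := weight_nonneg ε x
  gcongr

/-- The product of the Schwartz function `w` with the regularized inverse weight. -/
def damp (ε : ℝ) (w : 𝓢(Space, ℂ)) : 𝓢(Space, ℂ) := SchwartzMap.smulLeftCLM ℂ (weight ε) w

theorem damp_apply {ε : ℝ} (hε : 0 < ε) (w : 𝓢(Space, ℂ)) (x : Space) :
    damp ε w x = weight ε x • w x :=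
  SchwartzMap.smulLeftCLM_apply_apply (hasTemperateGrowth_weight hε) w x

theorem hasDerivAt_schwartz (w : 𝓢(Space, ℂ)) (x e : Space) :
    HasDerivAt (fun t : ℝ => w (x + t • e)) (∂_{e} w x) 0 := by
  rw [SchwartzMap.lineDerivOp_apply]
  exact (w.differentiableAt.lineDifferentiableAt).hasLineDerivAt

theorem lineDeriv_damp {ε : ℝ} (hε : 0 < ε) (w : 𝓢(Space, ℂ)) (x e : Space) :
    ∂_{e} (damp ε w) x = weight ε x • ∂_{e} w x + weightDeriv ε e x • w x := by
  refine (hasDerivAt_schwartz (damp ε w) x e).unique ?_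
  simp only [damp_apply hε]
  refine HasDerivAt.congr_deriv (f := fun t : ℝ => weight ε (x + t • e) • w (x + t • e))
    ((hasDerivAt_weight hε x e).smul (hasDerivAt_schwartz w x e)) ?_
  simp only [zero_smul, add_zero]

theorem lineDeriv_lineDeriv_damp {ε : ℝ} (hε : 0 < ε) (w : 𝓢(Space, ℂ)) (x : Space) {e : Space}
    (he : ‖e‖ = 1) :
    ∂_{e} (∂_{e} (damp ε w)) x = weight ε x • ∂_{e} (∂_{e} w) x +
      (2 * weightDeriv ε e x) • ∂_{e} w x + weightDeriv2 ε e x • w x := by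
  refine (hasDerivAt_schwartz (∂_{e} (damp ε w)) x e).unique ?_
  simp only [lineDeriv_damp hε]
  have h := ((hasDerivAt_weight hε x e).smul (hasDerivAt_schwartz (∂_{e} w) x e)).add
    ((hasDerivAt_weightDeriv hε x he).smul (hasDerivAt_schwartz w x e))
  refine HasDerivAt.congr_deriv (f := fun t : ℝ => weight ε (x + t • e) • ∂_{e} w (x + t • e) +
    weightDeriv ε e (x + t • e) • w (x + t • e)) h ?_
  simp only [zero_smul, add_zero, two_mul, add_smul]
  abel

/-- The Laplacian commutes with the weight up to terms of lower order, whose coefficients are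
bounded by the weight itself, apart from a singularity `|x|⁻¹`. -/
theorem norm_damp_sub_laplacian_le {ε : ℝ} (hε : 0 < ε) (w : 𝓢(Space, ℂ)) {x : Space}
    (hx : x ≠ 0) :
    ‖(damp ε w - Δ (damp ε w)) x‖ ≤ ((1 + ‖x‖) ^ 4)⁻¹ * (‖(w - Δ w) x‖ +
      8 * ∑ j, ‖∂_{EuclideanSpace.basisFun (Fin 3) ℝ j} w x‖) +
      ((1 + ‖x‖) ^ 4)⁻¹ * (60 + 12 * ‖x‖⁻¹) * ‖w x‖ := by
  set b := EuclideanSpace.basisFun (Fin 3) ℝ with hb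
  have hb1 : ∀ j, ‖b j‖ = 1 := b.norm_eq_one
  have h1 : (damp ε w - Δ (damp ε w)) x = weight ε x • (w - Δ w) x -
      ∑ j, ((2 * weightDeriv ε (b j) x) • ∂_{b j} w x + weightDeriv2 ε (b j) x • w x) := by
    simp only [sub_apply, SchwartzMap.laplacian_eq_sum b, sum_apply,
      lineDeriv_lineDeriv_damp hε w x (hb1 _), damp_apply hε, smul_sub, Finset.smul_sum,
      Finset.sum_add_distrib]
    abel
  rw [h1]
  have hω : 0 ≤ ((1 + ‖x‖) ^ 4)⁻¹ := by positivity
  have h2 : ∀ j, ‖(2 * weightDeriv ε (b j) x) • ∂_{b j} w x + weightDeriv2 ε (b j) x • w x‖ ≤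
      ((1 + ‖x‖) ^ 4)⁻¹ * (8 * ‖∂_{b j} w x‖) +
        ((1 + ‖x‖) ^ 4)⁻¹ * (20 + 4 * ‖x‖⁻¹) * ‖w x‖ := fun j => by
    refine (norm_add_le _ _).trans (add_le_add ?_ ?_)
    · rw [norm_smul, Real.norm_eq_abs, abs_mul, abs_two]
      nlinarith [mul_le_mul_of_nonneg_right (abs_weightDeriv_le hε x (hb1 j))
        (norm_nonneg (∂_{b j} w x))]
    · rw [norm_smul, Real.norm_eq_abs]
      gcongr
      exact abs_weightDeriv2_le hε hx (hb1 j)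
  refine (norm_sub_le _ _).trans ?_
  have h3 := (norm_sum_le Finset.univ fun j =>
    (2 * weightDeriv ε (b j) x) • ∂_{b j} w x + weightDeriv2 ε (b j) x • w x).trans
      (Finset.sum_le_sum fun j _ => h2 j)
  have h4 : ‖weight ε x • (w - Δ w) x‖ ≤ ((1 + ‖x‖) ^ 4)⁻¹ * ‖(w - Δ w) x‖ := by
    rw [norm_smul, Real.norm_of_nonneg (weight_nonneg ε x)]
    gcongr
    exact weight_le ε x
  refine (add_le_add h4 h3).trans (le_of_eq ?_)
  simp only [Fin.sum_univ_three]
  ring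

/-! ### The weighted data norm -/

theorem fourier_sub_laplacian (w : 𝓢(Space, ℂ)) (ξ : Space) :
    𝓕 (w - Δ w) ξ = ((1 + (2 * Real.pi * ‖ξ‖) ^ 2 : ℝ) : ℂ) * 𝓕 w ξ := by
  have hg : (fun x : Space => ‖x‖ ^ 2).HasTemperateGrowth := by fun_prop
  rw [sub_eq_add_neg, ← neg_one_smul ℝ (Δ w), FourierTransform.fourier_add,
    FourierTransform.fourier_smul, SchwartzMap.laplacian_eq_fourierMultiplierCLM,
    FourierTransform.fourier_smul,
    SchwartzMap.fourierMultiplierCLM_apply, FourierTransform.fourier_fourierInv_eq]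
  simp only [add_apply, smul_apply, SchwartzMap.smulLeftCLM_apply_apply hg,
    Complex.real_smul]
  push_cast
  ring

theorem norm_fourier_lineDeriv_le (w : 𝓢(Space, ℂ)) {e : Space} (he : ‖e‖ = 1) (ξ : Space) :
    ‖𝓕 (∂_{e} w) ξ‖ ≤ ‖𝓕 (w - Δ w) ξ‖ := by
  have hg : (fun x : Space => inner ℝ x e).HasTemperateGrowth := by fun_prop
  have h1 : ‖(2 * Real.pi * Complex.I : ℂ)‖ = 2 * Real.pi := by
    simp [abs_of_pos Real.pi_pos]
  rw [SchwartzMap.fourier_lineDerivOp_eq, fourier_sub_laplacian, smul_apply,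
    SchwartzMap.smulLeftCLM_apply_apply hg, norm_smul, norm_smul, h1, ← mul_assoc,
    norm_mul (_ : ℂ), Complex.norm_real, Real.norm_eq_abs, Real.norm_of_nonneg (by positivity)]
  refine mul_le_mul_of_nonneg_right ?_ (norm_nonneg (𝓕 w ξ))
  have h2 : |inner ℝ ξ e| ≤ ‖ξ‖ := (abs_real_inner_le_norm ξ e).trans (by rw [he, mul_one])
  calc 2 * Real.pi * |inner ℝ ξ e| ≤ 2 * Real.pi * ‖ξ‖ := by gcongr
    _ ≤ _ := by nlinarith [sq_nonneg (2 * Real.pi * ‖ξ‖ - 1)]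

theorem integrable_schwartz_sq (f : 𝓢(Space, ℂ)) : Integrable fun x => ‖f x‖ ^ 2 :=
  (f.memLp 2 volume).norm.integrable_sq

theorem integral_lineDeriv_sq_le (w : 𝓢(Space, ℂ)) {e : Space} (he : ‖e‖ = 1) :
    ∫ x, ‖∂_{e} w x‖ ^ 2 ≤ ∫ x, ‖(w - Δ w) x‖ ^ 2 := by
  rw [← SchwartzMap.integral_norm_sq_fourier, ← SchwartzMap.integral_norm_sq_fourier (w - Δ w)]
  refine integral_mono (integrable_schwartz_sq _) (integrable_schwartz_sq _) fun ξ => ?_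
  have := norm_fourier_lineDeriv_le w he ξ
  dsimp only
  gcongr

theorem integrable_prof_norm {α β : ℝ} (hα : -3 < α) (h : α + 2 * β < -3) :
    Integrable fun x : Space => prof α β ‖x‖ := by
  have h1 := (integrable_prof hα h).comp_smul (R := (2 * Real.pi)⁻¹) (by positivity)
  refine h1.congr (Eventually.of_forall fun x => ?_)
  simp only
  rw [norm_smul, Real.norm_of_nonneg (by positivity)]
  congr 1
  field_simp

/-- The Sobolev embedding `H² ⊆ L^∞`. -/
theorem exists_norm_le_of_laplacian : ∃ k : ℝ, 0 ≤ k ∧ ∀ (w : 𝓢(Space, ℂ)) (M : ℝ), 0 < M →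
    ∫ x, ‖(w - Δ w) x‖ ^ 2 ≤ M ^ 2 → ∀ x, ‖w x‖ ≤ k * M := by
  have hJ := integrable_prof (α := 0) (β := -2) (by norm_num) (by norm_num)
  refine ⟨((∫ ξ : Space, prof 0 (-2) (2 * Real.pi * ‖ξ‖)) + 1) / 2, ?_, fun w M hM hw x => ?_⟩
  · have : 0 ≤ ∫ ξ : Space, prof 0 (-2) (2 * Real.pi * ‖ξ‖) :=
      integral_nonneg fun ξ => prof_nonneg _ _ (by positivity)
    positivity
  have h1 : ‖w x‖ ≤ ∫ ξ, ‖𝓕 w ξ‖ := by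
    have h2 : w x = 𝓕⁻ ⇑(𝓕 w : 𝓢(Space, ℂ)) x := by
      rw [← SchwartzMap.fourierInv_coe, FourierTransform.fourierInv_fourier_eq]
    rw [h2, fourierInv_eq_integral_wave]
    refine (norm_integral_le_integral_norm _).trans (le_of_eq ?_)
    exact integral_congr_ae (Eventually.of_forall fun ξ => by
      simp only [norm_mul, norm_wave, mul_one])
  have h3 : ∀ ξ, ‖𝓕 w ξ‖ ≤ (M * prof 0 (-2) (2 * Real.pi * ‖ξ‖) +
      M⁻¹ * ‖𝓕 (w - Δ w) ξ‖ ^ 2) / 2 := fun ξ => by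
    rw [fourier_sub_laplacian, norm_mul, Complex.norm_real, Real.norm_of_nonneg (by positivity),
      prof, Real.rpow_zero, one_mul, Real.rpow_neg (by positivity)]
    norm_cast
    have hp : 0 < 1 + (2 * Real.pi * ‖ξ‖) ^ 2 := by positivity
    generalize 1 + (2 * Real.pi * ‖ξ‖) ^ 2 = p at *
    generalize ‖𝓕 w ξ‖ = y at *
    have h4 := sq_nonneg (M * p⁻¹ - p * y)
    have h5 : p⁻¹ * p = 1 := inv_mul_cancel₀ hp.ne'
    have h6 : 2 * M * y ≤ M ^ 2 * (p ^ 2)⁻¹ + (p * y) ^ 2 := by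
      rw [← inv_pow]
      have h8 : M * p⁻¹ * (p * y) = M * y := by rw [mul_mul_mul_comm]; field_simp
      nlinarith
    rw [le_div_iff₀ two_pos, ← mul_le_mul_iff_right₀ hM]
    calc M * (y * 2) = 2 * M * y := by ring
      _ ≤ _ := h6
      _ = _ := by field_simp
  have hi := integrable_schwartz_sq (𝓕 (w - Δ w))
  refine h1.trans ((integral_mono (𝓕 w).integrable.norm
    (((hJ.const_mul M).add (hi.const_mul M⁻¹)).div_const 2) h3).trans ?_)
  simp only [Pi.add_apply]
  rw [integral_div, integral_add (hJ.const_mul M) (hi.const_mul M⁻¹), integral_const_mul,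
    integral_const_mul, SchwartzMap.integral_norm_sq_fourier]
  have h7 : M⁻¹ * ∫ x, ‖(w - Δ w) x‖ ^ 2 ≤ M := by
    rw [inv_mul_le_iff₀ hM, ← sq]
    exact hw
  linarith

theorem inv_one_add_norm_pow_le_prof (x : Space) : ((1 + ‖x‖) ^ 4)⁻¹ ≤ prof 0 (-2) ‖x‖ := by
  rw [prof, Real.rpow_zero, one_mul, Real.rpow_neg (by positivity)]
  norm_cast
  gcongr
  have := norm_nonneg x
  calc (1 + ‖x‖ ^ 2) ^ 2 ≤ ((1 + ‖x‖) ^ 2) ^ 2 := by gcongr; nlinarith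
    _ = _ := by ring

/-- The data norm of `(1 - Δ)` applied to the damped function is controlled by the `H²` norm,
uniformly in the regularization. -/
theorem exists_mass_damp_le : ∃ C : ℝ, 0 ≤ C ∧ ∀ (ε : ℝ) (w : 𝓢(Space, ℂ)) (M : ℝ), 0 < ε → 0 < M →
    ∫ x, ‖(w - Δ w) x‖ ^ 2 ≤ M ^ 2 → mass (damp ε w - Δ (damp ε w)) ≤ C * M := by
  obtain ⟨k, hk, hK⟩ := exists_norm_le_of_laplacian
  have i0 := integrable_prof_norm (α := 0) (β := -2) (by norm_num) (by norm_num)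
  have i1 := integrable_prof_norm (α := -1) (β := -2) (by norm_num) (by norm_num)
  have i2 := integrable_prof_norm (α := 0) (β := -4) (by norm_num) (by norm_num)
  have i3 := integrable_prof_norm (α := -2) (β := -4) (by norm_num) (by norm_num)
  have iQ := (i0.const_mul 60).add (i1.const_mul 12)
  have iR := (i2.const_mul (2 * 60 ^ 2)).add (i3.const_mul (2 * 12 ^ 2))
  set p : Space → ℝ := fun x => prof 0 (-2) ‖x‖ with hp
  set Q : Space → ℝ := fun x => 60 * prof 0 (-2) ‖x‖ + 12 * prof (-1) (-2) ‖x‖ with hQ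
  set R : Space → ℝ := fun x => 2 * 60 ^ 2 * prof 0 (-4) ‖x‖ + 2 * 12 ^ 2 * prof (-2) (-4) ‖x‖
    with hR
  have hp0 : ∀ x, 0 ≤ p x := fun x => prof_nonneg _ _ (norm_nonneg x)
  have hQ0 : ∀ x, 0 ≤ Q x := fun x => add_nonneg
    (mul_nonneg (by norm_num) (prof_nonneg _ _ (norm_nonneg x)))
    (mul_nonneg (by norm_num) (prof_nonneg _ _ (norm_nonneg x)))
  have hR0 : ∀ x, 0 ≤ R x := fun x => add_nonneg
    (mul_nonneg (by norm_num) (prof_nonneg _ _ (norm_nonneg x)))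
    (mul_nonneg (by norm_num) (prof_nonneg _ _ (norm_nonneg x)))
  have hQR : ∀ x, x ≠ 0 → Q x ^ 2 ≤ R x := fun x hx => by
    have hx' := norm_pos_iff.2 hx
    have e1 : prof 0 (-4) ‖x‖ = prof 0 (-2) ‖x‖ ^ 2 := by
      rw [sq, prof_mul_prof _ _ _ _ hx']; norm_num
    have e2 : prof (-2) (-4) ‖x‖ = prof (-1) (-2) ‖x‖ ^ 2 := by
      rw [sq, prof_mul_prof _ _ _ _ hx']; norm_num
    simp only [hQ, hR, e1, e2]
    nlinarith [sq_nonneg (60 * prof 0 (-2) ‖x‖ - 12 * prof (-1) (-2) ‖x‖)]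
  have hpi : 0 ≤ ∫ x, p x := integral_nonneg hp0
  have hQi : 0 ≤ ∫ x, Q x := integral_nonneg hQ0
  have hRi : 0 ≤ ∫ x, R x := integral_nonneg hR0
  refine ⟨((∫ x, p x) + 772) / 2 + k * (∫ x, Q x) + √(1544 + 2 * k ^ 2 * ∫ x, R x),
    by positivity, fun ε w M hε hM hw => ?_⟩
  set b := EuclideanSpace.basisFun (Fin 3) ℝ with hb
  set S : Space → ℝ := fun x => ‖(w - Δ w) x‖ ^ 2 + 64 * ∑ j, ‖∂_{b j} w x‖ ^ 2 with hS
  have iS : Integrable S := (integrable_schwartz_sq _).add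
    ((integrable_finsetSum _ fun j _ => integrable_schwartz_sq (∂_{b j} w)).const_mul 64)
  have hSi : ∫ x, S x ≤ 193 * M ^ 2 := by
    rw [hS, integral_add (integrable_schwartz_sq _)
      ((integrable_finsetSum _ fun j _ => integrable_schwartz_sq (∂_{b j} w)).const_mul 64),
      integral_const_mul, integral_finsetSum _ fun j _ => integrable_schwartz_sq (∂_{b j} w),
      Fin.sum_univ_three]
    have h1 := fun j => (integral_lineDeriv_sq_le w (b.norm_eq_one j)).trans hw
    linarith [h1 0, h1 1, h1 2]
  have hpt : ∀ x, x ≠ 0 → ‖(damp ε w - Δ (damp ε w)) x‖ ≤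
      (M * p x + M⁻¹ * (4 * S x)) / 2 + k * M * Q x ∧
      ‖(damp ε w - Δ (damp ε w)) x‖ ^ 2 ≤ 8 * S x + 2 * (k * M) ^ 2 * R x := fun x hx => by
    have h0 := norm_damp_sub_laplacian_le hε w hx
    rw [← hb] at h0
    have hω : 0 ≤ ((1 + ‖x‖) ^ 4)⁻¹ := by positivity
    have hω1 := inv_one_add_norm_pow_le_one x
    have hωp : ((1 + ‖x‖) ^ 4)⁻¹ ≤ p x := inv_one_add_norm_pow_le_prof x
    have hx' := norm_pos_iff.2 hx
    have hq : ((1 + ‖x‖) ^ 4)⁻¹ * (60 + 12 * ‖x‖⁻¹) ≤ Q x := by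
      have e1 : prof (-1) (-2) ‖x‖ = ‖x‖⁻¹ * p x := by
        simp only [hp, prof, Real.rpow_neg_one, Real.rpow_zero, one_mul]
      calc _ ≤ p x * (60 + 12 * ‖x‖⁻¹) := by gcongr
        _ = Q x := by simp only [hQ]; rw [e1]; ring
    have hwx := hK w M hM hw x
    have hG : (‖(w - Δ w) x‖ + 8 * ∑ j, ‖∂_{b j} w x‖) ^ 2 ≤ 4 * S x := by
      simp only [hS, Fin.sum_univ_three]
      generalize ‖(w - Δ w) x‖ = a
      generalize ‖∂_{b 0} w x‖ = a₀
      generalize ‖∂_{b 1} w x‖ = a₁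
      generalize ‖∂_{b 2} w x‖ = a₂
      nlinarith [sq_nonneg (a - 8 * a₀), sq_nonneg (a - 8 * a₁), sq_nonneg (a - 8 * a₂),
        sq_nonneg (a₀ - a₁), sq_nonneg (a₀ - a₂), sq_nonneg (a₁ - a₂)]
    have hG0 : 0 ≤ ‖(w - Δ w) x‖ + 8 * ∑ j, ‖∂_{b j} w x‖ := by positivity
    have hR' := hQR x hx
    have hQ' := hQ0 x
    generalize ‖(w - Δ w) x‖ + 8 * ∑ j, ‖∂_{b j} w x‖ = G at *
    have h2 : ((1 + ‖x‖) ^ 4)⁻¹ * (60 + 12 * ‖x‖⁻¹) * ‖w x‖ ≤ k * M * Q x := by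
      rw [mul_comm (k * M)]
      gcongr
    generalize ((1 + ‖x‖) ^ 4)⁻¹ = θ at *
    constructor
    · have h3 : θ * G ≤ (M * p x + M⁻¹ * (4 * S x)) / 2 := by
        rw [le_div_iff₀ two_pos, ← mul_le_mul_iff_right₀ hM]
        have h4 : M * (M * p x + M⁻¹ * (4 * S x)) = M ^ 2 * p x + 4 * S x := by field_simp
        rw [h4]
        have h5 : θ ^ 2 ≤ p x := by nlinarith
        nlinarith [sq_nonneg (M * θ - G), mul_le_mul_of_nonneg_left h5 (sq_nonneg M)]
      linarith
    · have h3 : θ * G ≤ G := mul_le_of_le_one_left hG0 hω1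
      have h6 : ‖(damp ε w - Δ (damp ε w)) x‖ ≤ G + k * M * Q x := by linarith
      calc _ ≤ (G + k * M * Q x) ^ 2 := by gcongr
        _ ≤ 2 * G ^ 2 + 2 * (k * M) ^ 2 * Q x ^ 2 := by nlinarith [sq_nonneg (G - k * M * Q x)]
        _ ≤ 2 * (4 * S x) + 2 * (k * M) ^ 2 * R x := by gcongr
        _ = _ := by ring
  have hne : ∀ᵐ x : Space, x ≠ 0 := by simp [ae_iff]
  have hL1 : ∫ x, ‖(damp ε w - Δ (damp ε w)) x‖ ≤
      (((∫ x, p x) + 772) / 2 + k * (∫ x, Q x)) * M := by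
    have j1 := ((i0.const_mul M).add ((iS.const_mul 4).const_mul M⁻¹)).div_const 2
    have j2 := iQ.const_mul (k * M)
    refine (integral_mono_ae (damp ε w - Δ (damp ε w)).integrable.norm (j1.add j2)
      (by filter_upwards [hne] with x hx using (hpt x hx).1)).trans ?_
    rw [integral_add' j1 j2]
    simp only [Pi.add_apply]
    rw [integral_div, integral_add (i0.const_mul M) ((iS.const_mul 4).const_mul M⁻¹),
      integral_const_mul, integral_const_mul, integral_const_mul, integral_const_mul]
    have h7 : M⁻¹ * (4 * ∫ x, S x) ≤ 772 * M := by
      rw [inv_mul_le_iff₀ hM]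
      nlinarith
    change (M * (∫ x, p x) + M⁻¹ * (4 * ∫ x, S x)) / 2 + k * M * (∫ x, Q x) ≤ _
    linarith
  have hL2 : ∫ x, ‖(damp ε w - Δ (damp ε w)) x‖ ^ 2 ≤ (1544 + 2 * k ^ 2 * ∫ x, R x) * M ^ 2 := by
    have j1 := iS.const_mul 8
    have j2 := iR.const_mul (2 * (k * M) ^ 2)
    refine (integral_mono_ae (integrable_schwartz_sq _) (j1.add j2)
      (by filter_upwards [hne] with x hx using (hpt x hx).2)).trans ?_
    rw [integral_add' j1 j2, integral_const_mul, integral_const_mul]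
    change 8 * (∫ x, S x) + 2 * (k * M) ^ 2 * (∫ x, R x) ≤ _
    nlinarith
  have hsq : √(∫ x, ‖(damp ε w - Δ (damp ε w)) x‖ ^ 2) ≤
      √(1544 + 2 * k ^ 2 * ∫ x, R x) * M := by
    refine (Real.sqrt_le_sqrt hL2).trans (le_of_eq ?_)
    rw [Real.sqrt_mul (by positivity), Real.sqrt_sq hM.le]
  rw [mass]
  linarith

/-! ### Decay for weighted data -/

theorem memLp_smoothing :
    MemLp (fun ξ : Space => (prof 0 (-1) (2 * Real.pi * ‖ξ‖) : ℂ)) ∞ volume := by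
  refine memLp_top_of_bound (by
    have : Measurable fun ξ : Space => (prof 0 (-1) (2 * Real.pi * ‖ξ‖) : ℂ) := by fun_prop
    exact this.aestronglyMeasurable) 1 ?_
  filter_upwards [ae_norm_pos] with ξ hξ
  rw [Complex.norm_real, Real.norm_of_nonneg (prof_nonneg _ _ hξ.le)]
  exact prof_le_one (by norm_num) (by norm_num) hξ

theorem memLp_weight (ε : ℝ) : MemLp (fun x : Space => (weight ε x : ℂ)) ∞ volume := by
  refine memLp_top_of_bound
    (Complex.continuous_ofReal.comp (continuous_weight ε)).aestronglyMeasurable 1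
    (Eventually.of_forall fun x => ?_)
  rw [Complex.norm_real, Real.norm_of_nonneg (weight_nonneg ε x)]
  exact (weight_le ε x).trans (inv_one_add_norm_pow_le_one x)

/-- The operator `g ↦ weight ε · (1 - Δ)⁻¹ 𝓕⁻¹ g`, recovering the data from the frequency
representation of its weighted `H²` norm. -/
def recover (ε : ℝ) : L2 →L[ℂ] L2 :=
  ((mulL2 (memLp_weight ε)).comp ((Lp.fourierTransformₗᵢ Space ℂ).symm : L2 →L[ℂ] L2)).comp
    (mulL2 memLp_smoothing)

theorem recover_apply (ε : ℝ) {g v : L2} (h : (𝓕 v : L2) =ᵐ[volume]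
    fun ξ => (prof 0 (-1) (2 * Real.pi * ‖ξ‖) : ℂ) * g ξ) :
    recover ε g = mulL2 (memLp_weight ε) v := by
  have h1 : (𝓕 v : L2) = mulL2 memLp_smoothing g := Lp.ext (h.trans (coeFn_mulL2 _ _).symm)
  have h2 : (Lp.fourierTransformₗᵢ Space ℂ).symm (mulL2 memLp_smoothing g) = v := by
    rw [← h1]
    exact (Lp.fourierTransformₗᵢ Space ℂ).symm_apply_apply v
  exact congrArg (mulL2 (memLp_weight ε)) h2

theorem recover_schwartz {ε : ℝ} (hε : 0 < ε) (g : 𝓢(Space, ℂ)) :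
    ∃ w : 𝓢(Space, ℂ), 𝓕 (w - Δ w) = g ∧
      recover ε (g.toLp 2 volume) = (damp ε w).toLp 2 volume := by
  have hg : (fun ξ : Space => prof 0 (-1) (2 * Real.pi * ‖ξ‖)).HasTemperateGrowth := by
    have h1 := (Function.hasTemperateGrowth_one_add_norm_sq_rpow Space (-1)).comp
      ((2 * Real.pi) • ContinuousLinearMap.id ℝ Space).hasTemperateGrowth
    refine (congrArg Function.HasTemperateGrowth (funext fun ξ => ?_)).mpr h1
    simp [prof, norm_smul, abs_of_pos Real.pi_pos]
  let w : 𝓢(Space, ℂ) := 𝓕⁻ (SchwartzMap.smulLeftCLM ℂ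
    (fun ξ : Space => prof 0 (-1) (2 * Real.pi * ‖ξ‖)) g)
  have hw : ∀ ξ, 𝓕 w ξ = (prof 0 (-1) (2 * Real.pi * ‖ξ‖) : ℂ) * g ξ := fun ξ => by
    rw [FourierTransform.fourier_fourierInv_eq, SchwartzMap.smulLeftCLM_apply_apply hg,
      Complex.real_smul]
  refine ⟨w, ?_, ?_⟩
  · ext ξ
    rw [fourier_sub_laplacian, hw, ← mul_assoc, ← Complex.ofReal_mul]
    have : (1 + (2 * Real.pi * ‖ξ‖) ^ 2) * prof 0 (-1) (2 * Real.pi * ‖ξ‖) = 1 := by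
      rw [prof, Real.rpow_zero, one_mul, Real.rpow_neg_one, mul_inv_cancel₀ (by positivity)]
    rw [this, Complex.ofReal_one, one_mul]
  · rw [recover_apply ε (v := w.toLp 2 volume)]
    · refine Lp.ext ?_
      filter_upwards [coeFn_mulL2 (memLp_weight ε) (w.toLp 2 volume), w.coeFn_toLp 2 volume,
        (damp ε w).coeFn_toLp 2 volume] with x h1 h2 h3
      rw [h1, h2, h3, damp_apply hε, Complex.real_smul]
    · rw [SchwartzMap.toLp_fourier_eq]
      filter_upwards [(𝓕 w).coeFn_toLp 2 volume, g.coeFn_toLp 2 volume] with ξ h1 h2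
      rw [h1, h2, hw]

theorem exists_recover_decay :
    ∃ C : ℝ, 0 ≤ C ∧ ∀ (P : Space) (t : ℝ≥0) (ε M : ℝ), 0 < ε → 0 < M → ∀ g : L2 × L2,
      ‖g.1‖ < M → ‖g.2‖ < M →
      supNorm (semigroup P t (recover ε g.1, recover ε g.2)) ≤
        ENNReal.ofReal (C * (1 + (t : ℝ))⁻¹ * M) := by
  obtain ⟨C₁, hC₁, h₁⟩ := exists_supNorm_semigroup_le
  obtain ⟨C₂, hC₂, h₂⟩ := exists_mass_damp_le
  refine ⟨2 * C₁ * C₂, by positivity, fun P t ε M hε hM => ?_⟩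
  set B : ℝ := 2 * C₁ * C₂ * (1 + (t : ℝ))⁻¹ * M with hB
  have hcont : Continuous fun g : L2 × L2 => semigroup P t (recover ε g.1, recover ε g.2) := by
    fun_prop
  -- the bound is a closed condition, so that it suffices to treat Schwartz functions
  have hcl := (isClosed_supNorm_le (B := B) (by positivity)).preimage hcont
  have hdense : Dense (Set.range (Prod.map (SchwartzMap.toLpCLM ℝ ℂ 2 (volume : Measure Space))
      (SchwartzMap.toLpCLM ℝ ℂ 2 (volume : Measure Space)))) :=
    (SchwartzMap.denseRange_toLpCLM (p := 2) (by norm_num)).prodMap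
      (SchwartzMap.denseRange_toLpCLM (p := 2) (by norm_num))
  have hopen : IsOpen {g : L2 × L2 | ‖g.1‖ < M ∧ ‖g.2‖ < M} :=
    (isOpen_lt continuous_fst.norm continuous_const).inter
      (isOpen_lt continuous_snd.norm continuous_const)
  intro g hg1 hg2
  refine closure_minimal ?_ hcl (hdense.open_subset_closure_inter hopen ⟨hg1, hg2⟩)
  rintro _ ⟨⟨hg1, hg2⟩, ⟨g₁, g₂⟩, rfl⟩
  have hg1 : ‖g₁.toLp 2 volume‖ < M := hg1
  have hg2 : ‖g₂.toLp 2 volume‖ < M := hg2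
  obtain ⟨w₁, hw₁, hr₁⟩ := recover_schwartz hε g₁
  obtain ⟨w₂, hw₂, hr₂⟩ := recover_schwartz hε g₂
  have hmass : ∀ {g w : 𝓢(Space, ℂ)}, ‖g.toLp 2 volume‖ < M → 𝓕 (w - Δ w) = g →
      mass (damp ε w - Δ (damp ε w)) ≤ C₂ * M := fun {g w} hg hw => by
    refine h₂ ε w M hε hM ?_
    rw [← SchwartzMap.integral_norm_sq_fourier, hw]
    have h3 : ∫ x, ‖g x‖ ^ 2 = ‖g.toLp 2 volume‖ ^ 2 := by
      rw [norm_sq_L2_eq]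
      exact integral_congr_ae (by
        filter_upwards [g.coeFn_toLp 2 volume] with x hx
        rw [hx])
    rw [h3]
    gcongr
  have hfour : ∀ w : 𝓢(Space, ℂ), (𝓕 ((damp ε w).toLp 2 volume) : L2) =ᵐ[volume]
      fun ξ => (prof 0 (-1) (2 * Real.pi * ‖ξ‖) : ℂ) * 𝓕 (damp ε w - Δ (damp ε w)) ξ := fun w => by
    rw [SchwartzMap.toLp_fourier_eq]
    filter_upwards [(𝓕 (damp ε w)).coeFn_toLp 2 volume] with ξ h
    have : prof 0 (-1) (2 * Real.pi * ‖ξ‖) * (1 + (2 * Real.pi * ‖ξ‖) ^ 2) = 1 := by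
      rw [prof, Real.rpow_zero, one_mul, Real.rpow_neg_one, inv_mul_cancel₀ (by positivity)]
    rw [h, fourier_sub_laplacian, ← mul_assoc, ← Complex.ofReal_mul, this, Complex.ofReal_one,
      one_mul]
  change supNorm (semigroup P t (recover ε (g₁.toLp 2 volume), recover ε (g₂.toLp 2 volume))) ≤ _
  rw [hr₁, hr₂]
  refine (h₁ P _ _ ((damp ε w₁).toLp 2 volume, (damp ε w₂).toLp 2 volume) (hfour w₁) (hfour w₂)
    t).trans (ENNReal.ofReal_le_ofReal ?_)
  have h4 := hmass hg1 hw₁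
  have h5 := hmass hg2 hw₂
  calc C₁ * (1 + (t : ℝ))⁻¹ * (mass (damp ε w₁ - Δ (damp ε w₁)) + mass (damp ε w₂ - Δ (damp ε w₂)))
      ≤ C₁ * (1 + (t : ℝ))⁻¹ * (C₂ * M + C₂ * M) := by gcongr
    _ = B := by rw [hB]; ring

/-- The regularization of the weight can be removed in `L²`. -/
theorem tendsto_mulL2_weight (v : L2) :
    Tendsto (fun ε => mulL2 (memLp_weight ε) v) (𝓝[>] 0) (𝓝 (mulL2 (memLp_weight 0) v)) := by
  refine tendsto_L2_of_dominated (g := fun x => 2 * ‖v x‖) (fun ε => coeFn_mulL2 _ _)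
    (coeFn_mulL2 _ _) ((Lp.memLp v).norm.const_mul 2)
    (Eventually.of_forall fun ε => Eventually.of_forall fun x => ?_)
    (Eventually.of_forall fun x => ?_)
  · rw [← sub_mul, norm_mul]
    gcongr
    have h : ∀ ε, ‖(weight ε x : ℂ)‖ ≤ 1 := fun ε => by
      rw [Complex.norm_real, Real.norm_of_nonneg (weight_nonneg ε x)]
      exact (weight_le ε x).trans (inv_one_add_norm_pow_le_one x)
    linarith [norm_sub_le (weight ε x : ℂ) (weight 0 x), h ε, h 0]
  · exact ((Complex.continuous_ofReal.tendsto _).comp (tendsto_weight x)).mul_const _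

theorem sobolevNorm_le_pair (s : ℝ) (w : State) :
    sobolevNorm s w.1 ≤ sobolevNormPair s w ∧ sobolevNorm s w.2 ≤ sobolevNormPair s w := by
  have h : ∀ a : ℝ≥0∞, (a ^ 2) ^ (1 / 2 : ℝ) = a := fun a => by
    rw [← ENNReal.rpow_natCast, ← ENNReal.rpow_mul]; norm_num
  unfold sobolevNormPair
  constructor
  · nth_rewrite 1 [← h (sobolevNorm s w.1)]
    gcongr
    exact le_self_add
  · nth_rewrite 1 [← h (sobolevNorm s w.2)]
    gcongr
    exact le_add_self

/-- A function of finite `H²` norm is `(1 - Δ)⁻¹` of an `L²` function with that norm. -/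
theorem exists_fourier_eq_smoothing {v : L2} {M : ℝ} (hM : sobolevNorm 2 v < ENNReal.ofReal M) :
    ∃ g : L2, ‖g‖ < M ∧ (𝓕 v : L2) =ᵐ[volume]
      fun ξ => (prof 0 (-1) (2 * Real.pi * ‖ξ‖) : ℂ) * g ξ := by
  have hmeas : AEStronglyMeasurable (fun ξ : Space =>
      (((1 + (2 * Real.pi * ‖ξ‖) ^ 2) ^ ((2 : ℝ) / 2) : ℝ) : ℂ) * (𝓕 v : L2) ξ) volume := by
    have h1 : Measurable fun ξ : Space => (((1 + (2 * Real.pi * ‖ξ‖) ^ 2) ^ ((2 : ℝ) / 2) : ℝ) : ℂ) := by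
      fun_prop
    exact h1.aestronglyMeasurable.mul (Lp.aestronglyMeasurable _)
  have hmem : MemLp (fun ξ : Space =>
      (((1 + (2 * Real.pi * ‖ξ‖) ^ 2) ^ ((2 : ℝ) / 2) : ℝ) : ℂ) * (𝓕 v : L2) ξ) 2 volume :=
    ⟨hmeas, hM.trans ENNReal.ofReal_lt_top⟩
  refine ⟨hmem.toLp _, ?_, ?_⟩
  · rw [Lp.norm_toLp]
    exact ENNReal.toReal_lt_of_lt_ofReal hM
  · filter_upwards [hmem.coeFn_toLp] with ξ h
    have : prof 0 (-1) (2 * Real.pi * ‖ξ‖) * (1 + (2 * Real.pi * ‖ξ‖) ^ 2) ^ ((2 : ℝ) / 2) = 1 := by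
      rw [prof, Real.rpow_zero, one_mul, Real.rpow_neg_one, div_self two_ne_zero, Real.rpow_one,
        inv_mul_cancel₀ (by positivity)]
    rw [h, ← mul_assoc, ← Complex.ofReal_mul, this, Complex.ofReal_one, one_mul]

/-- Decay of the flow for weighted `H²` data. -/
theorem exists_weighted_decay :
    ∃ C : ℝ, 0 < C ∧ ∀ (P : Space) (η w : State), IsWeighted η w → ∀ t : ℝ≥0,
      supNorm (semigroup P t η) ≤
        ENNReal.ofReal (C * (1 + (t : ℝ))⁻¹) * sobolevNormPair 2 w := by
  obtain ⟨C, hC, h⟩ := exists_recover_decay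
  refine ⟨C + 1, by positivity, fun P η w hηw t => ?_⟩
  have hc : 0 < (C + 1) * (1 + (t : ℝ))⁻¹ := by positivity
  rcases eq_or_ne (sobolevNormPair 2 w) ∞ with htop | htop
  · rw [htop, ENNReal.mul_top (by simpa using hc)]
    exact le_top
  have hη : ∀ {e v : L2}, (∀ᵐ x, v x = (((1 + ‖x‖) ^ 4 : ℝ) : ℂ) * e x) →
      mulL2 (memLp_weight 0) v = e := fun {e v} hev => by
    refine Lp.ext ?_
    filter_upwards [coeFn_mulL2 (memLp_weight 0) v, hev] with x h1 h2
    rw [h1, h2, weight_zero, ← mul_assoc, ← Complex.ofReal_mul, inv_mul_cancel₀ (by positivity),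
      Complex.ofReal_one, one_mul]
  have key : ∀ M : ℝ, (sobolevNormPair 2 w).toReal < M →
      supNorm (semigroup P t η) ≤ ENNReal.ofReal ((C + 1) * (1 + (t : ℝ))⁻¹ * M) := fun M hM => by
    have hM0 : 0 < M := ENNReal.toReal_nonneg.trans_lt hM
    have hM' : sobolevNormPair 2 w < ENNReal.ofReal M := (ENNReal.lt_ofReal_iff_toReal_lt htop).2 hM
    obtain ⟨g₁, hg₁, hf₁⟩ := exists_fourier_eq_smoothing ((sobolevNorm_le_pair 2 w).1.trans_lt hM')
    obtain ⟨g₂, hg₂, hf₂⟩ := exists_fourier_eq_smoothing ((sobolevNorm_le_pair 2 w).2.trans_lt hM')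
    have hlim : Tendsto (fun ε => semigroup P t (recover ε g₁, recover ε g₂)) (𝓝[>] 0)
        (𝓝 (semigroup P t η)) := by
      refine ((semigroup P t).continuous.tendsto η).comp (Prod.tendsto_iff _ _ |>.2 ⟨?_, ?_⟩)
      · simp only [recover_apply _ hf₁]
        simpa only [hη hηw.1] using tendsto_mulL2_weight w.1
      · simp only [recover_apply _ hf₂]
        simpa only [hη hηw.2] using tendsto_mulL2_weight w.2
    refine (isClosed_supNorm_le (by positivity)).mem_of_tendsto hlim ?_
    filter_upwards [self_mem_nhdsWithin] with ε hε
    refine (h P t ε M hε hM0 (g₁, g₂) hg₁ hg₂).trans (ENNReal.ofReal_le_ofReal ?_)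
    gcongr
    linarith
  have hlim : Tendsto (fun M : ℝ => ENNReal.ofReal ((C + 1) * (1 + (t : ℝ))⁻¹ * M))
      (𝓝[>] (sobolevNormPair 2 w).toReal)
      (𝓝 (ENNReal.ofReal ((C + 1) * (1 + (t : ℝ))⁻¹ * (sobolevNormPair 2 w).toReal))) :=
    ((ENNReal.continuous_ofReal.comp (by fun_prop)).tendsto _).mono_left nhdsWithin_le_nhds
  have h2 := ge_of_tendsto hlim (by filter_upwards [self_mem_nhdsWithin] with M hM using key M hM)
  rwa [ENNReal.ofReal_mul hc.le, ENNReal.ofReal_toReal htop] at h2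

end

end Bogoliubov

theorem mainTheorem5 :
    ∃ T : Bogoliubov.Space → ℝ≥0 → Bogoliubov.State →L[ℂ] Bogoliubov.State,
      (∀ P : Bogoliubov.Space, ‖P‖ = 1 →
        Bogoliubov.IsSemigroupGeneratedBy (Bogoliubov.H P) (T P) ∧
        (Bogoliubov.H P).toFun.ker = ⊥) ∧
      (∃ C : ℝ, 0 < C ∧ ∀ P : Bogoliubov.Space, ‖P‖ = 1 →
        ∀ η w : Bogoliubov.State, Bogoliubov.IsWeighted η w → ∀ t : ℝ≥0,
          Bogoliubov.supNorm (T P t η) ≤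
            ENNReal.ofReal (C * (1 + (t : ℝ))⁻¹) * Bogoliubov.sobolevNormPair 2 w) ∧
      (∀ n : ℝ, 3 / 4 ≤ n → ∀ V : Bogoliubov.Space → ℝ, Bogoliubov.IsAdmissible V →
        ∃ C : ℝ, 0 < C ∧ ∀ P : Bogoliubov.Space, ‖P‖ = 1 → ∀ Y : Bogoliubov.Space,
          (∃ hW : MemLp (Bogoliubov.shifted n V Y) 2 volume,
            ∃ hD : Bogoliubov.lower hW ∈ (Bogoliubov.H P).inverse.domain,
              ∀ t : ℝ≥0,
                Bogoliubov.supNorm (T P t ((Bogoliubov.H P).inverse ⟨Bogoliubov.lower hW, hD⟩)) ≤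
                  ENNReal.ofReal (C * (1 + (t : ℝ))⁻¹)) ∧
          Differentiable ℝ (Bogoliubov.shifted n V Y) ∧
          ∀ j : Fin 3,
            ∃ hW : MemLp (Bogoliubov.shiftedDeriv n V Y j) 2 volume,
              ∃ hD : Bogoliubov.lower hW ∈ (Bogoliubov.H P).inverse.domain,
                ∀ t : ℝ≥0,
                  Bogoliubov.supNorm
                      (T P t ((Bogoliubov.H P).inverse ⟨Bogoliubov.lower hW, hD⟩)) ≤
                    ENNReal.ofReal (C * (1 + (t : ℝ))⁻¹)) := by
  refine ⟨Bogoliubov.semigroup, fun P hP =>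
    ⟨Bogoliubov.isSemigroupGeneratedBy_semigroup P, Bogoliubov.ker_H hP⟩, ?_,
    fun n hn V hV => Bogoliubov.exists_potential_decay hn hV⟩
  obtain ⟨C, hC, h⟩ := Bogoliubov.exists_weighted_decay
  exact ⟨C, hC, fun P _ => h P⟩
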